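/- Let $H^4=H^4(\mathbb R^2)$ be the real Sobolev space with $(u,w)_{H^4}=\sum_{|\alpha|\le 4}(\partial^\alpha u,\partial^\alpha w)_{L^2}$, write points of $\mathbb R^2$ as $\tilde y=(x,y)$, and let $\langle \delta\tilde y\rangle=(1+\delta^2(x^2+y^2))^{1/2}$. There are constants $\varepsilon_0>0$ and $\delta_0>0$, and for every $T>0$ a constant $B_0>0$ (depending only on $T$), such that the following holds for all $v_0\in H^4$ and $g\in L^\infty([0,T];H^4)$ with $$\|g\|_{L^\infty([0,T];H^4)}\le\varepsilon_0,\qquad \|v_0\|_{H^4}\le\varepsilon_0 .$$ 1. The Cauchy problem $$\partial_t v+y\,\partial_x v-(1+g)^2\partial_y^2 v=0,\qquad v|_{t=0}=v_0,$$ has a weak solution $v\in L^\infty(]0,T];H^4)$, and it is unique up to null sets of times. Here weak solution means: for every $\varphi\in C_c^\infty([0,T[\times\mathbb R^2)$, $$\int_0^T\!\!\int_{\mathbb R^2}\Big(-v\,\partial_t\varphi+\big(y\,\partial_x v-(1+g)^2\partial_y^2 v\big)\varphi\Big)\,dx\,dy\,dt=\int_{\mathbb R^2}v_0\,\varphi(0)\,dx\,dy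 .$$ The solution has a representative, again denoted $v$, that is continuous on $[0,T]$ for the weak topology of $H^4$, with $v(0)=v_0$. 2. For this representative, $\partial_y v\in L^2(]0,T];H^4)$ and $$\|v(t)\|_{H^4}^2+\frac14\int_0^t\|\partial_y v(s)\|_{H^4}^2\,ds\le B_0\|v_0\|_{H^4}^2,\qquad 0<t\le T .$$ 3. For every $0<\delta\le\delta_0$ the modified problem $$\partial_t v_\delta+\langle\delta\tilde y\rangle^{-1}y\,\partial_x\big(\langle\delta\tilde y\rangle^{-1}v_\delta\big)-\langle\delta\tilde y\rangle^{-1}(1+g)^2\partial_y^2\big(\langle\delta\tilde y\rangle^{-1}v_\delta\big)=0,\qquad v_\delta|_{t=0}=\langle\delta\tilde y\rangle^{-1}v_0,$$ has a unique weak solution $v_\delta\in L^\infty(]0,T];H^4)$ (in the same sense), represented by its weakly continuous version on $[0,T]$, and for every $t\in[0,T]$, $v_\delta(t)\to v(t)$ weakly in $H^4$ as $\delta\to0+$. -/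

import Mathlib

open MeasureTheory Set Filter Topology
open scoped ENNReal ContDiff

noncomputable section

/-! Points of the plane are pairs `p = (x, y)`, with Lebesgue measure on `ℝ × ℝ`. -/

/-- The classical partial derivative `∂_x φ`. -/
def partialX (φ : ℝ × ℝ → ℝ) : ℝ × ℝ → ℝ := fun p => fderiv ℝ φ p (1, 0)

/-- The classical partial derivative `∂_y φ`. -/
def partialY (φ : ℝ × ℝ → ℝ) : ℝ × ℝ → ℝ := fun p => fderiv ℝ φ p (0, 1)

/-- The classical partial derivative `∂_x^a ∂_y^b φ`. -/
def partialXY (a b : ℕ) (φ : ℝ × ℝ → ℝ) : ℝ × ℝ → ℝ := partialX^[a] (partialY^[b] φ)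

lemma contDiff_partialX {φ : ℝ × ℝ → ℝ} (h : ContDiff ℝ ∞ φ) : ContDiff ℝ ∞ (partialX φ) :=
  (h.fderiv_right (m := ∞) (by simp)).clm_apply contDiff_const

lemma contDiff_partialY {φ : ℝ × ℝ → ℝ} (h : ContDiff ℝ ∞ φ) : ContDiff ℝ ∞ (partialY φ) :=
  (h.fderiv_right (m := ∞) (by simp)).clm_apply contDiff_const

lemma hasCompactSupport_partialX {φ : ℝ × ℝ → ℝ} (h : HasCompactSupport φ) :
    HasCompactSupport (partialX φ) :=
  h.fderiv_apply (𝕜 := ℝ) (1, 0)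

lemma hasCompactSupport_partialY {φ : ℝ × ℝ → ℝ} (h : HasCompactSupport φ) :
    HasCompactSupport (partialY φ) :=
  h.fderiv_apply (𝕜 := ℝ) (0, 1)

lemma partialXY_test (a b : ℕ) {φ : ℝ × ℝ → ℝ} (h : ContDiff ℝ ∞ φ) (hc : HasCompactSupport φ) :
    ContDiff ℝ ∞ (partialXY a b φ) ∧ HasCompactSupport (partialXY a b φ) := by
  have hb : ContDiff ℝ ∞ (partialY^[b] φ) ∧ HasCompactSupport (partialY^[b] φ) := by
    induction b with
    | zero => exact ⟨h, hc⟩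
    | succ n ih =>
      rw [Function.iterate_succ_apply']
      exact ⟨contDiff_partialY ih.1, hasCompactSupport_partialY ih.2⟩
  unfold partialXY
  induction a with
  | zero => exact hb
  | succ n ih =>
    rw [Function.iterate_succ_apply']
    exact ⟨contDiff_partialX ih.1, hasCompactSupport_partialX ih.2⟩

/-- `w` is the weak derivative `∂_x^a ∂_y^b u` on the plane. -/
structure HasWeakDeriv (a b : ℕ) (u w : ℝ × ℝ → ℝ) : Prop where
  locallyIntegrable_left : LocallyIntegrable u
  locallyIntegrable_right : LocallyIntegrable w
  integral_eq : ∀ φ : ℝ × ℝ → ℝ, ContDiff ℝ ∞ φ → HasCompactSupport φ →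
    ∫ p, u p * partialXY a b φ p = (-1) ^ (a + b) * ∫ p, w p * φ p

lemma integrable_mul_test {u φ : ℝ × ℝ → ℝ} (hu : LocallyIntegrable u) (h : ContDiff ℝ ∞ φ)
    (hc : HasCompactSupport φ) : Integrable (fun p => u p * φ p) := by
  simpa [smul_eq_mul, mul_comm] using hu.integrable_smul_left_of_hasCompactSupport h.continuous hc

lemma HasWeakDeriv.add {a b : ℕ} {u w u' w' : ℝ × ℝ → ℝ} (h : HasWeakDeriv a b u w)
    (h' : HasWeakDeriv a b u' w') : HasWeakDeriv a b (u + u') (w + w') where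
  locallyIntegrable_left := h.1.add h'.1
  locallyIntegrable_right := h.2.add h'.2
  integral_eq φ hφ hc := by
    have ht := partialXY_test a b hφ hc
    simp only [Pi.add_apply, add_mul]
    rw [integral_add (integrable_mul_test h.1 ht.1 ht.2) (integrable_mul_test h'.1 ht.1 ht.2),
      integral_add (integrable_mul_test h.2 hφ hc) (integrable_mul_test h'.2 hφ hc),
      h.3 φ hφ hc, h'.3 φ hφ hc, mul_add]

lemma HasWeakDeriv.smul {a b : ℕ} {u w : ℝ × ℝ → ℝ} (c : ℝ) (h : HasWeakDeriv a b u w) :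
    HasWeakDeriv a b (c • u) (c • w) where
  locallyIntegrable_left := h.1.smul c
  locallyIntegrable_right := h.2.smul c
  integral_eq φ hφ hc := by
    simp only [Pi.smul_apply, smul_eq_mul, mul_assoc]
    rw [integral_const_mul, integral_const_mul, h.3 φ hφ hc]
    ring

lemma HasWeakDeriv.congr {a b : ℕ} {u w u' w' : ℝ × ℝ → ℝ} (h : HasWeakDeriv a b u w)
    (hu : u =ᵐ[volume] u') (hw : w =ᵐ[volume] w') : HasWeakDeriv a b u' w' where
  locallyIntegrable_left := h.1.congr hu
  locallyIntegrable_right := h.2.congr hw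
  integral_eq φ hφ hc := by
    have e1 : ∫ p, u' p * partialXY a b φ p = ∫ p, u p * partialXY a b φ p :=
      integral_congr_ae (by filter_upwards [hu] with p hp; rw [hp])
    have e2 : ∫ p, w' p * φ p = ∫ p, w p * φ p :=
      integral_congr_ae (by filter_upwards [hw] with p hp; rw [hp])
    rw [e1, e2, h.3 φ hφ hc]

open Classical in
/-- The weak derivative `∂_x^a ∂_y^b u` as a function (determined up to null sets; zero if `u` has
no weak derivative of this order). -/
def weakDeriv (a b : ℕ) (u : ℝ × ℝ → ℝ) : ℝ × ℝ → ℝ :=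
  if h : ∃ w, HasWeakDeriv a b u w then h.choose else 0

lemma HasWeakDeriv.weakDeriv_ae_eq {a b : ℕ} {u w : ℝ × ℝ → ℝ} (h : HasWeakDeriv a b u w) :
    weakDeriv a b u =ᵐ[volume] w := by
  have hex : ∃ w, HasWeakDeriv a b u w := ⟨w, h⟩
  have h' : HasWeakDeriv a b u (weakDeriv a b u) := by
    unfold weakDeriv
    rw [dif_pos hex]
    exact hex.choose_spec
  refine ae_eq_of_integral_contDiff_smul_eq h'.2 h.2 fun φ hφ hc => ?_
  have e := (h'.3 φ hφ hc).symm.trans (h.3 φ hφ hc)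
  have hne : ((-1 : ℝ) ^ (a + b)) ≠ 0 := pow_ne_zero _ (by norm_num)
  simpa [smul_eq_mul, mul_comm] using mul_left_cancel₀ hne e

/-- The multi-indices `α = (α₁, α₂)` with `|α| ≤ 4`. -/
abbrev MultiIndex4 : Type := {α : Fin 5 × Fin 5 // (α.1 : ℕ) + (α.2 : ℕ) ≤ 4}

/-- The multi-index `(0, 0)`. -/
def MultiIndex4.zero : MultiIndex4 := ⟨(0, 0), by simp⟩

/-- The real Hilbert sum of copies of `L²(ℝ²)` indexed by the multi-indices `|α| ≤ 4`. -/
abbrev L2Jets : Type := PiLp 2 (fun _ : MultiIndex4 => Lp ℝ 2 (volume : Measure (ℝ × ℝ)))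

/-- The families `(∂^α u)_{|α| ≤ 4}` of weak derivatives of functions `u ∈ L²(ℝ²)` all of whose
weak derivatives up to order four belong to `L²(ℝ²)`. -/
def sobolevH4 : Submodule ℝ L2Jets where
  carrier := {U | ∀ α : MultiIndex4, HasWeakDeriv α.1.1 α.1.2 (U MultiIndex4.zero) (U α)}
  zero_mem' := fun α =>
    HasWeakDeriv.congr (u := 0) (w := 0)
      ⟨locallyIntegrable_zero, locallyIntegrable_zero, by simp⟩
      (Lp.coeFn_zero ℝ 2 _).symm (Lp.coeFn_zero ℝ 2 _).symm
  add_mem' := fun {U V} hU hV α =>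
    ((hU α).add (hV α)).congr (Lp.coeFn_add _ _).symm (Lp.coeFn_add _ _).symm
  smul_mem' := fun c U hU α =>
    ((hU α).smul c).congr (Lp.coeFn_smul _ _).symm (Lp.coeFn_smul _ _).symm

/-- The Sobolev space `H⁴(ℝ²)` of real functions. A function `u` is stored with its weak
derivatives, so that the inherited inner product is
`(u, v)_{H⁴} = ∑_{|α| ≤ 4} (∂^α u, ∂^α v)_{L²}` and `‖u‖²_{H⁴} = ∑_{|α| ≤ 4} ‖∂^α u‖²_{L²}`. -/
abbrev H4 : Type := ↥sobolevH4

/-- The function (a representative of the `L²` class) underlying an element of `H⁴(ℝ²)`. -/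
def H4.fn (u : H4) : ℝ × ℝ → ℝ := (u : L2Jets) MultiIndex4.zero

/-- A test function on `[0, T[ × ℝ²`: the values matter only for times `t ≥ 0`, and the function
need not vanish at `t = 0`. -/
structure IsTestFunction (T : ℝ) (φ : ℝ × (ℝ × ℝ) → ℝ) : Prop where
  contDiff : ContDiff ℝ ∞ φ
  hasCompactSupport : HasCompactSupport φ
  tsupport_subset : tsupport φ ⊆ Iio T ×ˢ univ

/-- `v ∈ L^∞(]0, T]; H⁴(ℝ²))` is a weak (distributional) solution of the Cauchy problem
`∂_t v + y ∂_x v - (1 + g)² ∂_y² v = 0`, `v|_{t = 0} = v₀`, on `[0, T]`. -/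
structure IsWeakSolution (T : ℝ) (g : ℝ → H4) (v₀ : H4) (v : ℝ → H4) : Prop where
  memLp : MemLp v ∞ (volume.restrict (Ioc 0 T))
  weak_eq : ∀ φ : ℝ × (ℝ × ℝ) → ℝ, IsTestFunction T φ →
    (∫ t in Ioc 0 T, ∫ p : ℝ × ℝ,
        (-((v t).fn p * deriv (fun s => φ (s, p)) t)
          + (p.2 * weakDeriv 1 0 (v t).fn p
              - (1 + (g t).fn p) ^ 2 * weakDeriv 0 2 (v t).fn p) * φ (t, p)))
      - ∫ p : ℝ × ℝ, v₀.fn p * φ (0, p) = 0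

/-- The weight `⟨δ (x, y)⟩⁻¹ = (1 + δ² (x² + y²))^{-1/2}`. -/
def weight (δ : ℝ) (p : ℝ × ℝ) : ℝ := (Real.sqrt (1 + δ ^ 2 * (p.1 ^ 2 + p.2 ^ 2)))⁻¹

/-- `v ∈ L^∞(]0, T]; H⁴(ℝ²))` is a weak (distributional) solution on `[0, T]` of the modified
problem, in which `J = ⟨δ (x, y)⟩⁻¹`,
`∂_t v + J y ∂_x (J v) - J (1 + g)² ∂_y² (J v) = 0`, `v|_{t = 0} = J v₀`. -/
structure IsModifiedWeakSolution (δ T : ℝ) (g : ℝ → H4) (v₀ : H4) (v : ℝ → H4) : Prop where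
  memLp : MemLp v ∞ (volume.restrict (Ioc 0 T))
  weak_eq : ∀ φ : ℝ × (ℝ × ℝ) → ℝ, IsTestFunction T φ →
    (∫ t in Ioc 0 T, ∫ p : ℝ × ℝ,
        (-((v t).fn p * deriv (fun s => φ (s, p)) t)
          + (weight δ p * p.2 * weakDeriv 1 0 (fun q => weight δ q * (v t).fn q) p
              - weight δ p * (1 + (g t).fn p) ^ 2
                  * weakDeriv 0 2 (fun q => weight δ q * (v t).fn q) p) * φ (t, p)))
      - ∫ p : ℝ × ℝ, weight δ p * v₀.fn p * φ (0, p) = 0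

/-- `v : [0, T] → H⁴(ℝ²)` is continuous for the weak topology of the Hilbert space `H⁴(ℝ²)`. -/
def WeaklyContinuous (T : ℝ) (v : ℝ → H4) : Prop :=
  ∀ h : H4, ContinuousOn (fun t => inner ℝ (v t) h) (Icc 0 T)

end

/-!
Write `J = ⟨δ(x, y)⟩⁻¹`. For `δ = 0` the modified problem is the original one
(`isWeakSolution_iff`), so all `δ ∈ [0, 1]` are treated together, with bounds that do not depend
on `δ`. Such bounds hold because the derivatives of `J`, and those of positive order of the
transport coefficient `J² y`, are polynomials in `δ`, `J`, `δ x J` and `δ y J`, all of modulus at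
most one (`Smooth.exists_weight_bound`).

The operator `P = ∑_{|α| ≤ 4} (-1)^{|α|} ∂^{2α}` represents the inner product:
`(u, w)_{H⁴} = (u, P w)_{L²}` for test functions `w`. An `L²` function orthogonal to the range of
`P` vanishes, since its mollifications are smooth solutions of `P F = 0` that are square integrable
with all derivatives (`Test.eq_zero_of_inner_opP`); this makes test functions dense in `H⁴`, and
gives the Sobolev bound for the coefficient by density.

Existence for `δ > 0`. Leibniz' rule and integration by parts yield, for the spatial operator `L`
and test functions `w`, the coercivity `(L w, P w)_{L²} ≥ ¼ ‖∂_y (J w)‖²_{H⁴} - K ‖w‖²_{H⁴}`: the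
commutators of `∂^α` with the transport term cost at most a multiple of `‖w‖²`, those with
`J (1 + g)²` a multiple of `‖∂_y (J w)‖ ‖w‖`, and the smallness of `g` keeps `(1 + g)² ≥ 1/2`
(`H4.energy_estimate`). Lions' projection theorem then produces a solution on each interval `]0, τ]`
together with its value at `τ` (`exists_weak_evolution`, `exists_mild_with_final_value`), and these
values, glued by uniqueness, are a solution defined at every time (`exists_mild_of_pos`).

Uniqueness. A weak solution satisfies an integrated equation for almost all times (`IsMild`), in
`L²` and after multiplication by the weight `⟨(x, y)⟩⁻¹`, which makes `y ∂_x v` square integrable.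
Since `L` is bounded below in the weighted `L²` norm (`H4.weighted_estimate`), Grönwall's argument
gives uniqueness (`IsMild.unique`).

The limit `δ → 0`. Along every ultrafilter finer than `δ → 0+`, the solutions of the modified
problems have weak limits at each time and in `L²` of time. The transposed operators converge
strongly, so these limits solve the integrated equation with `δ = 0` (`exists_limit`). By uniqueness
they do not depend on the ultrafilter: this is the convergence asserted, and the solution inherits
the bounds.
-/

noncomputable section

/-! ### The algebra of smooth functions and the ideal of test functions -/

/-- The algebra of smooth real functions on the plane. -/
def smoothAlgebra : Subalgebra ℝ (ℝ × ℝ → ℝ) where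
  carrier := {f | ContDiff ℝ ∞ f}
  mul_mem' {f g} (hf : ContDiff ℝ ∞ f) (hg : ContDiff ℝ ∞ g) :=
    show ContDiff ℝ ∞ (f * g) from hf.mul hg
  add_mem' {f g} (hf : ContDiff ℝ ∞ f) (hg : ContDiff ℝ ∞ g) :=
    show ContDiff ℝ ∞ (f + g) from hf.add hg
  algebraMap_mem' c := show ContDiff ℝ ∞ (fun _ => c) from contDiff_const

/-- Smooth real functions on the plane. -/
abbrev Smooth : Type := ↥smoothAlgebra

/-- The ideal of compactly supported functions in the algebra of smooth functions. -/
def testIdeal : Ideal Smooth where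
  carrier := {f | HasCompactSupport (f : ℝ × ℝ → ℝ)}
  zero_mem' := HasCompactSupport.zero
  add_mem' hf hg := HasCompactSupport.add hf hg
  smul_mem' _ _ hf := HasCompactSupport.mul_left hf

/-- Test functions on the plane: smooth functions with compact support. -/
abbrev Test : Type := ↥testIdeal

instance : AddCommGroup Test := inferInstanceAs (AddCommGroup ↥testIdeal)
instance : Module ℝ Test := inferInstanceAs (Module ℝ ↥testIdeal)
instance : SMul Smooth Test := ⟨fun m w => ⟨m * (w : Smooth), testIdeal.mul_mem_left m w.2⟩⟩

namespace Smooth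

lemma contDiff (f : Smooth) : ContDiff ℝ ∞ (f : ℝ × ℝ → ℝ) := f.2

lemma differentiable (f : Smooth) : Differentiable ℝ (f : ℝ × ℝ → ℝ) :=
  f.contDiff.differentiable (by simp)

lemma continuous (f : Smooth) : Continuous (f : ℝ × ℝ → ℝ) := f.contDiff.continuous

@[ext] lemma ext {f g : Smooth} (h : ∀ p, (f : ℝ × ℝ → ℝ) p = (g : ℝ × ℝ → ℝ) p) : f = g :=
  Subtype.ext (funext h)

/-- The derivative of smooth functions in the constant direction `e`. -/
def dirDeriv (e : ℝ × ℝ) : Derivation ℝ Smooth Smooth :=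
  Derivation.mk'
    { toFun := fun f => ⟨fun p => fderiv ℝ (f : ℝ × ℝ → ℝ) p e,
        show ContDiff ℝ ∞ (fun p => fderiv ℝ (f : ℝ × ℝ → ℝ) p e) from
          (f.contDiff.fderiv_right (m := ∞) (by simp)).clm_apply contDiff_const⟩
      map_add' := fun f g => by
        ext p
        have := fderiv_add (f.differentiable p) (g.differentiable p)
        simpa using congrArg (fun L => L e) this
      map_smul' := fun c f => by
        ext p
        have := fderiv_const_smul (f.differentiable p) c
        simpa using congrArg (fun L => L e) this }
    (fun f g => by
      ext p
      have := fderiv_mul (f.differentiable p) (g.differentiable p)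
      simpa using congrArg (fun L => L e) this)

lemma dirDeriv_comm (e e' : ℝ × ℝ) (f : Smooth) :
    dirDeriv e (dirDeriv e' f) = dirDeriv e' (dirDeriv e f) := by
  ext p
  have key : ∀ e e' : ℝ × ℝ, fderiv ℝ (fun q => fderiv ℝ (f : ℝ × ℝ → ℝ) q e') p e
      = fderiv ℝ (fderiv ℝ (f : ℝ × ℝ → ℝ)) p e e' := fun e e' => by
    have hd : DifferentiableAt ℝ (fderiv ℝ (f : ℝ × ℝ → ℝ)) p :=
      (f.contDiff.fderiv_right (m := 1) (WithTop.coe_le_coe.2 le_top)).differentiable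
        (by simp) p
    rw [fderiv_clm_apply hd (differentiableAt_const _)]
    simp
  have hs : IsSymmSndFDerivAt ℝ (f : ℝ × ℝ → ℝ) p :=
    (f.contDiff.contDiffAt).isSymmSndFDerivAt (by simp; exact WithTop.coe_le_coe.2 le_top)
  change fderiv ℝ (fun q => fderiv ℝ (f : ℝ × ℝ → ℝ) q e') p e
    = fderiv ℝ (fun q => fderiv ℝ (f : ℝ × ℝ → ℝ) q e) p e'
  rw [key, key]
  exact hs e e'

/-- `∂_x` on smooth functions. -/
def dx : Derivation ℝ Smooth Smooth := dirDeriv (1, 0)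

/-- `∂_y` on smooth functions. -/
def dy : Derivation ℝ Smooth Smooth := dirDeriv (0, 1)

/-- `∂_x^a ∂_y^b` on smooth functions. -/
def dd (a b : ℕ) : Module.End ℝ Smooth :=
  (dx : Module.End ℝ Smooth) ^ a * (dy : Module.End ℝ Smooth) ^ b

lemma dx_dy_comm : Commute (dx : Module.End ℝ Smooth) (dy : Module.End ℝ Smooth) :=
  LinearMap.ext fun f => dirDeriv_comm _ _ f

@[simp] lemma dd_zero (f : Smooth) : dd 0 0 f = f := by simp [dd]

lemma dd_one_zero (f : Smooth) : dd 1 0 f = dx f := by simp [dd]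

lemma dd_zero_one (f : Smooth) : dd 0 1 f = dy f := by simp [dd]

lemma dd_add (a b c d : ℕ) (f : Smooth) : dd a b (dd c d f) = dd (a + c) (b + d) f := by
  have : dd a b * dd c d = dd (a + c) (b + d) := by
    unfold dd
    rw [pow_add, pow_add, mul_assoc, mul_assoc]
    congr 1
    rw [← mul_assoc, ← mul_assoc, ((dx_dy_comm.pow_pow c b)).eq]
  rw [← this]; rfl

lemma dx_dd (a b : ℕ) (f : Smooth) : dx (dd a b f) = dd (a + 1) b f := by
  rw [← dd_one_zero, dd_add]; congr 2 <;> omega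

lemma dy_dd (a b : ℕ) (f : Smooth) : dy (dd a b f) = dd a (b + 1) f := by
  rw [← dd_zero_one, dd_add]; congr 2 <;> omega

lemma dd_dx (a b : ℕ) (f : Smooth) : dd a b (dx f) = dd (a + 1) b f := by
  rw [← dd_one_zero, dd_add]; rfl

lemma dd_dy (a b : ℕ) (f : Smooth) : dd a b (dy f) = dd a (b + 1) f := by
  rw [← dd_zero_one, dd_add]; rfl

lemma coe_dd (a b : ℕ) (f : Smooth) :
    (dd a b f : ℝ × ℝ → ℝ) = partialXY a b (f : ℝ × ℝ → ℝ) := by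
  have hy : ∀ b : ℕ, ((dd 0 b f : Smooth) : ℝ × ℝ → ℝ) = partialY^[b] f := by
    intro b
    induction b with
    | zero => simp
    | succ n ih =>
      rw [← dy_dd, Function.iterate_succ_apply', ← ih]; rfl
  unfold partialXY
  induction a with
  | zero => exact hy b
  | succ n ih => rw [← dx_dd, Function.iterate_succ_apply', ← ih]; rfl

end Smooth

open Finset in
/-- The Leibniz rule for the powers of a derivation. -/
lemma Derivation.pow_leibniz {A : Type*} [CommRing A] [Algebra ℝ A] (D : Derivation ℝ A A) (n : ℕ)
    (f g : A) : ((D : Module.End ℝ A) ^ n) (f * g) = ∑ p ∈ antidiagonal n,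
      (n.choose p.1) • (((D : Module.End ℝ A) ^ p.1) f * ((D : Module.End ℝ A) ^ p.2) g) := by
  induction n with
  | zero => simp
  | succ n ih =>
    rw [sum_antidiagonal_choose_succ_nsmul (M := A)
      (fun i j => ((D : Module.End ℝ A) ^ i) f * ((D : Module.End ℝ A) ^ j) g) n]
    rw [pow_succ', Module.End.mul_apply, ih, map_sum, ← sum_add_distrib]
    refine sum_congr rfl fun ⟨i, j⟩ hij ↦ ?_
    rw [map_nsmul, n.choose_symm_of_eq_add (mem_antidiagonal.1 hij).symm, ← smul_add, pow_succ',
      pow_succ']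
    simp only [Derivation.coeFn_coe, Derivation.leibniz, smul_eq_mul, Module.End.mul_apply]
    congr 1
    ring

namespace Smooth

open Finset in
/-- The Leibniz rule for `∂_x^a ∂_y^b`. -/
lemma dd_mul (a b : ℕ) (f g : Smooth) : dd a b (f * g) =
    ∑ p ∈ antidiagonal a ×ˢ antidiagonal b, ((a.choose p.1.1 * b.choose p.2.1 : ℕ) : ℝ) •
      (dd p.1.1 p.2.1 f * dd p.1.2 p.2.2 g) := by
  rw [dd, Module.End.mul_apply, Derivation.pow_leibniz, map_sum, sum_product_right]
  refine sum_congr rfl fun q _ => ?_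
  rw [map_nsmul, Derivation.pow_leibniz, smul_sum]
  refine sum_congr rfl fun p _ => ?_
  rw [smul_smul, Nat.cast_smul_eq_nsmul, mul_comm]
  rfl

end Smooth

namespace Test

/-- The function underlying a test function. -/
def fn (w : Test) : ℝ × ℝ → ℝ := ((w : Smooth) : ℝ × ℝ → ℝ)

lemma contDiff (w : Test) : ContDiff ℝ ∞ w.fn := w.1.2

lemma continuous (w : Test) : Continuous w.fn := w.contDiff.continuous

lemma hasCompactSupport (w : Test) : HasCompactSupport w.fn := w.2

/-- A smooth function with compact support as a test function. -/
def mk (φ : ℝ × ℝ → ℝ) (h : ContDiff ℝ ∞ φ) (hc : HasCompactSupport φ) : Test := ⟨⟨φ, h⟩, hc⟩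

@[simp] lemma mk_fn (φ : ℝ × ℝ → ℝ) (h : ContDiff ℝ ∞ φ) (hc : HasCompactSupport φ) :
    (mk φ h hc).fn = φ := rfl

@[ext] lemma ext {f g : Test} (h : ∀ p, f.fn p = g.fn p) : f = g :=
  Subtype.ext (Smooth.ext h)

@[simp] lemma add_fn (f g : Test) : (f + g).fn = f.fn + g.fn := rfl
@[simp] lemma sub_fn (f g : Test) : (f - g).fn = f.fn - g.fn := rfl
@[simp] lemma smul_fn (c : ℝ) (f : Test) : (c • f).fn = c • f.fn := rfl
@[simp] lemma smooth_smul_fn (m : Smooth) (f : Test) :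
    (m • f).fn = (m : ℝ × ℝ → ℝ) * f.fn := rfl

lemma dirDeriv_mem (e : ℝ × ℝ) (f : Smooth) (hf : f ∈ testIdeal) :
    Smooth.dirDeriv e f ∈ testIdeal :=
  HasCompactSupport.fderiv_apply (𝕜 := ℝ) (f := (f : ℝ × ℝ → ℝ)) hf e

lemma dd_mem (a b : ℕ) (f : Smooth) (hf : f ∈ testIdeal) : Smooth.dd a b f ∈ testIdeal := by
  have h0 : ∀ b : ℕ, Smooth.dd 0 b f ∈ testIdeal := by
    intro b
    induction b with
    | zero => simpa using hf
    | succ n ih => rw [← Smooth.dy_dd]; exact dirDeriv_mem _ _ ih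
  induction a with
  | zero => exact h0 b
  | succ n ih => rw [← Smooth.dx_dd]; exact dirDeriv_mem _ _ ih

/-- `∂_x^a ∂_y^b` on test functions. -/
def dd (a b : ℕ) : Test →ₗ[ℝ] Test where
  toFun w := ⟨Smooth.dd a b w, dd_mem a b w w.2⟩
  map_add' f g := Subtype.ext (map_add (Smooth.dd a b) (f : Smooth) (g : Smooth))
  map_smul' c f := Subtype.ext (map_smul (Smooth.dd a b) c (f : Smooth))

lemma coe_dd (a b : ℕ) (w : Test) : ((dd a b w : Test) : Smooth) = Smooth.dd a b (w : Smooth) := rfl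

lemma dd_fn (a b : ℕ) (w : Test) : (dd a b w).fn = partialXY a b w.fn := Smooth.coe_dd a b w

@[simp] lemma dd_zero (w : Test) : dd 0 0 w = w := Subtype.ext (Smooth.dd_zero _)

lemma dd_add (a b c d : ℕ) (f : Test) : dd a b (dd c d f) = dd (a + c) (b + d) f :=
  Subtype.ext (Smooth.dd_add a b c d f)

open Finset in
/-- The Leibniz rule for a smooth multiple of a test function. -/
lemma dd_smul (a b : ℕ) (m : Smooth) (f : Test) : dd a b (m • f) =
    ∑ p ∈ antidiagonal a ×ˢ antidiagonal b, ((a.choose p.1.1 * b.choose p.2.1 : ℕ) : ℝ) •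
      (Smooth.dd p.1.1 p.2.1 m • dd p.1.2 p.2.2 f) := by
  apply Subtype.ext
  rw [AddSubmonoidClass.coe_finsetSum]
  exact Smooth.dd_mul a b m f

lemma dx_smul (m : Smooth) (f : Test) : dd 1 0 (m • f) = Smooth.dx m • f + m • dd 1 0 f := by
  apply Subtype.ext
  change Smooth.dd 1 0 (m * (f : Smooth)) = Smooth.dx m * (f : Smooth) + m * Smooth.dd 1 0 f
  rw [Smooth.dd_one_zero, Smooth.dd_one_zero, Derivation.leibniz]
  simp only [smul_eq_mul]; ring

lemma dy_smul (m : Smooth) (f : Test) : dd 0 1 (m • f) = Smooth.dy m • f + m • dd 0 1 f := by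
  apply Subtype.ext
  change Smooth.dd 0 1 (m * (f : Smooth)) = Smooth.dy m * (f : Smooth) + m * Smooth.dd 0 1 f
  rw [Smooth.dd_zero_one, Smooth.dd_zero_one, Derivation.leibniz]
  simp only [smul_eq_mul]; ring

lemma integrable (w : Test) : Integrable w.fn :=
  w.continuous.integrable_of_hasCompactSupport w.hasCompactSupport

lemma integral_dirDeriv (e : ℝ × ℝ) (w : Test) : ∫ p, fderiv ℝ w.fn p e = 0 := by
  have h := integral_mul_fderiv_eq_neg_fderiv_mul_of_integrable (μ := (volume : Measure (ℝ × ℝ)))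
    (f := fun _ => (1 : ℝ)) (g := w.fn) (v := e) (by simp)
    (by simpa using (show Integrable (fun x => fderiv ℝ w.fn x e) volume from
      Test.integrable ⟨Smooth.dirDeriv e w, dirDeriv_mem e w w.2⟩))
    (by simpa using w.integrable) (fun x _ => by fun_prop)
    (fun x _ => (w : Smooth).differentiable x)
  simpa using h

lemma integral_dx (w : Test) : ∫ p, (dd 1 0 w).fn p = 0 := by
  have := integral_dirDeriv (1, 0) w
  rw [← this]
  congr 1

lemma integral_dy (w : Test) : ∫ p, (dd 0 1 w).fn p = 0 := by
  have := integral_dirDeriv (0, 1) w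
  rw [← this]
  congr 1

lemma integral_mul_dx (f : Smooth) (w : Test) :
    ∫ p, (f : ℝ × ℝ → ℝ) p * (dd 1 0 w).fn p
      = - ∫ p, (Smooth.dx f : ℝ × ℝ → ℝ) p * w.fn p := by
  have h := integral_dx (f • w)
  rw [dx_smul] at h
  rw [add_fn] at h
  simp only [Pi.add_apply] at h
  rw [integral_add (Smooth.dx f • w).integrable (f • dd 1 0 w).integrable] at h
  simp only [smooth_smul_fn, Pi.mul_apply] at h
  linarith

lemma integral_mul_dy (f : Smooth) (w : Test) :
    ∫ p, (f : ℝ × ℝ → ℝ) p * (dd 0 1 w).fn p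
      = - ∫ p, (Smooth.dy f : ℝ × ℝ → ℝ) p * w.fn p := by
  have h := integral_dy (f • w)
  rw [dy_smul] at h
  rw [add_fn] at h
  simp only [Pi.add_apply] at h
  rw [integral_add (Smooth.dy f • w).integrable (f • dd 0 1 w).integrable] at h
  simp only [smooth_smul_fn, Pi.mul_apply] at h
  linarith

lemma integral_mul_dd (a b : ℕ) (f : Smooth) (w : Test) :
    ∫ p, (f : ℝ × ℝ → ℝ) p * (dd a b w).fn p
      = (-1) ^ (a + b) * ∫ p, (Smooth.dd a b f : ℝ × ℝ → ℝ) p * w.fn p := by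
  have hy : ∀ (b : ℕ) (f : Smooth), ∫ p, (f : ℝ × ℝ → ℝ) p * (dd 0 b w).fn p
      = (-1) ^ b * ∫ p, (Smooth.dd 0 b f : ℝ × ℝ → ℝ) p * w.fn p := by
    intro b
    induction b with
    | zero => intro f; simp
    | succ n ih =>
      intro f
      have : dd 0 (n + 1) w = dd 0 1 (dd 0 n w) := by rw [dd_add]; congr 2; omega
      rw [this, integral_mul_dy, ih, Smooth.dd_dy, pow_succ]
      ring
  induction a generalizing f with
  | zero => simpa using hy b f
  | succ n ih =>
    have : dd (n + 1) b w = dd 1 0 (dd n b w) := by rw [dd_add]; congr 2 <;> omega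
    rw [this, integral_mul_dx, ih, Smooth.dd_dx]
    ring

end Test

/-! ### Test functions in `L²` and in `H⁴` -/

/-- The space `L²(ℝ²)`. -/
abbrev L2 : Type := Lp ℝ 2 (volume : Measure (ℝ × ℝ))

namespace Test

lemma memLp (w : Test) : MemLp w.fn 2 volume :=
  w.continuous.memLp_of_hasCompactSupport w.hasCompactSupport

/-- A test function as an element of `L²`. -/
def toL2 : Test →ₗ[ℝ] L2 where
  toFun w := w.memLp.toLp w.fn
  map_add' f g := MemLp.toLp_add f.memLp g.memLp
  map_smul' c f := MemLp.toLp_const_smul c f.memLp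

lemma coeFn_toL2 (w : Test) : (toL2 w : ℝ × ℝ → ℝ) =ᵐ[volume] w.fn := MemLp.coeFn_toLp w.memLp

lemma inner_toL2 (f : L2) (w : Test) : inner ℝ f (toL2 w) = ∫ p, f p * w.fn p := by
  rw [L2.inner_def]
  refine integral_congr_ae ?_
  filter_upwards [w.coeFn_toL2] with p hp
  simp [hp, mul_comm]

lemma inner_toL2_toL2 (f w : Test) : inner ℝ (toL2 f) (toL2 w) = ∫ p, f.fn p * w.fn p := by
  rw [inner_toL2]
  refine integral_congr_ae ?_
  filter_upwards [f.coeFn_toL2] with p hp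
  rw [hp]

lemma inner_dd_right (a b : ℕ) (f w : Test) :
    inner ℝ (toL2 f) (toL2 (dd a b w)) = (-1) ^ (a + b) * inner ℝ (toL2 (dd a b f)) (toL2 w) := by
  rw [inner_toL2_toL2, inner_toL2_toL2]
  exact integral_mul_dd a b f w

lemma inner_smul_left (m : Smooth) (f w : Test) :
    inner ℝ (toL2 (m • f)) (toL2 w) = inner ℝ (toL2 f) (toL2 (m • w)) := by
  rw [inner_toL2_toL2, inner_toL2_toL2]
  congr 1; ext p; simp; ring

lemma norm_smul_le {m : Smooth} {C : ℝ} (hm : ∀ p, |(m : ℝ × ℝ → ℝ) p| ≤ C)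
    (w : Test) : ‖toL2 (m • w)‖ ≤ C * ‖toL2 w‖ := by
  refine Lp.norm_le_mul_norm_of_ae_le_mul ?_
  filter_upwards [(m • w).coeFn_toL2, w.coeFn_toL2] with p h1 h2
  rw [h1, h2]
  simp only [smooth_smul_fn, Pi.mul_apply, norm_mul, Real.norm_eq_abs]
  gcongr
  exact hm p

/-- `L²` functions orthogonal to all test functions vanish. -/
lemma eq_zero_of_inner {f : L2} (h : ∀ w : Test, inner ℝ f (toL2 w) = 0) : f = 0 := by
  rw [Lp.eq_zero_iff_ae_eq_zero]
  refine ae_eq_zero_of_integral_contDiff_smul_eq_zero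
    ((Lp.memLp f).locallyIntegrable (by norm_num)) fun φ hφ hc => ?_
  have := h (mk φ hφ hc)
  rw [inner_toL2] at this
  simpa [mul_comm] using this

end Test

/-- The weak derivative `∂^α : H⁴ → L²`. -/
def H4.D (α : MultiIndex4) : H4 →L[ℝ] L2 :=
  (PiLp.proj 2 (fun _ : MultiIndex4 => L2) α) ∘L sobolevH4.subtypeL

/-- The inclusion `H⁴ → L²`. -/
def H4.incl : H4 →L[ℝ] L2 := H4.D MultiIndex4.zero

lemma H4.hasWeakDeriv (u : H4) (α : MultiIndex4) :
    HasWeakDeriv α.1.1 α.1.2 u.fn (H4.D α u) := u.2 α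

lemma H4.fn_eq (u : H4) : u.fn = (H4.incl u : ℝ × ℝ → ℝ) := rfl

lemma H4.inner_eq (u v : H4) : inner ℝ u v = ∑ α, inner ℝ (H4.D α u) (H4.D α v) := by
  rw [Submodule.coe_inner, PiLp.inner_apply]; rfl

lemma H4.norm_sq_eq (u : H4) : ‖u‖ ^ 2 = ∑ α, ‖H4.D α u‖ ^ 2 := by
  rw [← real_inner_self_eq_norm_sq, H4.inner_eq]
  simp

lemma H4.norm_D_le (α : MultiIndex4) (u : H4) : ‖H4.D α u‖ ≤ ‖u‖ := by
  rw [← sq_le_sq₀ (norm_nonneg _) (norm_nonneg _), H4.norm_sq_eq u]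
  exact Finset.single_le_sum (f := fun α => ‖H4.D α u‖ ^ 2) (fun _ _ => by positivity)
    (Finset.mem_univ α)

namespace Test

/-- The derivative `∂^α` of test functions for a multi-index `|α| ≤ 4`. -/
abbrev ddα (α : MultiIndex4) : Test →ₗ[ℝ] Test := dd α.1.1 α.1.2

/-- A test function as an element of `H⁴`. -/
def toH4 : Test →ₗ[ℝ] H4 where
  toFun w := ⟨WithLp.toLp 2 fun α => toL2 (ddα α w), fun α => by
    have h : HasWeakDeriv α.1.1 α.1.2 w.fn (ddα α w).fn :=
      ⟨w.continuous.locallyIntegrable, (ddα α w).continuous.locallyIntegrable, fun φ hφ hc => by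
        have := integral_mul_dd α.1.1 α.1.2 (w : Smooth) (mk φ hφ hc)
        rw [dd_fn, mk_fn] at this
        exact this⟩
    refine h.congr ?_ (coeFn_toL2 _).symm
    have h0 : ddα MultiIndex4.zero w = w := by
      change dd 0 0 w = w
      simp
    change _ =ᵐ[volume] (toL2 (ddα MultiIndex4.zero w) : ℝ × ℝ → ℝ)
    rw [h0]
    exact (coeFn_toL2 w).symm⟩
  map_add' f g := by
    apply Subtype.ext
    ext1 α
    simp
  map_smul' c f := by
    apply Subtype.ext
    ext1 α
    simp

lemma D_toH4 (α : MultiIndex4) (w : Test) : H4.D α (toH4 w) = toL2 (ddα α w) := rfl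

lemma incl_toH4 (w : Test) : H4.incl (toH4 w) = toL2 w := by
  change toL2 (dd 0 0 w) = toL2 w
  simp

/-- The operator `P = ∑_{|α| ≤ 4} (-1)^{|α|} ∂^{2α}` of order eight representing the inner product
of `H⁴` in `L²`. -/
def opP : Test →ₗ[ℝ] Test :=
  ∑ α : MultiIndex4, ((-1 : ℝ) ^ ((α.1.1 : ℕ) + (α.1.2 : ℕ))) • (ddα α ∘ₗ ddα α)

/-- The `H⁴` inner product with a test function `w` is the `L²` inner product with `P w`. -/
lemma inner_toH4 (u : H4) (w : Test) :
    inner ℝ u (toH4 w) = inner ℝ (H4.incl u) (toL2 (opP w)) := by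
  rw [H4.inner_eq, opP, LinearMap.sum_apply, map_sum, inner_sum]
  refine Finset.sum_congr rfl fun α _ => ?_
  rw [LinearMap.smul_apply, map_smul, inner_smul_right, D_toH4, LinearMap.comp_apply,
    inner_toL2, inner_toL2]
  have h := (u.hasWeakDeriv α).integral_eq (ddα α w).fn (ddα α w).contDiff
    (ddα α w).hasCompactSupport
  rw [← dd_fn] at h
  rw [← H4.fn_eq, h, ← mul_assoc, ← mul_pow]
  simp

end Test

lemma H4.incl_injective : Function.Injective H4.incl := by
  intro u v h
  rw [← sub_eq_zero, ← map_sub] at h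
  rw [← sub_eq_zero]
  have key : ∀ α, H4.D α (u - v) = 0 := fun α => by
    refine Test.eq_zero_of_inner fun w => ?_
    have h1 := ((u - v).hasWeakDeriv α).integral_eq w.fn w.contDiff w.hasCompactSupport
    rw [H4.fn_eq, h, ← Test.dd_fn, ← Test.inner_toL2, ← Test.inner_toL2, inner_zero_left] at h1
    have : ((-1 : ℝ) ^ ((α.1.1 : ℕ) + (α.1.2 : ℕ))) ≠ 0 := pow_ne_zero _ (by norm_num)
    exact (mul_eq_zero.1 h1.symm).resolve_left this
  have : ‖u - v‖ ^ 2 = 0 := by rw [H4.norm_sq_eq]; simp [key]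
  exact norm_eq_zero.1 (by simpa only [sq_eq_zero_iff] using this)

/-- The space `H⁴` is complete: the identities that define weak derivatives are preserved by limits
in `L²`. -/
instance : CompleteSpace H4 := by
  have hc : IsClosed (sobolevH4 : Set L2Jets) := by
    have : (sobolevH4 : Set L2Jets) = ⋂ (α : MultiIndex4) (w : Test), {U : L2Jets |
        inner ℝ (U MultiIndex4.zero) (Test.toL2 (Test.ddα α w))
          = (-1) ^ ((α.1.1 : ℕ) + (α.1.2 : ℕ)) * inner ℝ (U α) (Test.toL2 w)} := by
      ext U
      simp only [mem_iInter, mem_ofPred_eq]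
      constructor
      · intro hU α w
        have := (hU α).integral_eq w.fn w.contDiff w.hasCompactSupport
        rwa [← Test.dd_fn, ← Test.inner_toL2, ← Test.inner_toL2] at this
      · intro hU α
        refine ⟨(Lp.memLp _).locallyIntegrable (by norm_num),
          (Lp.memLp _).locallyIntegrable (by norm_num), fun φ hφ hφc => ?_⟩
        have := hU α (Test.mk φ hφ hφc)
        rwa [Test.inner_toL2, Test.inner_toL2, Test.dd_fn] at this
    rw [this]
    refine isClosed_iInter fun α => isClosed_iInter fun w => isClosed_eq ?_ ?_
    · exact ((PiLp.continuous_apply 2 _ MultiIndex4.zero)).inner continuous_const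
    · exact continuous_const.mul (((PiLp.continuous_apply 2 _ α)).inner continuous_const)
  exact hc.completeSpace_coe

/-! ### Multiplication operators on `L²` -/

/-- `m` is a measurable function bounded by `C` almost everywhere. -/
structure IsMultiplier (m : ℝ × ℝ → ℝ) (C : ℝ) : Prop where
  aestronglyMeasurable : AEStronglyMeasurable m volume
  bound : ∀ᵐ p, |m p| ≤ C

lemma IsMultiplier.memLp_mul {m : ℝ × ℝ → ℝ} {C : ℝ} (h : IsMultiplier m C) (f : L2) :
    MemLp (fun p => m p * f p) 2 volume := by
  refine MemLp.of_le_mul (c := C) (Lp.memLp f) (h.1.mul (Lp.aestronglyMeasurable f)) ?_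
  filter_upwards [h.2] with p hp
  rw [norm_mul, Real.norm_eq_abs]
  gcongr

lemma IsMultiplier.nonneg {m : ℝ × ℝ → ℝ} {C : ℝ} (h : IsMultiplier m C) : 0 ≤ C := by
  obtain ⟨p, hp⟩ := h.2.exists
  exact (abs_nonneg _).trans hp

lemma IsMultiplier.of_continuous {m : ℝ × ℝ → ℝ} {C : ℝ} (h : Continuous m)
    (hC : ∀ p, |m p| ≤ C) : IsMultiplier m C :=
  ⟨h.aestronglyMeasurable, ae_of_all _ hC⟩

open Classical in
/-- Multiplication by an essentially bounded function, as an operator on `L²` (zero if the function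
is not essentially bounded). -/
def mulOp (m : ℝ × ℝ → ℝ) : L2 →L[ℝ] L2 :=
  if h : ∃ C, IsMultiplier m C then
    LinearMap.mkContinuous
      { toFun := fun f => (h.choose_spec.memLp_mul f).toLp _
        map_add' := fun f g => by
          rw [← MemLp.toLp_add]
          refine MemLp.toLp_congr _ _ ?_
          filter_upwards [Lp.coeFn_add f g] with p hp
          rw [hp, Pi.add_apply, mul_add]; rfl
        map_smul' := fun c f => by
          rw [RingHom.id_apply, ← MemLp.toLp_const_smul]
          refine MemLp.toLp_congr _ _ ?_
          filter_upwards [Lp.coeFn_smul c f] with p hp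
          rw [hp, Pi.smul_apply, Pi.smul_apply, smul_eq_mul, smul_eq_mul]; ring }
      h.choose (fun f => by
        refine Lp.norm_le_mul_norm_of_ae_le_mul ?_
        filter_upwards [MemLp.coeFn_toLp (h.choose_spec.memLp_mul f), h.choose_spec.2] with p h1 h2
        simp only [LinearMap.coe_mk, AddHom.coe_mk]
        rw [h1, norm_mul, Real.norm_eq_abs]
        gcongr)
  else 0

namespace IsMultiplier

variable {m : ℝ × ℝ → ℝ} {C : ℝ}

lemma coeFn_mulOp (h : IsMultiplier m C) (f : L2) :
    (mulOp m f : ℝ × ℝ → ℝ) =ᵐ[volume] fun p => m p * f p := by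
  have hex : ∃ C, IsMultiplier m C := ⟨C, h⟩
  have : mulOp m f = (hex.choose_spec.memLp_mul f).toLp _ := by
    unfold mulOp
    rw [dif_pos hex]; rfl
  rw [this]
  exact MemLp.coeFn_toLp _

lemma norm_mulOp_apply_le (h : IsMultiplier m C) (f : L2) : ‖mulOp m f‖ ≤ C * ‖f‖ := by
  refine Lp.norm_le_mul_norm_of_ae_le_mul ?_
  filter_upwards [h.coeFn_mulOp f, h.2] with p h1 h2
  rw [h1, norm_mul, Real.norm_eq_abs]
  gcongr

lemma norm_mulOp_le (h : IsMultiplier m C) : ‖mulOp m‖ ≤ C :=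
  ContinuousLinearMap.opNorm_le_bound _ h.nonneg h.norm_mulOp_apply_le

lemma inner_mulOp (h : IsMultiplier m C) (f g : L2) :
    inner ℝ (mulOp m f) g = inner ℝ f (mulOp m g) := by
  rw [L2.inner_def, L2.inner_def]
  refine integral_congr_ae ?_
  filter_upwards [h.coeFn_mulOp f, h.coeFn_mulOp g] with p h1 h2
  simp [h1, h2]; ring

lemma mulOp_toL2 {m : Smooth} (h : IsMultiplier m.1 C) (w : Test) :
    mulOp m.1 (Test.toL2 w) = Test.toL2 (m • w) := by
  apply Lp.ext
  filter_upwards [h.coeFn_mulOp (Test.toL2 w), w.coeFn_toL2, (m • w).coeFn_toL2] with p h1 h2 h3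
  rw [h1, h2, h3]; rfl

end IsMultiplier

lemma L2.norm_sq_eq (f : L2) : ‖f‖ ^ 2 = ∫ p, f p ^ 2 := by
  rw [← real_inner_self_eq_norm_sq, MeasureTheory.L2.inner_def]
  congr 1; ext p; simp [sq]

lemma mulOp_one (f : L2) : mulOp (fun _ => 1) f = f := by
  have h : IsMultiplier (fun _ => (1 : ℝ)) 1 := .of_continuous continuous_const (by simp)
  apply Lp.ext
  filter_upwards [h.coeFn_mulOp f] with p hp
  simp [hp]

/-- Multiplication operators by uniformly bounded functions converge strongly when the functions
converge pointwise. -/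
lemma tendsto_mulOp {ι : Type*} {l : Filter ι} [l.IsCountablyGenerated] {m : ι → ℝ × ℝ → ℝ}
    {m₀ : ℝ × ℝ → ℝ} {C : ℝ} (hm : ∀ᶠ i in l, IsMultiplier (m i) C) (hm₀ : IsMultiplier m₀ C)
    (hlim : ∀ p, Tendsto (fun i => m i p) l (𝓝 (m₀ p))) (f : L2) :
    Tendsto (fun i => mulOp (m i) f) l (𝓝 (mulOp m₀ f)) := by
  rw [tendsto_iff_norm_sub_tendsto_zero]
  have hsq : Tendsto (fun i => ‖mulOp (m i) f - mulOp m₀ f‖ ^ 2) l (𝓝 0) := by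
    have h1 : Tendsto (fun i => ∫ p, ((m i p - m₀ p) * f p) ^ 2) l (𝓝 (∫ _ : ℝ × ℝ, (0 : ℝ))) := by
      refine tendsto_integral_filter_of_dominated_convergence
        (fun p => (2 * C) ^ 2 * f p ^ 2) ?_ ?_ ?_ ?_
      · filter_upwards [hm] with i hi
        exact (((hi.1.sub hm₀.1).mul (Lp.aestronglyMeasurable f)).pow 2)
      · filter_upwards [hm] with i hi
        filter_upwards [hi.2, hm₀.2] with p h1 h2
        rw [Real.norm_eq_abs, abs_pow, abs_mul, mul_pow, sq_abs (f p)]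
        have : |m i p - m₀ p| ≤ 2 * C := (abs_sub _ _).trans (by linarith)
        gcongr
      · exact (Lp.memLp f).integrable_sq.const_mul _
      · refine ae_of_all _ fun p => ?_
        have : Tendsto (fun i => ((m i p - m₀ p) * f p) ^ 2) l (𝓝 (((m₀ p - m₀ p) * f p) ^ 2)) :=
          (((hlim p).sub_const _).mul_const _).pow 2
        simpa using this
    rw [integral_zero] at h1
    refine h1.congr' ?_
    filter_upwards [hm] with i hi
    rw [L2.norm_sq_eq]
    refine integral_congr_ae ?_
    filter_upwards [hi.coeFn_mulOp f, hm₀.coeFn_mulOp f, Lp.coeFn_sub (mulOp (m i) f) (mulOp m₀ f)]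
      with p h1 h2 h3
    rw [h3, Pi.sub_apply, h1, h2]; ring
  have := hsq.sqrt
  simpa using this

/-! ### The Sobolev inequality for test functions -/

/-- A compactly supported `C¹` function on the line is bounded by the integral of its derivative. -/
lemma abs_le_integral_abs_deriv {f : ℝ → ℝ} (hf : ContDiff ℝ 1 f) (hc : HasCompactSupport f)
    (x : ℝ) : |f x| ≤ ∫ s, |deriv f s| := by
  have hint : Integrable (deriv f) :=
    (hf.continuous_deriv le_rfl).integrable_of_hasCompactSupport hc.deriv
  rw [← hc.integral_Iic_deriv_eq hf x]
  calc |∫ s in Iic x, deriv f s| ≤ ∫ s in Iic x, |deriv f s| := abs_integral_le_integral_abs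
    _ ≤ ∫ s, |deriv f s| :=
      setIntegral_le_integral hint.abs (ae_of_all _ fun _ => abs_nonneg _)

namespace Test

lemma hasCompactSupport_fst (w : Test) (y : ℝ) : HasCompactSupport fun s => w.fn (s, y) := by
  have he : IsClosedEmbedding fun s : ℝ => ((s, y) : ℝ × ℝ) := by
    refine Topology.IsClosedEmbedding.of_continuous_injective_isClosedMap (by fun_prop)
      (fun a b h => congrArg Prod.fst h) (fun s hs => ?_)
    have : (fun s : ℝ => ((s, y) : ℝ × ℝ)) '' s = s ×ˢ {y} := by
      ext ⟨a, b⟩; simp [eq_comm]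
    rw [this]
    exact hs.prod isClosed_singleton
  exact w.hasCompactSupport.comp_isClosedEmbedding he

lemma hasCompactSupport_snd (w : Test) (x : ℝ) : HasCompactSupport fun s => w.fn (x, s) := by
  have he : IsClosedEmbedding fun s : ℝ => ((x, s) : ℝ × ℝ) := by
    refine Topology.IsClosedEmbedding.of_continuous_injective_isClosedMap (by fun_prop)
      (fun a b h => congrArg Prod.snd h) (fun s hs => ?_)
    have : (fun s : ℝ => ((x, s) : ℝ × ℝ)) '' s = {x} ×ˢ s := by
      ext ⟨a, b⟩; simp [eq_comm, and_comm]
    rw [this]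
    exact isClosed_singleton.prod hs
  exact w.hasCompactSupport.comp_isClosedEmbedding he

lemma deriv_fst (w : Test) (s y : ℝ) : deriv (fun s => w.fn (s, y)) s = (dd 1 0 w).fn (s, y) := by
  have h : HasDerivAt (fun s : ℝ => ((s, y) : ℝ × ℝ)) (1, 0) s :=
    (hasDerivAt_id s).prodMk (hasDerivAt_const s y)
  have := ((w.1.differentiable (s, y)).hasFDerivAt.comp_hasDerivAt s h).deriv
  rw [dd_fn]
  exact this

lemma deriv_snd (w : Test) (x s : ℝ) : deriv (fun s => w.fn (x, s)) s = (dd 0 1 w).fn (x, s) := by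
  have h : HasDerivAt (fun s : ℝ => ((x, s) : ℝ × ℝ)) (0, 1) s :=
    (hasDerivAt_const s x).prodMk (hasDerivAt_id s)
  have := ((w.1.differentiable (x, s)).hasFDerivAt.comp_hasDerivAt s h).deriv
  rw [dd_fn]
  exact this

/-- The bound `‖w‖_∞ ≤ ‖∂_x ∂_y w‖_{L¹}`. -/
lemma abs_le_integral_abs (w : Test) (p : ℝ × ℝ) : |w.fn p| ≤ ∫ q, |(dd 1 1 w).fn q| := by
  have hi : Integrable (fun q => |(dd 1 1 w).fn q|) ((volume : Measure ℝ).prod volume) :=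
    (dd 1 1 w).integrable.abs
  have hcd : ContDiff ℝ 1 w.fn := w.contDiff.of_le (WithTop.coe_le_coe.2 le_top)
  have hcd' : ContDiff ℝ 1 (dd 1 0 w).fn :=
    (dd 1 0 w).contDiff.of_le (WithTop.coe_le_coe.2 le_top)
  have h1 := abs_le_integral_abs_deriv (f := fun s => w.fn (s, p.2))
    (hcd.comp (contDiff_id.prodMk contDiff_const)) (w.hasCompactSupport_fst p.2) p.1
  refine h1.trans ?_
  have h2 : ∀ s, |deriv (fun s => w.fn (s, p.2)) s| ≤ ∫ t, |(dd 1 1 w).fn (s, t)| := by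
    intro s
    rw [deriv_fst]
    have := abs_le_integral_abs_deriv (f := fun t => (dd 1 0 w).fn (s, t))
      (hcd'.comp (contDiff_const.prodMk contDiff_id)) ((dd 1 0 w).hasCompactSupport_snd s) p.2
    refine this.trans (le_of_eq ?_)
    congr 1; ext t
    rw [deriv_snd, dd_add]
  calc ∫ s, |deriv (fun s => w.fn (s, p.2)) s| ≤ ∫ s, ∫ t, |(dd 1 1 w).fn (s, t)| := by
        refine integral_mono_of_nonneg (ae_of_all _ fun _ => abs_nonneg _) hi.integral_prod_left
          (ae_of_all _ h2)
    _ = ∫ q, |(dd 1 1 w).fn q| := (integral_prod _ hi).symm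

lemma integral_abs_mul_le (f g : Test) : ∫ p, |f.fn p * g.fn p| ≤ ‖toL2 f‖ * ‖toL2 g‖ := by
  have hf : MemLp (fun p => |f.fn p|) 2 volume := f.memLp.abs
  have hg : MemLp (fun p => |g.fn p|) 2 volume := g.memLp.abs
  have h := real_inner_le_norm (hf.toLp _) (hg.toLp _)
  have e1 : ‖hf.toLp _‖ = ‖toL2 f‖ := by
    rw [Lp.norm_toLp]
    change _ = ‖f.memLp.toLp f.fn‖
    rw [Lp.norm_toLp]
    congr 1
    exact eLpNorm_norm f.fn
  have e2 : ‖hg.toLp _‖ = ‖toL2 g‖ := by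
    rw [Lp.norm_toLp]
    change _ = ‖g.memLp.toLp g.fn‖
    rw [Lp.norm_toLp]
    congr 1
    exact eLpNorm_norm g.fn
  rw [e1, e2] at h
  refine le_trans (le_of_eq ?_) h
  rw [MeasureTheory.L2.inner_def]
  refine integral_congr_ae ?_
  filter_upwards [hf.coeFn_toLp, hg.coeFn_toLp] with p h1 h2
  simp [h1, h2, abs_mul, mul_comm]

/-- The Sobolev inequality `‖w‖_∞² ≤ 2 (‖∂_x w‖ ‖∂_y w‖ + ‖w‖ ‖∂_x ∂_y w‖)`, which comes from
integrating `∂_x ∂_y (w²)` over a quadrant. -/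
lemma sq_le (w : Test) (p : ℝ × ℝ) : w.fn p ^ 2 ≤
    2 * (‖toL2 (dd 1 0 w)‖ * ‖toL2 (dd 0 1 w)‖ + ‖toL2 w‖ * ‖toL2 (dd 1 1 w)‖) := by
  have h := abs_le_integral_abs (w.1 • w) p
  have e : ∀ q, (dd 1 1 (w.1 • w)).fn q = 2 * ((dd 1 0 w).fn q * (dd 0 1 w).fn q)
      + 2 * (w.fn q * (dd 1 1 w).fn q) := by
    intro q
    have h0 : dd 1 1 (w.1 • w) = dd 1 0 (dd 0 1 (w.1 • w)) := by rw [dd_add]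
    have h1 : Smooth.dy w.1 = (dd 0 1 w).1 := (Smooth.dd_zero_one _).symm
    have h2 : Smooth.dx (dd 0 1 w).1 = (dd 1 1 w).1 := by
      rw [← Smooth.dd_one_zero, coe_dd, Smooth.dd_add]; rfl
    have h3 : Smooth.dx w.1 = (dd 1 0 w).1 := (Smooth.dd_one_zero _).symm
    rw [h0, dy_smul, map_add, dx_smul, dx_smul, h1, h2, h3, dd_add]
    simp only [add_fn, smooth_smul_fn, Pi.add_apply, Pi.mul_apply]
    change (dd 1 1 w).fn q * w.fn q + (dd 0 1 w).fn q * (dd 1 0 w).fn q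
      + ((dd 1 0 w).fn q * (dd 0 1 w).fn q + w.fn q * (dd 1 1 w).fn q) = _
    ring
  have e0 : |(w.1 • w).fn p| = w.fn p ^ 2 := by
    change |w.fn p * w.fn p| = _
    rw [← sq, abs_of_nonneg (sq_nonneg _)]
  rw [e0] at h
  refine h.trans ?_
  have i1 : Integrable (fun q => |(dd 1 0 w).fn q * (dd 0 1 w).fn q|) :=
    ((dd 1 0 w).1 • dd 0 1 w).integrable.abs
  have i2 : Integrable (fun q => |w.fn q * (dd 1 1 w).fn q|) :=
    (w.1 • dd 1 1 w).integrable.abs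
  calc ∫ q, |(dd 1 1 (w.1 • w)).fn q|
      ≤ ∫ q, (2 * |(dd 1 0 w).fn q * (dd 0 1 w).fn q| + 2 * |w.fn q * (dd 1 1 w).fn q|) := by
        refine integral_mono_of_nonneg (ae_of_all _ fun _ => abs_nonneg _)
          ((i1.const_mul 2).add (i2.const_mul 2)) (ae_of_all _ fun q => ?_)
        simp only []
        rw [e]
        refine (abs_add_le _ _).trans (le_of_eq ?_)
        rw [abs_mul 2, abs_mul 2]; simp
    _ = 2 * (∫ q, |(dd 1 0 w).fn q * (dd 0 1 w).fn q|) + 2 * ∫ q, |w.fn q * (dd 1 1 w).fn q| := by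
        rw [integral_add (i1.const_mul 2) (i2.const_mul 2), integral_const_mul, integral_const_mul]
    _ ≤ _ := by
        have := integral_abs_mul_le (dd 1 0 w) (dd 0 1 w)
        have := integral_abs_mul_le w (dd 1 1 w)
        linarith

lemma norm_toL2_dd_le (a b : ℕ) (h : a + b ≤ 4) (w : Test) : ‖toL2 (dd a b w)‖ ≤ ‖toH4 w‖ := by
  have := H4.norm_D_le ⟨(⟨a, by omega⟩, ⟨b, by omega⟩), h⟩ (toH4 w)
  rwa [D_toH4] at this

/-- Derivatives of order at most two are bounded by the `H⁴` norm. -/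
lemma abs_dd_le (a b : ℕ) (h : a + b ≤ 2) (w : Test) (p : ℝ × ℝ) :
    |(dd a b w).fn p| ≤ 2 * ‖toH4 w‖ := by
  have h1 := sq_le (dd a b w) p
  rw [dd_add, dd_add, dd_add] at h1
  have a1 := norm_toL2_dd_le (1 + a) (0 + b) (by omega) w
  have a2 := norm_toL2_dd_le (0 + a) (1 + b) (by omega) w
  have a3 := norm_toL2_dd_le a b (by omega) w
  have a4 := norm_toL2_dd_le (1 + a) (1 + b) (by omega) w
  refine abs_le_of_sq_le_sq ?_ (by positivity)
  refine h1.trans ?_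
  have b1 := mul_le_mul a1 a2 (norm_nonneg _) (norm_nonneg _)
  have b2 := mul_le_mul a3 a4 (norm_nonneg _) (norm_nonneg _)
  nlinarith

end Test

/-! ### Injectivity of `P` and density of test functions in `H⁴` -/

namespace Test

/-- The reflected translate `q ↦ w (p - q)` of a test function. -/
def reflect (p : ℝ × ℝ) (w : Test) : Test :=
  mk (fun q => w.fn (p - q)) (w.contDiff.comp (contDiff_const.sub contDiff_id))
    (w.hasCompactSupport.comp_homeomorph (Homeomorph.subLeft p))

@[simp] lemma reflect_fn (p : ℝ × ℝ) (w : Test) (q : ℝ × ℝ) :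
    (reflect p w).fn q = w.fn (p - q) := rfl

lemma fderiv_reflect (p q e : ℝ × ℝ) (w : Test) :
    fderiv ℝ (reflect p w).fn q e = - fderiv ℝ w.fn (p - q) e := by
  have h : HasFDerivAt (fun q : ℝ × ℝ => p - q) (-ContinuousLinearMap.id ℝ (ℝ × ℝ)) q :=
    (hasFDerivAt_id q).const_sub p
  have := ((w.1.differentiable (p - q)).hasFDerivAt.comp q h).fderiv
  have h2 := congrArg (fun L => L e) this
  refine h2.trans ?_
  simp
  rfl

lemma dd_reflect (p : ℝ × ℝ) (a b : ℕ) (w : Test) :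
    dd a b (reflect p w) = (-1 : ℝ) ^ (a + b) • reflect p (dd a b w) := by
  have hx : ∀ w : Test, dd 1 0 (reflect p w) = (-1 : ℝ) • reflect p (dd 1 0 w) := fun w => by
    ext q
    rw [dd_fn, smul_fn, Pi.smul_apply, reflect_fn, dd_fn]
    exact (fderiv_reflect p q (1, 0) w).trans (by simp [partialXY, partialX])
  have hy : ∀ w : Test, dd 0 1 (reflect p w) = (-1 : ℝ) • reflect p (dd 0 1 w) := fun w => by
    ext q
    rw [dd_fn, smul_fn, Pi.smul_apply, reflect_fn, dd_fn]
    exact (fderiv_reflect p q (0, 1) w).trans (by simp [partialXY, partialY])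
  have hyb : ∀ b : ℕ, dd 0 b (reflect p w) = (-1 : ℝ) ^ b • reflect p (dd 0 b w) := by
    intro b
    induction b with
    | zero => simp
    | succ n ih =>
      rw [add_comm, ← zero_add 0, ← dd_add, ih, map_smul, hy, dd_add, smul_smul, pow_add, mul_comm]
      simp
  induction a with
  | zero => simpa using hyb b
  | succ n ih =>
    have e : ∀ v, dd (n + 1) b v = dd 1 0 (dd n b v) := fun v => by
      rw [dd_add]; congr 2 <;> omega
    rw [e, ih, map_smul, hx, e w, smul_smul]
    congr 1
    ring

lemma opP_reflect (p : ℝ × ℝ) (w : Test) : opP (reflect p w) = reflect p (opP w) := by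
  have hadd : ∀ s : Finset MultiIndex4, ∀ f : MultiIndex4 → Test,
      reflect p (∑ α ∈ s, f α) = ∑ α ∈ s, reflect p (f α) := by
    classical
    intro s f
    induction s using Finset.induction_on with
    | empty => ext q; rfl
    | insert a s ha ih =>
      rw [Finset.sum_insert ha, Finset.sum_insert ha, ← ih]; ext q; rfl
  rw [opP, LinearMap.sum_apply, LinearMap.sum_apply, hadd]
  refine Finset.sum_congr rfl fun α _ => ?_
  simp only [LinearMap.smul_apply, LinearMap.comp_apply]
  rw [dd_reflect, map_smul, dd_reflect, smul_smul, ← mul_pow]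
  ext q
  simp

/-- The convolution of an `L²` function with a test function. -/
def conv (f : L2) (w : Test) : Smooth :=
  ⟨convolution f w.fn (ContinuousLinearMap.mul ℝ ℝ) volume,
    w.hasCompactSupport.contDiff_convolution_right _
      ((Lp.memLp f).locallyIntegrable (by norm_num)) w.contDiff⟩

lemma conv_apply (f : L2) (w : Test) (p : ℝ × ℝ) :
    (conv f w).1 p = ∫ q, f q * w.fn (p - q) := rfl

lemma conv_eq_inner (f : L2) (w : Test) (p : ℝ × ℝ) :
    (conv f w).1 p = inner ℝ f (toL2 (reflect p w)) := by
  rw [inner_toL2]; rfl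

lemma fderiv_conv (f : L2) (w : Test) (p e : ℝ × ℝ) :
    fderiv ℝ (conv f w).1 p e = ∫ q, f q * fderiv ℝ w.fn (p - q) e := by
  have hf : LocallyIntegrable f volume := (Lp.memLp f).locallyIntegrable (by norm_num)
  have h := (w.hasCompactSupport.hasFDerivAt_convolution_right (ContinuousLinearMap.mul ℝ ℝ) hf
    (w.contDiff.of_le (WithTop.coe_le_coe.2 le_top)) p).fderiv
  have h2 := congrArg (fun L => L e) h
  refine h2.trans ?_
  rw [convolution_precompR_apply _ hf (w.hasCompactSupport.fderiv ℝ)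
    (w.contDiff.continuous_fderiv (by simp))]
  rfl

lemma dd_conv (f : L2) (a b : ℕ) (w : Test) : Smooth.dd a b (conv f w) = conv f (dd a b w) := by
  have hx : ∀ w : Test, Smooth.dx (conv f w) = conv f (dd 1 0 w) := fun w => by
    ext p
    refine (fderiv_conv f w p (1, 0)).trans ?_
    rw [conv_apply]
    refine integral_congr_ae (ae_of_all _ fun q => ?_)
    simp only [dd_fn]; rfl
  have hy : ∀ w : Test, Smooth.dy (conv f w) = conv f (dd 0 1 w) := fun w => by
    ext p
    refine (fderiv_conv f w p (0, 1)).trans ?_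
    rw [conv_apply]
    refine integral_congr_ae (ae_of_all _ fun q => ?_)
    simp only [dd_fn]; rfl
  have hyb : ∀ b : ℕ, Smooth.dd 0 b (conv f w) = conv f (dd 0 b w) := by
    intro b
    induction b with
    | zero => simp
    | succ n ih =>
      rw [← Smooth.dy_dd, ih, hy, dd_add, add_comm 1 n]
  induction a with
  | zero => exact hyb b
  | succ n ih =>
    rw [← Smooth.dx_dd, ih, hx, dd_add, add_comm 1 n, zero_add]

/-- Young's inequality `L² * L¹ ⊆ L²`, in the form needed here. -/
lemma memLp_conv (f : L2) (w : Test) : MemLp (conv f w).1 2 volume := by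
  rw [memLp_two_iff_integrable_sq (conv f w).continuous.aestronglyMeasurable]
  have hf2 : Integrable (fun q => f q ^ 2) := (Lp.memLp f).integrable_sq
  have hw : Integrable (fun q => |w.fn q|) := w.integrable.abs
  set G : ℝ × ℝ → ℝ := convolution (fun q => f q ^ 2) (fun q => |w.fn q|)
    (ContinuousLinearMap.mul ℝ ℝ) volume with hG
  have hGi : Integrable G := hf2.integrable_convolution _ hw
  refine (hGi.const_mul (∫ q, |w.fn q|)).mono'
    ((conv f w).continuous.aestronglyMeasurable.pow 2) (ae_of_all _ fun p => ?_)
  rw [Real.norm_eq_abs, abs_of_nonneg (sq_nonneg _)]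
  set h : ℝ × ℝ → ℝ := fun q => |w.fn (p - q)| with hh
  have hLp : MemLp (fun q => f q) 2 volume := Lp.memLp f
  have hi : Integrable h := (reflect p w).integrable.abs
  have hcont : Continuous h := (reflect p w).continuous.abs
  have hhLp : MemLp h 2 volume := (reflect p w).memLp.abs
  have hi1 : Integrable (fun q => h q * |f q|) := hhLp.integrable_mul hLp.abs
  have hi2 : Integrable (fun q => h q * f q ^ 2) := by
    obtain ⟨C, hC⟩ := (reflect p w).hasCompactSupport.exists_bound_of_continuous
      (reflect p w).continuous
    refine hf2.bdd_mul (c := C) hcont.aestronglyMeasurable (ae_of_all _ fun q => ?_)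
    simpa [hh] using hC q
  have hA : ∫ q, h q = ∫ q, |w.fn q| := integral_sub_left_eq_self (fun q => |w.fn q|) volume p
  have hC : ∫ q, h q * f q ^ 2 = G p := by
    rw [hG, convolution_def]
    refine integral_congr_ae (ae_of_all _ fun q => ?_)
    simp [hh, mul_comm]
  have hB : |(conv f w).1 p| ≤ ∫ q, h q * |f q| := by
    rw [conv_apply]
    refine abs_integral_le_integral_abs.trans (le_of_eq ?_)
    refine integral_congr_ae (ae_of_all _ fun q => ?_)
    simp [hh, abs_mul, mul_comm]
  have hdisc := discrim_le_zero (a := ∫ q, h q) (b := -2 * ∫ q, h q * |f q|)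
    (c := ∫ q, h q * f q ^ 2) (fun c => by
      have : 0 ≤ ∫ q, h q * (c - |f q|) ^ 2 :=
        integral_nonneg fun q => mul_nonneg (abs_nonneg _) (sq_nonneg _)
      have e : ∫ q, h q * (c - |f q|) ^ 2
          = ∫ q, (((c * c) * h q - 2 * c * (h q * |f q|)) + h q * f q ^ 2) := by
        refine integral_congr_ae (ae_of_all _ fun q => ?_)
        simp only []
        rw [← sq_abs (f q)]; ring
      have hs : Integrable (fun q => (c * c) * h q - 2 * c * (h q * |f q|)) :=
        (hi.const_mul _).sub (hi1.const_mul _)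
      rw [e, integral_add hs hi2, integral_sub (hi.const_mul _) (hi1.const_mul _),
        integral_const_mul, integral_const_mul] at this
      linarith)
  rw [discrim, hA, hC] at hdisc
  have hsq : (conv f w).1 p ^ 2 ≤ (∫ q, h q * |f q|) ^ 2 := by
    rw [← sq_abs]; gcongr
  nlinarith

/-- A cutoff function equal to one near the origin. -/
lemma exists_cutoff : ∃ χ : Test, χ.fn 0 = 1 := by
  let b : ContDiffBump (0 : ℝ × ℝ) := ⟨1, 2, one_pos, one_lt_two⟩
  refine ⟨mk b b.contDiff b.hasCompactSupport, ?_⟩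
  exact b.one_of_mem_closedBall (by simp [b.rIn_pos.le])

/-- The dilation `p ↦ w (p / (n + 1))` of a test function. -/
def dilate (n : ℕ) (w : Test) : Test :=
  mk (fun p => w.fn ((n + 1 : ℝ)⁻¹ • p)) (w.contDiff.comp (contDiff_const_smul _))
    (w.hasCompactSupport.comp_homeomorph
      (Homeomorph.smulOfNeZero ((n + 1 : ℝ)⁻¹) (inv_ne_zero (by positivity))))

@[simp] lemma dilate_fn (n : ℕ) (w : Test) (p : ℝ × ℝ) :
    (dilate n w).fn p = w.fn ((n + 1 : ℝ)⁻¹ • p) := rfl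

lemma fderiv_dilate (n : ℕ) (p e : ℝ × ℝ) (w : Test) :
    fderiv ℝ (dilate n w).fn p e = (n + 1 : ℝ)⁻¹ * fderiv ℝ w.fn ((n + 1 : ℝ)⁻¹ • p) e := by
  have h : HasFDerivAt (fun q : ℝ × ℝ => (n + 1 : ℝ)⁻¹ • q)
      ((n + 1 : ℝ)⁻¹ • ContinuousLinearMap.id ℝ (ℝ × ℝ)) p :=
    (hasFDerivAt_id (𝕜 := ℝ) p).const_smul ((n + 1 : ℝ)⁻¹)
  have := ((w.1.differentiable ((n + 1 : ℝ)⁻¹ • p)).hasFDerivAt.comp p h).fderiv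
  have h2 := congrArg (fun L => L e) this
  refine h2.trans ?_
  simp
  exact Or.inl rfl

lemma dd_dilate (n a b : ℕ) (w : Test) :
    dd a b (dilate n w) = ((n + 1 : ℝ)⁻¹) ^ (a + b) • dilate n (dd a b w) := by
  have hx : ∀ w : Test, dd 1 0 (dilate n w) = (n + 1 : ℝ)⁻¹ • dilate n (dd 1 0 w) := fun w => by
    ext q
    rw [dd_fn, smul_fn, Pi.smul_apply, dilate_fn, dd_fn]
    exact (fderiv_dilate n q (1, 0) w)
  have hy : ∀ w : Test, dd 0 1 (dilate n w) = (n + 1 : ℝ)⁻¹ • dilate n (dd 0 1 w) := fun w => by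
    ext q
    rw [dd_fn, smul_fn, Pi.smul_apply, dilate_fn, dd_fn]
    exact (fderiv_dilate n q (0, 1) w)
  have hyb : ∀ b : ℕ, dd 0 b (dilate n w) = ((n + 1 : ℝ)⁻¹) ^ b • dilate n (dd 0 b w) := by
    intro b
    induction b with
    | zero => simp
    | succ k ih =>
      rw [add_comm, ← zero_add 0, ← dd_add, ih, map_smul, hy, dd_add, smul_smul, pow_add, mul_comm]
      simp
  induction a with
  | zero => simpa using hyb b
  | succ k ih =>
    have e : ∀ v, dd (k + 1) b v = dd 1 0 (dd k b v) := fun v => by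
      rw [dd_add]; congr 2 <;> omega
    rw [e, ih, map_smul, hx, e w, smul_smul]
    congr 1
    ring

lemma exists_bound (w : Test) : ∃ C, ∀ p, |w.fn p| ≤ C :=
  w.hasCompactSupport.exists_bound_of_continuous w.continuous

/-- Dilated cutoffs: the derivatives tend to zero, the functions tend to one. -/
lemma tendsto_dd_dilate {χ : Test} (hχ : χ.fn 0 = 1) (a b : ℕ) (p : ℝ × ℝ) :
    Tendsto (fun n => (dd a b (dilate n χ)).fn p) atTop (𝓝 (if a = 0 ∧ b = 0 then 1 else 0)) := by
  have hinv : Tendsto (fun n : ℕ => (n + 1 : ℝ)⁻¹) atTop (𝓝 0) := by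
    simpa [one_div] using tendsto_one_div_add_atTop_nhds_zero_nat (𝕜 := ℝ)
  have h1 : Tendsto (fun n : ℕ => (dd a b χ).fn ((n + 1 : ℝ)⁻¹ • p)) atTop
      (𝓝 ((dd a b χ).fn 0)) := by
    refine (dd a b χ).continuous.continuousAt.tendsto.comp ?_
    simpa using hinv.smul_const p
  have h2 := (hinv.pow (a + b)).mul h1
  simp only [dd_dilate, smul_fn, Pi.smul_apply, dilate_fn, smul_eq_mul]
  refine h2.trans (le_of_eq ?_)
  congr 1
  split_ifs with h
  · obtain ⟨rfl, rfl⟩ := h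
    simpa using hχ
  · have : a + b ≠ 0 := by omega
    rw [zero_pow this, zero_mul]

/-- A smooth function all of whose derivatives are square integrable and which is annihilated by
`P` vanishes: test the equation with cutoffs of the function itself. -/
lemma eq_zero_of_opP {F : Smooth} (hF : ∀ a b, MemLp (Smooth.dd a b F).1 2 volume)
    (hP : ∀ p, ∑ α : MultiIndex4, ((-1 : ℝ) ^ ((α.1.1 : ℕ) + (α.1.2 : ℕ))) *
      (Smooth.dd α.1.1 α.1.2 (Smooth.dd α.1.1 α.1.2 F)).1 p = 0) : F = 0 := by
  obtain ⟨χ, hχ⟩ := exists_cutoff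
  have hbound : ∀ (a b n : ℕ) (C : ℝ), (∀ p, |(dd a b χ).fn p| ≤ C) →
      ∀ p, |(dd a b (dilate n χ)).fn p| ≤ C := by
    intro a b n C hC p
    rw [dd_dilate, smul_fn, Pi.smul_apply, smul_eq_mul, abs_mul, dilate_fn]
    have : |((n + 1 : ℝ)⁻¹) ^ (a + b)| ≤ 1 := by
      rw [abs_of_nonneg (by positivity)]
      exact pow_le_one₀ (by positivity)
        (inv_le_one_of_one_le₀ (by linarith [n.cast_nonneg (α := ℝ)]))
    calc _ ≤ 1 * C := mul_le_mul this (hC _) (abs_nonneg _) zero_le_one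
      _ = C := one_mul _
  -- the identity obtained by testing with `χ_n F`
  have hid : ∀ n : ℕ, ∑ α : MultiIndex4,
      ∫ p, (Smooth.dd α.1.1 α.1.2 F).1 p * (ddα α (F • dilate n χ)).fn p = 0 := by
    intro n
    have h0 : ∀ α : MultiIndex4,
        ∫ p, (Smooth.dd α.1.1 α.1.2 F).1 p * (ddα α (F • dilate n χ)).fn p
        = ∫ p, ((-1 : ℝ) ^ ((α.1.1 : ℕ) + (α.1.2 : ℕ))) *
          (Smooth.dd α.1.1 α.1.2 (Smooth.dd α.1.1 α.1.2 F)).1 p * (F • dilate n χ).fn p := by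
      intro α
      rw [integral_mul_dd]
      simp only [mul_assoc]
      rw [integral_const_mul]
    simp only [h0]
    rw [← integral_finsetSum]
    · rw [← integral_zero (ℝ × ℝ) ℝ]
      refine integral_congr_ae (ae_of_all _ fun p => ?_)
      simp only []
      rw [← Finset.sum_mul, hP p, zero_mul]
    · intro α _
      simp only [mul_assoc]
      exact (Test.integrable
        (Smooth.dd α.1.1 α.1.2 (Smooth.dd α.1.1 α.1.2 F) • (F • dilate n χ))).const_mul _
  have hlim : ∀ α : MultiIndex4, Tendsto (fun n : ℕ =>
      ∫ p, (Smooth.dd α.1.1 α.1.2 F).1 p * (ddα α (F • dilate n χ)).fn p) atTop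
      (𝓝 (∫ p, (Smooth.dd α.1.1 α.1.2 F).1 p ^ 2)) := by
    intro α
    let I := Finset.HasAntidiagonal.antidiagonal (α.1.1 : ℕ) ×ˢ
      Finset.HasAntidiagonal.antidiagonal (α.1.2 : ℕ)
    choose C hC using fun q : ℕ × ℕ => exists_bound (dd q.1 q.2 χ)
    have hC0 : ∀ q, 0 ≤ C q := fun q => (abs_nonneg _).trans (hC q 0)
    have hexp : ∀ (n : ℕ) (p : ℝ × ℝ), (ddα α (F • dilate n χ)).fn p =
        ∑ r ∈ I,
          ((Nat.choose α.1.1 r.1.1 * Nat.choose α.1.2 r.2.1 : ℕ) : ℝ) *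
          ((Smooth.dd r.1.1 r.2.1 F).1 p * (dd r.1.2 r.2.2 (dilate n χ)).fn p) := by
      intro n p
      rw [ddα, dd_smul]
      have : ∀ (s : Finset ((ℕ × ℕ) × (ℕ × ℕ))) (f : (ℕ × ℕ) × (ℕ × ℕ) → Test),
          (∑ r ∈ s, f r).fn p = ∑ r ∈ s, (f r).fn p := by
        classical
        intro s f
        induction s using Finset.induction_on with
        | empty => rfl
        | insert a s ha ih => rw [Finset.sum_insert ha, Finset.sum_insert ha, ← ih]; rfl
      rw [this]
      refine Finset.sum_congr rfl fun r _ => ?_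
      rfl
    refine tendsto_integral_of_dominated_convergence (fun p =>
      ∑ r ∈ I,
        |(Smooth.dd α.1.1 α.1.2 F).1 p * (Smooth.dd r.1.1 r.2.1 F).1 p| *
          (((Nat.choose α.1.1 r.1.1 * Nat.choose α.1.2 r.2.1 : ℕ) : ℝ) * C (r.1.2, r.2.2)))
      ?_ ?_ ?_ ?_
    · intro n
      exact ((Smooth.dd α.1.1 α.1.2 F).continuous.mul
        (ddα α (F • dilate n χ)).continuous).aestronglyMeasurable
    · refine integrable_finsetSum _ fun r _ => Integrable.mul_const ?_ _
      exact ((hF _ _).integrable_mul (hF _ _)).abs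
    · intro n
      refine ae_of_all _ fun p => ?_
      rw [hexp, Finset.mul_sum]
      refine (norm_sum_le _ _).trans (Finset.sum_le_sum fun r _ => ?_)
      rw [Real.norm_eq_abs]
      rw [show ∀ a b c d : ℝ, a * (b * (c * d)) = (a * c) * (b * d) by intros; ring, abs_mul]
      gcongr
      rw [abs_mul, Nat.abs_cast]
      gcongr
      exact hbound _ _ n _ (hC (r.1.2, r.2.2)) p
    · refine ae_of_all _ fun p => ?_
      simp only [hexp]
      rw [sq]
      refine Tendsto.const_mul _ ?_
      have ht := tendsto_finsetSum I
        (fun (r : (ℕ × ℕ) × (ℕ × ℕ)) _ => ((tendsto_dd_dilate hχ r.1.2 r.2.2 p).const_mul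
          ((Smooth.dd r.1.1 r.2.1 F).1 p)).const_mul
          ((Nat.choose α.1.1 r.1.1 * Nat.choose α.1.2 r.2.1 : ℕ) : ℝ))
      refine ht.trans (le_of_eq ?_)
      congr 1
      rw [Finset.sum_eq_single (((α.1.1 : ℕ), 0), ((α.1.2 : ℕ), 0))]
      · simp
      · rintro ⟨⟨i, i'⟩, ⟨j, j'⟩⟩ hr hne
        simp only [I, Finset.mem_product, Finset.HasAntidiagonal.mem_antidiagonal] at hr
        rw [if_neg, mul_zero, mul_zero]
        rintro ⟨h1, h2⟩
        apply hne
        simp only [Prod.mk.injEq]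
        dsimp only at h1 h2
        omega
      · intro h
        simp [I] at h
  have hsum := tendsto_finsetSum Finset.univ fun α _ => hlim α
  simp only [hid] at hsum
  have hz := tendsto_nhds_unique hsum tendsto_const_nhds
  have h00 : ∫ p, F.1 p ^ 2 = 0 := by
    have := (Finset.sum_eq_zero_iff_of_nonneg
      (fun α _ => integral_nonneg fun p => sq_nonneg _)).1 hz MultiIndex4.zero (Finset.mem_univ _)
    have e : Smooth.dd (MultiIndex4.zero.1.1 : ℕ) (MultiIndex4.zero.1.2 : ℕ) F = F := by
      change Smooth.dd 0 0 F = F; simp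
    rwa [e] at this
  have hF0 : MemLp F.1 2 volume := by simpa using hF 0 0
  rw [integral_eq_zero_iff_of_nonneg (fun p => sq_nonneg _) hF0.integrable_sq] at h00
  have : F.1 = fun _ => 0 := by
    refine Continuous.ae_eq_iff_eq volume F.continuous continuous_const |>.1 ?_
    filter_upwards [h00] with p hp
    simpa using hp
  ext p
  exact congrFun this p

/-- An `L²` function orthogonal to the range of `P` on test functions vanishes: its convolutions
with test functions are smooth, square integrable with all derivatives, and annihilated by `P`. -/
theorem eq_zero_of_inner_opP {f : L2} (h : ∀ w : Test, inner ℝ f (toL2 (opP w)) = 0) : f = 0 := by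
  have hconv : ∀ w : Test, conv f w = 0 := fun w => by
    refine eq_zero_of_opP (fun a b => ?_) fun p => ?_
    · rw [dd_conv]; exact memLp_conv f _
    · have h1 := h (reflect p w)
      rw [opP_reflect, opP, LinearMap.sum_apply] at h1
      have hadd : ∀ s : Finset MultiIndex4, ∀ g : MultiIndex4 → Test,
          inner ℝ f (toL2 (reflect p (∑ α ∈ s, g α))) = ∑ α ∈ s, (conv f (g α)).1 p := by
        classical
        intro s g
        induction s using Finset.induction_on with
        | empty =>
          have : reflect p (0 : Test) = 0 := rfl
          simp [this]
        | insert a s ha ih =>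
          have : reflect p (g a + ∑ α ∈ s, g α) = reflect p (g a) + reflect p (∑ α ∈ s, g α) := rfl
          rw [Finset.sum_insert ha, Finset.sum_insert ha, ← ih, this, map_add, inner_add_right,
            conv_eq_inner]
      rw [hadd] at h1
      rw [← h1]
      refine Finset.sum_congr rfl fun α _ => ?_
      rw [dd_conv, dd_conv, conv_apply, conv_apply, ← integral_const_mul]
      refine integral_congr_ae (ae_of_all _ fun q => ?_)
      simp only [LinearMap.smul_apply, LinearMap.comp_apply, smul_fn, Pi.smul_apply, smul_eq_mul]
      ring
  refine eq_zero_of_inner fun w => ?_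
  have h1 : reflect 0 (reflect 0 w) = w := by ext q; simp
  rw [← h1, ← conv_eq_inner, hconv]
  rfl

/-- Test functions are dense in `H⁴`. -/
theorem denseRange_toH4 : DenseRange toH4 := by
  have h : (LinearMap.range toH4).topologicalClosure = ⊤ := by
    rw [Submodule.topologicalClosure_eq_top_iff, Submodule.eq_bot_iff]
    intro u hu
    rw [Submodule.mem_orthogonal'] at hu
    have h0 : H4.incl u = 0 := eq_zero_of_inner_opP fun w => by
      rw [← inner_toH4]; exact hu _ ⟨w, rfl⟩
    exact H4.incl_injective (by rw [h0, map_zero])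
  intro u
  have : u ∈ (LinearMap.range toH4).topologicalClosure := by rw [h]; trivial
  exact this

lemma exists_seq_tendsto (u : H4) : ∃ w : ℕ → Test, Tendsto (fun n => toH4 (w n)) atTop (𝓝 u) := by
  obtain ⟨x, hx, hlim⟩ := mem_closure_iff_seq_limit.1 (denseRange_toH4 u)
  choose w hw using hx
  exact ⟨w, by simpa only [hw] using hlim⟩

end Test

/-- The Sobolev embedding `H⁴ ⊆ L^∞`. -/
lemma H4.isMultiplier_fn (u : H4) : IsMultiplier u.fn (2 * ‖u‖) := by
  refine ⟨Lp.aestronglyMeasurable _, ?_⟩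
  obtain ⟨w, hw⟩ := Test.exists_seq_tendsto u
  have h1 : Tendsto (fun n => H4.incl (Test.toH4 (w n))) atTop (𝓝 (H4.incl u)) :=
    (H4.incl.continuous.tendsto u).comp hw
  obtain ⟨k, hk, hae⟩ := (tendstoInMeasure_of_tendsto_Lp h1).exists_seq_tendsto_ae
  have h2 : ∀ᵐ p, ∀ n, (H4.incl (Test.toH4 (w n)) : ℝ × ℝ → ℝ) p = (w n).fn p :=
    ae_all_iff.2 fun n => by rw [Test.incl_toH4]; exact Test.coeFn_toL2 _
  filter_upwards [hae, h2] with p hp h2p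
  have h3 : Tendsto (fun n => 2 * ‖Test.toH4 (w (k n))‖) atTop (𝓝 (2 * ‖u‖)) :=
    ((hw.comp hk.tendsto_atTop).norm).const_mul 2
  refine le_of_tendsto_of_tendsto hp.abs h3 (Eventually.of_forall fun n => ?_)
  simp only []
  rw [h2p]
  simpa using Test.abs_dd_le 0 0 (by norm_num) (w (k n)) p

/-- Multiplication by an `H⁴` function, as an operator on `L²` depending continuously on the
function. -/
def mulH4 : H4 →L[ℝ] L2 →L[ℝ] L2 :=
  LinearMap.mkContinuous
    { toFun := fun u => mulOp u.fn
      map_add' := fun u v => by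
        ext1 f
        apply Lp.ext
        have e : (u + v).fn =ᵐ[volume] fun p => u.fn p + v.fn p :=
          Lp.coeFn_add (H4.incl u) (H4.incl v)
        filter_upwards [(u + v).isMultiplier_fn.coeFn_mulOp f, u.isMultiplier_fn.coeFn_mulOp f,
          v.isMultiplier_fn.coeFn_mulOp f, e, Lp.coeFn_add (mulOp u.fn f) (mulOp v.fn f)]
          with p h1 h2 h3 h4 h5
        rw [_root_.add_apply, h5, Pi.add_apply, h1, h2, h3, h4, add_mul]
      map_smul' := fun c u => by
        ext1 f
        apply Lp.ext
        have e : (c • u).fn =ᵐ[volume] fun p => c * u.fn p := Lp.coeFn_smul c (H4.incl u)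
        filter_upwards [(c • u).isMultiplier_fn.coeFn_mulOp f, u.isMultiplier_fn.coeFn_mulOp f,
          e, Lp.coeFn_smul c (mulOp u.fn f)] with p h1 h2 h3 h4
        rw [RingHom.id_apply, _root_.smul_apply, h4, Pi.smul_apply, h1, h2, h3,
          smul_eq_mul, mul_assoc] }
    2 (fun u => u.isMultiplier_fn.norm_mulOp_le)

lemma mulH4_apply (u : H4) : mulH4 u = mulOp u.fn := rfl

lemma norm_mulH4_le (u : H4) : ‖mulH4 u‖ ≤ 2 * ‖u‖ := u.isMultiplier_fn.norm_mulOp_le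

lemma mulH4_toH4 (g w : Test) : mulH4 (Test.toH4 g) (Test.toL2 w) = Test.toL2 (g.1 • w) := by
  apply Lp.ext
  have e : (Test.toH4 g).fn =ᵐ[volume] g.fn := by
    rw [H4.fn_eq, Test.incl_toH4]; exact Test.coeFn_toL2 g
  filter_upwards [(Test.toH4 g).isMultiplier_fn.coeFn_mulOp (Test.toL2 w), w.coeFn_toL2,
    (g.1 • w).coeFn_toL2, e] with p h1 h2 h3 h4
  rw [mulH4_apply, h1, h2, h3, h4]; rfl

/-! ### Uniform bounds on the weights -/

namespace Smooth

/-- The coordinate function `x`. -/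
def cx : Smooth := ⟨fun p => p.1, show ContDiff ℝ ∞ (fun p : ℝ × ℝ => p.1) from contDiff_fst⟩

/-- The coordinate function `y`. -/
def cy : Smooth := ⟨fun p => p.2, show ContDiff ℝ ∞ (fun p : ℝ × ℝ => p.2) from contDiff_snd⟩

/-- The constant functions. -/
abbrev const (c : ℝ) : Smooth := algebraMap ℝ Smooth c

lemma dx_cx : dx cx = 1 := by
  ext p
  change fderiv ℝ Prod.fst p (1, 0) = 1
  rw [fderiv_fst]; rfl

lemma dx_cy : dx cy = 0 := by
  ext p
  change fderiv ℝ Prod.snd p (1, 0) = 0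
  rw [fderiv_snd]; rfl

lemma dy_cx : dy cx = 0 := by
  ext p
  change fderiv ℝ Prod.fst p (0, 1) = 0
  rw [fderiv_fst]; rfl

lemma dy_cy : dy cy = 1 := by
  ext p
  change fderiv ℝ Prod.snd p (0, 1) = 1
  rw [fderiv_snd]; rfl

/-- The weight `⟨δ (x, y)⟩⁻¹` as a smooth function. -/
def wt (δ : ℝ) : Smooth :=
  ⟨weight δ, by
    have h : ∀ p : ℝ × ℝ, 1 + δ ^ 2 * (p.1 ^ 2 + p.2 ^ 2) ≠ 0 := fun p => by positivity
    have h' : ∀ p : ℝ × ℝ, Real.sqrt (1 + δ ^ 2 * (p.1 ^ 2 + p.2 ^ 2)) ≠ 0 := fun p => by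
      positivity
    have hc : ContDiff ℝ ∞ fun p : ℝ × ℝ => 1 + δ ^ 2 * (p.1 ^ 2 + p.2 ^ 2) := by fun_prop
    exact ContDiff.inv (ContDiff.sqrt hc h) h'⟩

lemma wt_apply (δ : ℝ) (p : ℝ × ℝ) : (wt δ).1 p = weight δ p := rfl

lemma weight_pos (δ : ℝ) (p : ℝ × ℝ) : 0 < weight δ p := by
  unfold weight; positivity

lemma weight_sq (δ : ℝ) (p : ℝ × ℝ) :
    weight δ p ^ 2 * (1 + δ ^ 2 * (p.1 ^ 2 + p.2 ^ 2)) = 1 := by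
  unfold weight
  rw [inv_pow, Real.sq_sqrt (by positivity)]
  exact inv_mul_cancel₀ (by positivity)

lemma weight_le_one (δ : ℝ) (p : ℝ × ℝ) : weight δ p ≤ 1 := by
  have h := weight_sq δ p
  have h0 := weight_pos δ p
  have : 0 ≤ weight δ p ^ 2 * (δ ^ 2 * (p.1 ^ 2 + p.2 ^ 2)) := by positivity
  nlinarith

lemma weight_zero (p : ℝ × ℝ) : weight 0 p = 1 := by simp [weight]

lemma abs_mul_weight_le (δ : ℝ) (p : ℝ × ℝ) :
    |δ * p.1 * weight δ p| ≤ 1 ∧ |δ * p.2 * weight δ p| ≤ 1 := by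
  have h := weight_sq δ p
  have h0 := weight_pos δ p
  have h1 : 0 ≤ (weight δ p * δ * p.1) ^ 2 := sq_nonneg _
  have h2 : 0 ≤ (weight δ p * δ * p.2) ^ 2 := sq_nonneg _
  constructor <;> rw [← sq_le_one_iff_abs_le_one] <;> nlinarith

/-- The function `δ x ⟨δ (x, y)⟩⁻¹`. -/
def wx (δ : ℝ) : Smooth := const δ * cx * wt δ

/-- The function `δ y ⟨δ (x, y)⟩⁻¹`. -/
def wy (δ : ℝ) : Smooth := const δ * cy * wt δ

/-- The coefficient `⟨δ (x, y)⟩⁻² y` of the regularized transport term. -/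
def mu (δ : ℝ) : Smooth := wt δ * wt δ * cy

lemma wt_sq (δ : ℝ) : wt δ ^ 2 * (1 + const δ ^ 2 * (cx ^ 2 + cy ^ 2)) = 1 := by
  ext p
  exact weight_sq δ p

lemma derivation_wt (D : Derivation ℝ Smooth Smooth) (δ : ℝ) :
    D (wt δ) = - const δ ^ 2 * wt δ ^ 3 * (cx * D cx + cy * D cy) := by
  have h := congrArg D (wt_sq δ)
  have h2 := wt_sq δ
  simp only [Derivation.leibniz, Derivation.leibniz_pow, map_add, Derivation.map_one_eq_zero,
    Derivation.map_algebraMap, smul_eq_mul, nsmul_eq_mul] at h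
  have two : ((2 : ℕ) : Smooth) * (const (1 / 2)) = 1 := by
    ext p
    change ((2 : ℕ) : ℝ) * (1 / 2) = 1
    norm_num
  push_cast at two h
  simp only [pow_one] at h
  linear_combination (const (1 / 2)) * wt δ * h - D (wt δ) * h2 -
    (wt δ ^ 2 * (1 + const δ ^ 2 * (cx ^ 2 + cy ^ 2)) * D (wt δ) +
    wt δ ^ 3 * const δ ^ 2 * (cx * D cx + cy * D cy)) * two

lemma dx_wt (δ : ℝ) : dx (wt δ) = -(const δ * wx δ * wt δ ^ 2) := by
  rw [derivation_wt, dx_cx, dx_cy, wx]; ring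

lemma dy_wt (δ : ℝ) : dy (wt δ) = -(const δ * wy δ * wt δ ^ 2) := by
  rw [derivation_wt, dy_cx, dy_cy, wy]; ring

lemma dx_wx (δ : ℝ) : dx (wx δ) = const δ * wt δ * (1 - wx δ ^ 2) := by
  simp only [wx, Derivation.leibniz, dx_cx, dx_wt, Derivation.map_algebraMap, smul_eq_mul]
  ring

lemma dy_wx (δ : ℝ) : dy (wx δ) = -(const δ * wx δ * wy δ * wt δ) := by
  simp only [wx, Derivation.leibniz, dy_cx, dy_wt, Derivation.map_algebraMap, smul_eq_mul]
  ring

lemma dx_wy (δ : ℝ) : dx (wy δ) = -(const δ * wx δ * wy δ * wt δ) := by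
  simp only [wy, Derivation.leibniz, dx_cy, dx_wt, Derivation.map_algebraMap, smul_eq_mul]
  ring

lemma dy_wy (δ : ℝ) : dy (wy δ) = const δ * wt δ * (1 - wy δ ^ 2) := by
  simp only [wy, Derivation.leibniz, dy_cy, dy_wt, Derivation.map_algebraMap, smul_eq_mul]
  ring

lemma dx_mu (δ : ℝ) : dx (mu δ) = -(2 * wx δ * wy δ * wt δ ^ 2) := by
  simp only [mu, wy, Derivation.leibniz, dx_cy, dx_wt, smul_eq_mul]
  ring

lemma dy_mu (δ : ℝ) : dy (mu δ) = wt δ ^ 2 - 2 * wy δ ^ 2 * wt δ ^ 2 := by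
  simp only [mu, wy, Derivation.leibniz, dy_cy, dy_wt, smul_eq_mul]
  ring

/-- The four generators of an algebra of functions, bounded uniformly in `δ ∈ [0, 1]`, that is
stable under differentiation. -/
def wtGen (δ : ℝ) : Fin 4 → Smooth := ![const δ, wt δ, wx δ, wy δ]

/-- A family, indexed by `δ`, of polynomials in the generators `wtGen δ`. -/
def IsWtPoly (f : ℝ → Smooth) : Prop :=
  ∃ Q : MvPolynomial (Fin 4) ℝ, ∀ δ, f δ = MvPolynomial.aeval (wtGen δ) Q

lemma IsWtPoly.bound {f : ℝ → Smooth} (h : IsWtPoly f) :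
    ∃ C, ∀ δ ∈ Icc (0 : ℝ) 1, ∀ p, |(f δ).1 p| ≤ C := by
  obtain ⟨Q, hQ⟩ := h
  have : ∃ C, ∀ δ ∈ Icc (0 : ℝ) 1, ∀ p, |(MvPolynomial.aeval (wtGen δ) Q).1 p| ≤ C := by
    clear hQ
    induction Q using MvPolynomial.induction_on with
    | C a =>
      refine ⟨|a|, fun δ _ p => ?_⟩
      rw [MvPolynomial.aeval_C]; exact le_rfl
    | add P Q hP hQ =>
      obtain ⟨C, hC⟩ := hP
      obtain ⟨C', hC'⟩ := hQ
      refine ⟨C + C', fun δ hδ p => ?_⟩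
      rw [map_add]
      exact (abs_add_le _ _).trans (add_le_add (hC δ hδ p) (hC' δ hδ p))
    | mul_X P i hP =>
      obtain ⟨C, hC⟩ := hP
      refine ⟨C, fun δ hδ p => ?_⟩
      have hi : |(wtGen δ i).1 p| ≤ 1 := by
        fin_cases i
        · change |δ| ≤ 1
          rw [abs_of_nonneg hδ.1]; exact hδ.2
        · change |weight δ p| ≤ 1
          rw [abs_of_pos (weight_pos δ p)]; exact weight_le_one δ p
        · exact (abs_mul_weight_le δ p).1
        · exact (abs_mul_weight_le δ p).2
      rw [map_mul, MvPolynomial.aeval_X]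
      change |(MvPolynomial.aeval (wtGen δ) P).1 p * (wtGen δ i).1 p| ≤ C
      rw [abs_mul]
      calc _ ≤ C * 1 := mul_le_mul (hC δ hδ p) hi (abs_nonneg _) ((abs_nonneg _).trans (hC δ hδ p))
        _ = C := mul_one C
  obtain ⟨C, hC⟩ := this
  exact ⟨C, fun δ hδ p => by rw [hQ]; exact hC δ hδ p⟩

lemma IsWtPoly.derivation {D : Derivation ℝ Smooth Smooth}
    (hD : ∀ i, IsWtPoly fun δ => D (wtGen δ i)) {f : ℝ → Smooth} (h : IsWtPoly f) :
    IsWtPoly fun δ => D (f δ) := by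
  obtain ⟨Q, hQ⟩ := h
  suffices h : ∃ R : MvPolynomial (Fin 4) ℝ, ∀ δ, D (MvPolynomial.aeval (wtGen δ) Q)
      = MvPolynomial.aeval (wtGen δ) R by
    simpa only [IsWtPoly, hQ] using h
  clear hQ
  induction Q using MvPolynomial.induction_on with
  | C a => exact ⟨0, fun δ => by rw [MvPolynomial.aeval_C, Derivation.map_algebraMap, map_zero]⟩
  | add P Q hP hQ =>
    obtain ⟨P', hP'⟩ := hP
    obtain ⟨Q', hQ'⟩ := hQ
    exact ⟨P' + Q', fun δ => by rw [map_add, map_add, hP', hQ', map_add]⟩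
  | mul_X P i hP =>
    obtain ⟨P', hP'⟩ := hP
    obtain ⟨R, hR⟩ := hD i
    dsimp only at hR
    refine ⟨P * R + MvPolynomial.X i * P', fun δ => ?_⟩
    rw [map_mul, Derivation.leibniz, hP', MvPolynomial.aeval_X, hR, map_add, map_mul, map_mul,
      MvPolynomial.aeval_X, smul_eq_mul, smul_eq_mul]

open MvPolynomial in
lemma isWtPoly_dx (i : Fin 4) : IsWtPoly fun δ => dx (wtGen δ i) := by
  fin_cases i
  · exact ⟨0, fun δ => by simp [wtGen]⟩
  · refine ⟨- X 0 * X 2 * X 1 ^ 2, fun δ => ?_⟩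
    simpa [wtGen] using dx_wt δ
  · refine ⟨X 0 * X 1 * (1 - X 2 ^ 2), fun δ => ?_⟩
    simpa [wtGen] using dx_wx δ
  · refine ⟨- X 0 * X 2 * X 3 * X 1, fun δ => ?_⟩
    simpa [wtGen] using dx_wy δ

open MvPolynomial in
lemma isWtPoly_dy (i : Fin 4) : IsWtPoly fun δ => dy (wtGen δ i) := by
  fin_cases i
  · exact ⟨0, fun δ => by simp [wtGen]⟩
  · refine ⟨- X 0 * X 3 * X 1 ^ 2, fun δ => ?_⟩
    simpa [wtGen] using dy_wt δ
  · refine ⟨- X 0 * X 2 * X 3 * X 1, fun δ => ?_⟩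
    simpa [wtGen] using dy_wx δ
  · refine ⟨X 0 * X 1 * (1 - X 3 ^ 2), fun δ => ?_⟩
    simpa [wtGen] using dy_wy δ

lemma IsWtPoly.dd {f : ℝ → Smooth} (h : IsWtPoly f) (a b : ℕ) :
    IsWtPoly fun δ => dd a b (f δ) := by
  have hy : IsWtPoly fun δ => Smooth.dd 0 b (f δ) := by
    induction b with
    | zero => simpa using h
    | succ n ih => simpa only [dy_dd] using ih.derivation isWtPoly_dy
  induction a with
  | zero => exact hy
  | succ n ih => simpa only [dx_dd] using ih.derivation isWtPoly_dx

open MvPolynomial in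
lemma isWtPoly_wt : IsWtPoly wt := ⟨X 1, fun δ => by simp [wtGen]⟩

open MvPolynomial in
lemma isWtPoly_dx_mu : IsWtPoly fun δ => dx (mu δ) :=
  ⟨- 2 * X 2 * X 3 * X 1 ^ 2, fun δ => by simpa [wtGen] using dx_mu δ⟩

open MvPolynomial in
lemma isWtPoly_dy_mu : IsWtPoly fun δ => dy (mu δ) :=
  ⟨X 1 ^ 2 - 2 * X 3 ^ 2 * X 1 ^ 2, fun δ => by simpa [wtGen] using dy_mu δ⟩

/-- The derivatives of the weight, and those of positive order of the transport coefficient, are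
bounded uniformly in `δ ∈ [0, 1]`. -/
lemma exists_weight_bound : ∃ C : ℝ, 1 ≤ C ∧ ∀ δ ∈ Icc (0 : ℝ) 1, ∀ a b : ℕ, a + b ≤ 6 →
    ∀ p, |(dd a b (wt δ)).1 p| ≤ C ∧ (1 ≤ a + b → |(dd a b (mu δ)).1 p| ≤ C) := by
  have h1 : ∀ q : ℕ × ℕ, ∃ C, ∀ δ ∈ Icc (0 : ℝ) 1, ∀ p, |(dd q.1 q.2 (wt δ)).1 p| ≤ C :=
    fun q => (isWtPoly_wt.dd q.1 q.2).bound
  have h2 : ∀ q : ℕ × ℕ, ∃ C, ∀ δ ∈ Icc (0 : ℝ) 1, ∀ p, |(dd q.1 q.2 (dx (mu δ))).1 p| ≤ C :=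
    fun q => (isWtPoly_dx_mu.dd q.1 q.2).bound
  have h3 : ∀ q : ℕ × ℕ, ∃ C, ∀ δ ∈ Icc (0 : ℝ) 1, ∀ p, |(dd q.1 q.2 (dy (mu δ))).1 p| ≤ C :=
    fun q => (isWtPoly_dy_mu.dd q.1 q.2).bound
  choose C1 hC1 using h1
  choose C2 hC2 using h2
  choose C3 hC3 using h3
  let S : ℝ := ∑ q ∈ Finset.range 7 ×ˢ Finset.range 7, (|C1 q| + |C2 q| + |C3 q|)
  have hS : ∀ a b : ℕ, a ≤ 6 → b ≤ 6 → |C1 (a, b)| + |C2 (a, b)| + |C3 (a, b)| ≤ S := by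
    intro a b ha hb
    exact Finset.single_le_sum (f := fun q => |C1 q| + |C2 q| + |C3 q|)
      (fun _ _ => by positivity) (Finset.mem_product.2
        ⟨Finset.mem_range.2 (by omega), Finset.mem_range.2 (by omega)⟩)
  refine ⟨1 + S, ?_, fun δ hδ a b hab p => ⟨?_, fun h => ?_⟩⟩
  · have : 0 ≤ S := by positivity
    linarith
  · have := hS a b (by omega) (by omega)
    linarith [hC1 (a, b) δ hδ p, le_abs_self (C1 (a, b)), abs_nonneg (C2 (a, b)),
      abs_nonneg (C3 (a, b))]
  · rcases Nat.eq_zero_or_pos a with rfl | ha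
    · obtain ⟨b, rfl⟩ : ∃ c, b = c + 1 := ⟨b - 1, by omega⟩
      have := hS 0 b (by omega) (by omega)
      have h3 := hC3 (0, b) δ hδ p
      rw [dd_dy] at h3
      linarith [le_abs_self (C3 (0, b)), abs_nonneg (C2 (0, b)), abs_nonneg (C1 (0, b))]
    · obtain ⟨a, rfl⟩ : ∃ c, a = c + 1 := ⟨a - 1, by omega⟩
      have := hS a b (by omega) (by omega)
      have h3 := hC2 (a, b) δ hδ p
      rw [dd_dx] at h3
      linarith [le_abs_self (C2 (a, b)), abs_nonneg (C3 (a, b)), abs_nonneg (C1 (a, b))]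

end Smooth

/-! ### The energy estimate in `H⁴` for test functions -/

namespace Test

lemma smooth_smul_add (m : Smooth) (f g : Test) : m • (f + g) = m • f + m • g :=
  Subtype.ext (mul_add m f.1 g.1)

lemma smooth_smul_sub (m : Smooth) (f g : Test) : m • (f - g) = m • f - m • g :=
  Subtype.ext (mul_sub m f.1 g.1)

lemma smooth_add_smul (m n : Smooth) (f : Test) : (m + n) • f = m • f + n • f :=
  Subtype.ext (add_mul m n f.1)

lemma smooth_mul_smul (m n : Smooth) (f : Test) : (m * n) • f = m • (n • f) :=
  Subtype.ext (mul_assoc m n f.1)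

lemma smooth_smul_smul (m : Smooth) (c : ℝ) (f : Test) : m • (c • f) = c • (m • f) :=
  Subtype.ext (mul_smul_comm c m f.1)

lemma smooth_smul_comm (f g : Test) : f.1 • g = g.1 • f := Subtype.ext (mul_comm f.1 g.1)

open Finset in
lemma sum_choose_mul_choose (a b : ℕ) :
    ∑ p ∈ antidiagonal a ×ˢ antidiagonal b, ((a.choose p.1.1 * b.choose p.2.1 : ℕ) : ℝ)
      = 2 ^ (a + b) := by
  rw [← Nat.cast_sum, sum_product, pow_add]
  have h : ∀ n : ℕ, ∑ p ∈ antidiagonal n, n.choose p.1 = 2 ^ n := fun n => by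
    rw [Nat.sum_antidiagonal_eq_sum_range_succ (fun i _ => n.choose i), Nat.sum_range_choose]
  simp only [← mul_sum, ← sum_mul, h]
  push_cast; ring

open Finset in
/-- A bound on the terms of the Leibniz expansion bounds the derivative of a product. -/
lemma norm_dd_smul_le (Λ : Test →ₗ[ℝ] L2) (a b : ℕ) (hab : a + b ≤ 4) (m : Smooth) (f : Test)
    {B : ℝ} (hB : ∀ i j k l, i + k = a → j + l = b → ‖Λ (Smooth.dd i j m • dd k l f)‖ ≤ B) :
    ‖Λ (dd a b (m • f))‖ ≤ 16 * B := by
  have hB0 : 0 ≤ B := (norm_nonneg _).trans (hB a b 0 0 (by simp) (by simp))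
  rw [dd_smul, map_sum]
  calc _ ≤ ∑ p ∈ antidiagonal a ×ˢ antidiagonal b,
        ((a.choose p.1.1 * b.choose p.2.1 : ℕ) : ℝ) * B := by
        refine (norm_sum_le _ _).trans (sum_le_sum fun p hp => ?_)
        simp only [mem_product, HasAntidiagonal.mem_antidiagonal] at hp
        rw [map_smul, norm_smul, Real.norm_of_nonneg (Nat.cast_nonneg _)]
        gcongr
        exact hB _ _ _ _ hp.1 hp.2
    _ = 2 ^ (a + b) * B := by rw [← sum_mul, sum_choose_mul_choose]
    _ ≤ 2 ^ 4 * B := by gcongr; norm_num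
    _ = 16 * B := by norm_num

open Finset in
/-- The analogous bound for the commutator `[∂^α, m] f`, in whose expansion at least one derivative
falls on `m`. -/
lemma norm_commutator_le (Λ : Test →ₗ[ℝ] L2) (a b : ℕ) (hab : a + b ≤ 4) (m : Smooth) (f : Test)
    {B : ℝ} (hB0 : 0 ≤ B) (hB : ∀ i j k l, i + k = a → j + l = b → 1 ≤ i + j →
      ‖Λ (Smooth.dd i j m • dd k l f)‖ ≤ B) :
    ‖Λ (dd a b (m • f) - m • dd a b f)‖ ≤ 16 * B := by
  have hmem : (((0 : ℕ), a), ((0 : ℕ), b)) ∈ antidiagonal a ×ˢ antidiagonal b := by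
    simp [mem_product, HasAntidiagonal.mem_antidiagonal]
  have e : dd a b (m • f) - m • dd a b f =
      ∑ p ∈ (antidiagonal a ×ˢ antidiagonal b).erase ((0, a), (0, b)),
        ((a.choose p.1.1 * b.choose p.2.1 : ℕ) : ℝ) •
          (Smooth.dd p.1.1 p.2.1 m • dd p.1.2 p.2.2 f) := by
    rw [dd_smul, ← add_sum_erase _ _ hmem]
    simp
  rw [e, map_sum]
  calc _ ≤ ∑ p ∈ (antidiagonal a ×ˢ antidiagonal b).erase ((0, a), (0, b)),
        ((a.choose p.1.1 * b.choose p.2.1 : ℕ) : ℝ) * B := by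
        refine (norm_sum_le _ _).trans (sum_le_sum fun p hp => ?_)
        simp only [mem_erase, mem_product, HasAntidiagonal.mem_antidiagonal] at hp
        rw [map_smul, norm_smul, Real.norm_of_nonneg (Nat.cast_nonneg _)]
        gcongr
        refine hB _ _ _ _ hp.2.1 hp.2.2 ?_
        obtain ⟨hne, h1, h2⟩ := hp
        by_contra hlt
        apply hne
        obtain ⟨⟨i, k⟩, ⟨j, l⟩⟩ := p
        simp only [Prod.mk.injEq]
        dsimp only at h1 h2 hlt
        omega
    _ ≤ ∑ p ∈ antidiagonal a ×ˢ antidiagonal b,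
        ((a.choose p.1.1 * b.choose p.2.1 : ℕ) : ℝ) * B :=
        sum_le_sum_of_subset_of_nonneg (erase_subset _ _) fun _ _ _ => by positivity
    _ = 2 ^ (a + b) * B := by rw [← sum_mul, sum_choose_mul_choose]
    _ ≤ 2 ^ 4 * B := by gcongr; norm_num
    _ = 16 * B := by norm_num

lemma norm_toH4_le {w : Test} {B : ℝ} (hB : ∀ α, ‖toL2 (ddα α w)‖ ≤ B) : ‖toH4 w‖ ≤ 4 * B := by
  have hB0 : 0 ≤ B := (norm_nonneg _).trans (hB MultiIndex4.zero)
  rw [← sq_le_sq₀ (norm_nonneg _) (by positivity), H4.norm_sq_eq]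
  have hcard : Fintype.card MultiIndex4 = 15 := by decide
  calc ∑ α, ‖H4.D α (toH4 w)‖ ^ 2 ≤ ∑ _α : MultiIndex4, B ^ 2 := by
        refine Finset.sum_le_sum fun α _ => ?_
        rw [D_toH4]
        gcongr
        exact hB α
    _ = 15 * B ^ 2 := by rw [Finset.sum_const, Finset.card_univ, hcard]; simp
    _ ≤ (4 * B) ^ 2 := by nlinarith [sq_nonneg B]

/-- Multiplication by a smooth function with bounded derivatives is bounded on `H⁴`. -/
lemma norm_toH4_smul_le {m : Smooth} {C : ℝ}
    (hm : ∀ a b : ℕ, a + b ≤ 4 → ∀ p, |(Smooth.dd a b m).1 p| ≤ C) (f : Test) :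
    ‖toH4 (m • f)‖ ≤ 64 * C * ‖toH4 f‖ := by
  have hC : 0 ≤ C := (abs_nonneg _).trans (hm 0 0 (by norm_num) 0)
  have h := norm_toH4_le (w := m • f) (B := 16 * (C * ‖toH4 f‖)) fun α => by
    refine norm_dd_smul_le toL2 _ _ α.2 m f fun i j k l h1 h2 => ?_
    have := α.2
    refine (norm_smul_le (hm i j (by omega)) _).trans ?_
    gcongr
    exact norm_toL2_dd_le k l (by omega) f
  linarith

/-- Products of derivatives of total order at most five, with at most four on each factor. -/
lemma norm_dd_smul_dd_le (f h : Test) {i j k l : ℕ} (h1 : i + j ≤ 4) (h2 : k + l ≤ 4)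
    (h3 : i + j + (k + l) ≤ 5) :
    ‖toL2 ((dd i j f).1 • dd k l h)‖ ≤ 2 * ‖toH4 f‖ * ‖toH4 h‖ := by
  rcases le_or_gt (i + j) 2 with hle | hgt
  · refine (norm_smul_le (abs_dd_le i j hle f) _).trans ?_
    gcongr
    exact norm_toL2_dd_le k l h2 h
  · rw [smooth_smul_comm]
    refine (norm_smul_le (abs_dd_le k l (by omega) h) _).trans ?_
    have := norm_toL2_dd_le i j h1 f
    calc 2 * ‖toH4 h‖ * ‖toL2 (dd i j f)‖ ≤ 2 * ‖toH4 h‖ * ‖toH4 f‖ := by gcongr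
      _ = _ := by ring

/-- The smooth coefficient `(1 + g)²` of the diffusion. -/
def coef (g : Test) : Smooth := (1 + g.1) ^ 2

/-- The compactly supported part `(1 + g)² - 1` of the diffusion coefficient. -/
def coefSub (g : Test) : Test := (2 : ℝ) • g + g.1 • g

lemma coef_eq (g : Test) : coef g = 1 + (coefSub g).1 := by
  ext p
  change (1 + g.fn p) ^ 2 = 1 + (2 * g.fn p + g.fn p * g.fn p)
  ring

lemma norm_coefSub_le {g : Test} (hg : ‖toH4 g‖ ≤ 1 / 8) : ‖toH4 (coefSub g)‖ ≤ 3 := by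
  have h1 : ‖toH4 (g.1 • g)‖ ≤ 4 * (16 * (2 * ‖toH4 g‖ * ‖toH4 g‖)) := by
    refine norm_toH4_le fun α => norm_dd_smul_le toL2 _ _ α.2 _ _ fun i j k l h1 h2 => ?_
    have := α.2
    exact norm_dd_smul_dd_le g g (by omega) (by omega) (by omega)
  have h2 : ‖toH4 (coefSub g)‖ ≤ 2 * ‖toH4 g‖ + ‖toH4 (g.1 • g)‖ := by
    have e : toH4 (coefSub g) = (2 : ℝ) • toH4 g + toH4 (g.1 • g) := by
      rw [coefSub, map_add, toH4.map_smul]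
    rw [e]
    refine (norm_add_le _ _).trans ?_
    rw [norm_smul, Real.norm_of_nonneg (by positivity)]
  nlinarith [norm_nonneg (toH4 g)]

/-- By the Sobolev inequality `|g| ≤ 1/4` and `|∂_y g| ≤ 1/4`, so that the diffusion is uniformly
elliptic. -/
lemma coef_bounds {g : Test} (hg : ‖toH4 g‖ ≤ 1 / 8) (p : ℝ × ℝ) :
    1 / 2 ≤ (coef g).1 p ∧ (coef g).1 p ≤ 4 ∧ |(Smooth.dy (coef g)).1 p| ≤ 6 := by
  have h := abs_dd_le 0 0 (by norm_num) g p
  rw [dd_zero] at h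
  have h' := abs_le.1 (h.trans (show 2 * ‖toH4 g‖ ≤ 1 / 4 by linarith))
  have e : (coef g).1 p = (1 + g.fn p) ^ 2 := rfl
  refine ⟨by rw [e]; nlinarith, by rw [e]; nlinarith, ?_⟩
  have hd : Smooth.dy (coef g) = (dd 0 1 (coefSub g)).1 := by
    rw [coef_eq, map_add, Derivation.map_one_eq_zero, zero_add, coe_dd, Smooth.dd_zero_one]
  rw [hd]
  have := abs_dd_le 0 1 (by norm_num) (coefSub g) p
  have h3 := norm_coefSub_le hg
  exact this.trans (by linarith)

/-- The operator `∂_y (⟨δ (x, y)⟩⁻¹ ·)` measuring the dissipation of the modified problem. -/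
def opD (δ : ℝ) : Test →ₗ[ℝ] Test where
  toFun w := dd 0 1 (Smooth.wt δ • w)
  map_add' f g := by rw [smooth_smul_add, map_add]
  map_smul' c f := by rw [smooth_smul_smul, map_smul]; rfl

/-- The spatial operator of the modified problem, in the form
`μ ∂_x w + (∂_x μ / 2) w - J (1 + g)² ∂_y² (J w)` with `J = ⟨δ (x, y)⟩⁻¹` and `μ = J² y`. -/
def opL (δ : ℝ) (g w : Test) : Test :=
  (Smooth.mu δ • dd 1 0 w + (1 / 2 : ℝ) • (Smooth.dx (Smooth.mu δ) • w))
    - (Smooth.wt δ * coef g) • dd 0 1 (opD δ w)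

lemma toL2_sub_smul (Λ : Test →ₗ[ℝ] L2) (f h : Test) : Λ f = Λ (f - h) + Λ h := by
  rw [map_sub]; abel

/-- Antisymmetry of the transport part. -/
lemma inner_transport (m : Smooth) (z : Test) :
    inner ℝ (toL2 (m • dd 1 0 z)) (toL2 z)
      = -(1 / 2) * inner ℝ (toL2 (Smooth.dx m • z)) (toL2 z) := by
  have h : inner ℝ (toL2 (m • dd 1 0 z)) (toL2 z)
      = - (inner ℝ (toL2 (Smooth.dx m • z)) (toL2 z)
        + inner ℝ (toL2 (m • dd 1 0 z)) (toL2 z)) := by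
    conv_lhs => rw [inner_smul_left, real_inner_comm, inner_toL2_toL2]
    have h2 := inner_dd_right 1 0 (m • z) z
    rw [inner_toL2_toL2] at h2
    rw [h2, dx_smul, map_add, inner_add_left]
    norm_num
  linarith

/-- The transport part of the energy estimate. -/
lemma transport_estimate {C δ : ℝ} (hC : 1 ≤ C)
    (hμ : ∀ a b : ℕ, a + b ≤ 6 → 1 ≤ a + b → ∀ p, |(Smooth.dd a b (Smooth.mu δ)).1 p| ≤ C)
    (w : Test) (α : MultiIndex4) :
    |inner ℝ (toL2 (ddα α (Smooth.mu δ • dd 1 0 w + (1 / 2 : ℝ) • (Smooth.dx (Smooth.mu δ) • w))))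
      (toL2 (ddα α w))| ≤ 25 * C * ‖toH4 w‖ ^ 2 := by
  have hα := α.2
  set N := ‖toH4 w‖ with hN
  set z := ddα α w with hz
  have hzN : ‖toL2 z‖ ≤ N := norm_toL2_dd_le _ _ hα w
  have hN0 : 0 ≤ N := norm_nonneg _
  have hdx : ∀ p, |(Smooth.dx (Smooth.mu δ)).1 p| ≤ C := fun p => by
    rw [← Smooth.dd_one_zero]; exact hμ 1 0 (by norm_num) (by norm_num) p
  have h1 : ‖toL2 (ddα α (Smooth.mu δ • dd 1 0 w) - Smooth.mu δ • ddα α (dd 1 0 w))‖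
      ≤ 16 * (C * N) := by
    refine norm_commutator_le toL2 _ _ hα _ _ (by positivity) fun i j k l e1 e2 e3 => ?_
    refine (norm_smul_le (hμ i j (by omega) e3) _).trans ?_
    gcongr
    rw [dd_add]
    exact norm_toL2_dd_le _ _ (by omega) w
  have h2 : ‖toL2 (ddα α (Smooth.dx (Smooth.mu δ) • w))‖ ≤ 16 * (C * N) := by
    refine norm_dd_smul_le toL2 _ _ hα _ _ fun i j k l e1 e2 => ?_
    rw [Smooth.dd_dx]
    refine (norm_smul_le (hμ (i + 1) j (by omega) (by omega)) _).trans ?_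
    gcongr
    exact norm_toL2_dd_le _ _ (by omega) w
  have h3 : ddα α (dd 1 0 w) = dd 1 0 z := by
    rw [hz, ddα, dd_add, dd_add, add_comm, add_comm _ 0]
  have h4 : |inner ℝ (toL2 (Smooth.mu δ • dd 1 0 z)) (toL2 z)| ≤ (1 / 2) * (C * N * N) := by
    rw [inner_transport, abs_mul]
    have : |(-(1 / 2) : ℝ)| = 1 / 2 := by norm_num
    rw [this]
    gcongr
    refine (abs_real_inner_le_norm _ _).trans ?_
    have := norm_smul_le hdx z
    calc _ ≤ (C * ‖toL2 z‖) * ‖toL2 z‖ := by gcongr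
      _ ≤ C * N * N := by gcongr
  rw [map_add, map_smul (ddα α) (1 / 2 : ℝ), map_add, map_smul toL2 (1 / 2 : ℝ),
    toL2_sub_smul toL2 (ddα α (Smooth.mu δ • dd 1 0 w))
    (Smooth.mu δ • ddα α (dd 1 0 w)), h3, inner_add_left, inner_add_left, real_inner_smul_left]
  rw [h3] at h1
  have b1 := (abs_real_inner_le_norm
    (toL2 (ddα α (Smooth.mu δ • dd 1 0 w) - Smooth.mu δ • dd 1 0 z)) (toL2 z)).trans
    (mul_le_mul h1 hzN (norm_nonneg _) (by positivity))
  have b2 := (abs_real_inner_le_norm (toL2 (ddα α (Smooth.dx (Smooth.mu δ) • w)))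
    (toL2 z)).trans (mul_le_mul h2 hzN (norm_nonneg _) (by positivity))
  rw [abs_le] at *
  constructor <;> nlinarith

/-- The diffusion part of the energy estimate. -/
lemma diffusion_estimate {C δ : ℝ} (hC : 1 ≤ C)
    (hJ : ∀ a b : ℕ, a + b ≤ 6 → ∀ p, |(Smooth.dd a b (Smooth.wt δ)).1 p| ≤ C)
    {g : Test} (hg : ‖toH4 g‖ ≤ 1 / 8) (w : Test) (α : MultiIndex4) :
    1 / 2 * ‖toL2 (ddα α (opD δ w))‖ ^ 2 - 7000 * C * ‖toH4 (opD δ w)‖ * ‖toH4 w‖ ≤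
    - inner ℝ (toL2 (ddα α ((Smooth.wt δ * coef g) • dd 0 1 (opD δ w)))) (toL2 (ddα α w)) := by
  have hα := α.2
  set N := ‖toH4 w‖ with hN
  set M := ‖toH4 (opD δ w)‖ with hM
  set z := ddα α w with hz
  set ζ := ddα α (opD δ w) with hζ
  set J := Smooth.wt δ with hJdef
  set m : Smooth := J * coef g with hm
  have hzN : ‖toL2 z‖ ≤ N := norm_toL2_dd_le _ _ hα w
  have hζM : ‖toL2 ζ‖ ≤ M := norm_toL2_dd_le _ _ hα _
  have hN0 : 0 ≤ N := norm_nonneg _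
  have hM0 : 0 ≤ M := norm_nonneg _
  have hJ1 : ∀ p, |J.1 p| ≤ 1 := fun p => by
    rw [hJdef, Smooth.wt_apply, abs_of_pos (Smooth.weight_pos δ p)]
    exact Smooth.weight_le_one δ p
  -- the part of the coefficient with compact support
  have hc : ‖toH4 (J • coefSub g)‖ ≤ 192 * C := by
    have h1 := norm_toH4_smul_le (m := J) (fun a b h => hJ a b (by omega)) (coefSub g)
    have h2 := norm_coefSub_le hg
    nlinarith
  have hmJ : m = J + (J • coefSub g).1 := by
    rw [hm, coef_eq, mul_add, mul_one]; rfl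
  -- the commutator of `∂^α` with the coefficient
  have h1 : ‖toL2 (ddα α (m • dd 0 1 (opD δ w)) - m • ddα α (dd 0 1 (opD δ w)))‖
      ≤ 16 * (C * M + 2 * (192 * C) * M) := by
    refine norm_commutator_le toL2 _ _ hα _ _ (by positivity) fun i j k l e1 e2 e3 => ?_
    rw [hmJ, map_add, smooth_add_smul, map_add, dd_add]
    refine (norm_add_le _ _).trans (add_le_add ?_ ?_)
    · refine (norm_smul_le (hJ i j (by omega)) _).trans ?_
      gcongr
      exact norm_toL2_dd_le _ _ (by omega) _
    · rw [← coe_dd]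
      refine (norm_dd_smul_dd_le _ _ (by omega) (by omega) (by omega)).trans ?_
      gcongr
  -- the commutator of `∂^α` with the weight
  have h2 : ‖toL2 (dd 0 1 (ddα α (J • w) - J • z))‖ ≤ 16 * (C * N + C * N) := by
    refine norm_commutator_le (toL2 ∘ₗ dd 0 1) _ _ hα J w (by positivity)
      fun i j k l e1 e2 e3 => ?_
    rw [LinearMap.comp_apply, dy_smul, map_add, Smooth.dy_dd, dd_add]
    refine (norm_add_le _ _).trans (add_le_add ?_ ?_)
    · refine (norm_smul_le (hJ i (j + 1) (by omega)) _).trans ?_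
      gcongr
      exact norm_toL2_dd_le _ _ (by omega) _
    · refine (norm_smul_le (hJ i j (by omega)) _).trans ?_
      gcongr
      exact norm_toL2_dd_le _ _ (by omega) _
  have h3 : ddα α (dd 0 1 (opD δ w)) = dd 0 1 ζ := by
    rw [hζ, ddα, dd_add, dd_add, add_comm, add_comm _ 1]
  have h4 : dd 0 1 (ddα α (J • w)) = ζ := by
    rw [hζ, ddα, opD]
    change _ = dd _ _ (dd 0 1 (J • w))
    rw [dd_add, dd_add, add_comm, add_comm _ 1]
  set R := dd 0 1 (ddα α (J • w) - J • z) with hR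
  have h5 : dd 0 1 (J • z) = ζ - R := by rw [hR, map_sub, h4]; abel
  -- integration by parts in the principal term
  have h6 : - inner ℝ (toL2 (m • dd 0 1 ζ)) (toL2 z) = inner ℝ (toL2 ζ) (toL2 (coef g • ζ))
      - inner ℝ (toL2 ζ) (toL2 (coef g • R))
      + inner ℝ (toL2 ζ) (toL2 (Smooth.dy (coef g) • (J • z))) := by
    have e1 : m • z = coef g • (J • z) := by rw [hm, mul_comm, smooth_mul_smul]
    have e2 := inner_dd_right 0 1 (m • z) ζ
    rw [inner_smul_left, real_inner_comm, e2, e1, dy_smul, h5, smooth_smul_sub, map_add, map_sub,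
      inner_add_left, inner_sub_left, real_inner_comm (toL2 ζ), real_inner_comm (toL2 ζ),
      real_inner_comm (toL2 ζ)]
    norm_num
    ring
  have h7 : 1 / 2 * ‖toL2 ζ‖ ^ 2 ≤ inner ℝ (toL2 ζ) (toL2 (coef g • ζ)) := by
    rw [← real_inner_self_eq_norm_sq, inner_toL2_toL2, inner_toL2_toL2, ← integral_const_mul]
    refine integral_mono ((ζ.1 • ζ).integrable.const_mul _) (ζ.1 • (coef g • ζ)).integrable
      fun p => ?_
    have := (coef_bounds hg p).1
    change 1 / 2 * (ζ.fn p * ζ.fn p) ≤ ζ.fn p * ((coef g).1 p * ζ.fn p)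
    nlinarith [mul_self_nonneg (ζ.fn p)]
  have h8 : |inner ℝ (toL2 ζ) (toL2 (coef g • R))| ≤ M * (4 * (32 * (C * N))) := by
    refine (abs_real_inner_le_norm _ _).trans ?_
    have hb := norm_smul_le (m := coef g) (C := 4) (fun p => by
      have := coef_bounds hg p
      rw [abs_of_nonneg (by linarith)]; exact this.2.1) R
    have h2' : ‖toL2 R‖ ≤ 32 * (C * N) := by linarith
    have hb' : ‖toL2 (coef g • R)‖ ≤ 4 * (32 * (C * N)) := hb.trans (by linarith)
    exact mul_le_mul hζM hb' (norm_nonneg _) hM0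
  have h9 : |inner ℝ (toL2 ζ) (toL2 (Smooth.dy (coef g) • (J • z)))| ≤ M * (6 * (1 * N)) := by
    refine (abs_real_inner_le_norm _ _).trans ?_
    have hb := norm_smul_le (fun p => (coef_bounds hg p).2.2) (J • z)
    have hb2 := norm_smul_le hJ1 z
    have hb' : ‖toL2 (Smooth.dy (coef g) • (J • z))‖ ≤ 6 * (1 * N) := hb.trans (by linarith)
    exact mul_le_mul hζM hb' (norm_nonneg _) hM0
  rw [toL2_sub_smul toL2 (ddα α (m • dd 0 1 (opD δ w))) (m • ddα α (dd 0 1 (opD δ w))), h3,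
    inner_add_left, neg_add, h6]
  rw [h3] at h1
  set R' : Test := ddα α (m • dd 0 1 (opD δ w)) - m • dd 0 1 ζ with hR'
  have hB : 0 ≤ 16 * (C * M + 2 * (192 * C) * M) := by positivity
  have b1 : |inner ℝ (toL2 R') (toL2 z)| ≤ 16 * (C * M + 2 * (192 * C) * M) * N :=
    le_trans (abs_real_inner_le_norm _ _) (mul_le_mul h1 hzN (norm_nonneg _) hB)
  have hMN : 0 ≤ M * N := mul_nonneg hM0 hN0
  have hCMN : M * N ≤ C * (M * N) := le_mul_of_one_le_left hMN hC
  rw [abs_le] at b1 h8 h9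
  generalize inner ℝ (toL2 R') (toL2 z) = t1 at *
  generalize inner ℝ (toL2 ζ) (toL2 (coef g • R)) = t2 at *
  generalize inner ℝ (toL2 ζ) (toL2 (Smooth.dy (coef g) • (J • z))) = t3 at *
  linarith [b1.2, h8.2, h9.1, h7]

/-- The energy estimate in `H⁴`, uniformly in `δ ∈ [0, 1]`. -/
theorem energy_estimate : ∃ K : ℝ, 0 ≤ K ∧ ∀ δ ∈ Icc (0 : ℝ) 1, ∀ g : Test, ‖toH4 g‖ ≤ 1 / 8 →
    ∀ w : Test, 1 / 4 * ‖toH4 (opD δ w)‖ ^ 2 - K * ‖toH4 w‖ ^ 2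
      ≤ inner ℝ (toL2 (opL δ g w)) (toL2 (opP w)) := by
  obtain ⟨C, hC, hb⟩ := Smooth.exists_weight_bound
  -- there are fifteen multi-indices; the square pays for absorbing the products `M N` in `M² / 4`
  refine ⟨15 * (25 * C) + (15 * (7000 * C)) ^ 2, by positivity, fun δ hδ g hg w => ?_⟩
  have hJ : ∀ a b : ℕ, a + b ≤ 6 → ∀ p, |(Smooth.dd a b (Smooth.wt δ)).1 p| ≤ C :=
    fun a b h p => (hb δ hδ a b h p).1
  have hμ : ∀ a b : ℕ, a + b ≤ 6 → 1 ≤ a + b → ∀ p, |(Smooth.dd a b (Smooth.mu δ)).1 p| ≤ C :=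
    fun a b h h1 p => (hb δ hδ a b h p).2 h1
  set N := ‖toH4 w‖ with hN
  set M := ‖toH4 (opD δ w)‖ with hM
  have hcard : Fintype.card MultiIndex4 = 15 := by decide
  have e : inner ℝ (toL2 (opL δ g w)) (toL2 (opP w))
      = ∑ α, inner ℝ (toL2 (ddα α (opL δ g w))) (toL2 (ddα α w)) := by
    rw [← incl_toH4, ← inner_toH4, H4.inner_eq]
    rfl
  have hterm : ∀ α : MultiIndex4, 1 / 2 * ‖toL2 (ddα α (opD δ w))‖ ^ 2
      - (7000 * C * M * N + 25 * C * N ^ 2)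
      ≤ inner ℝ (toL2 (ddα α (opL δ g w))) (toL2 (ddα α w)) := by
    intro α
    have h1 := transport_estimate hC hμ w α
    have h2 := diffusion_estimate hC hJ hg w α
    rw [abs_le] at h1
    rw [opL, map_sub, map_sub, inner_sub_left]
    linarith [h1.1]
  have hsum := Finset.sum_le_sum fun α (_ : α ∈ Finset.univ) => hterm α
  rw [← e, Finset.sum_sub_distrib, ← Finset.mul_sum, Finset.sum_const, Finset.card_univ, hcard]
    at hsum
  have hM2 : ∑ α : MultiIndex4, ‖toL2 (ddα α (opD δ w))‖ ^ 2 = M ^ 2 := by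
    rw [hM, H4.norm_sq_eq]; rfl
  rw [hM2] at hsum
  simp only [nsmul_eq_mul] at hsum
  push_cast at hsum
  nlinarith [sq_nonneg (M / 2 - 15 * (7000 * C) * N)]

end Test

/-! ### The spatial operators on `H⁴` -/

namespace Smooth

lemma IsWtPoly.continuous {f : ℝ → Smooth} (h : IsWtPoly f) (p : ℝ × ℝ) :
    Continuous fun δ => (f δ).1 p := by
  obtain ⟨Q, hQ⟩ := h
  suffices h : Continuous fun δ => (MvPolynomial.aeval (wtGen δ) Q).1 p by simpa only [hQ] using h
  clear hQ
  have hJ : Continuous fun δ => weight δ p := by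
    unfold weight
    refine Continuous.inv₀ (by fun_prop) fun δ => ?_
    positivity
  induction Q using MvPolynomial.induction_on with
  | C a =>
    simp only [MvPolynomial.aeval_C]
    exact continuous_const
  | add P Q hP hQ =>
    simp only [map_add]
    exact hP.add hQ
  | mul_X P i hP =>
    simp only [map_mul, MvPolynomial.aeval_X]
    refine hP.mul ?_
    fin_cases i
    · exact continuous_id
    · exact hJ
    · exact (continuous_id.mul continuous_const).mul hJ
    · exact (continuous_id.mul continuous_const).mul hJ

lemma isWtPoly_dy_wt : IsWtPoly fun δ => dy (wt δ) := by
  simpa only [dd_zero_one] using isWtPoly_wt.dd 0 1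

lemma isWtPoly_dy_dy_wt : IsWtPoly fun δ => dy (dy (wt δ)) := by
  have : ∀ δ, dy (dy (wt δ)) = dd 0 2 (wt δ) := fun δ => by
    rw [← dd_zero_one (wt δ), dy_dd]
  simpa only [this] using isWtPoly_wt.dd 0 2

lemma continuous_wt (p : ℝ × ℝ) : Continuous fun δ => (wt δ).1 p := isWtPoly_wt.continuous p

/-- The inverse `⟨(x, y)⟩` of the weight with `δ = 1`. -/
def wtInv : Smooth :=
  ⟨fun p => Real.sqrt (1 + (p.1 ^ 2 + p.2 ^ 2)), by
    have h : ∀ p : ℝ × ℝ, 1 + (p.1 ^ 2 + p.2 ^ 2) ≠ 0 := fun p => by positivity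
    have hc : ContDiff ℝ ∞ fun p : ℝ × ℝ => 1 + (p.1 ^ 2 + p.2 ^ 2) := by fun_prop
    exact ContDiff.sqrt hc h⟩

lemma wt_one_mul_wtInv (p : ℝ × ℝ) : weight 1 p * wtInv.1 p = 1 := by
  have h : Real.sqrt (1 + (p.1 ^ 2 + p.2 ^ 2)) ≠ 0 := by positivity
  simp only [weight, wtInv, one_pow, one_mul]
  exact inv_mul_cancel₀ h

end Smooth

open Smooth

/-- A weight function `ℓ` with `|ℓ| ≤ 1` for which `ℓ μ` is bounded, so that `ℓ` times the spatial
operator is bounded from `H⁴` to `L²`. -/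
structure IsAdmissible (ℓ : Smooth) (δ : ℝ) : Prop where
  mem : δ ∈ Icc (0 : ℝ) 1
  le_one : ∀ p, |ℓ.1 p| ≤ 1
  bound : ∃ C, ∀ p, |(ℓ * mu δ).1 p| ≤ C

lemma abs_weight_le (δ : ℝ) (p : ℝ × ℝ) : |weight δ p| ≤ 1 := by
  rw [abs_of_pos (weight_pos δ p)]; exact weight_le_one δ p

lemma abs_wt_mul_mu_le (δ : ℝ) (p : ℝ × ℝ) : |(wt 1 * mu δ).1 p| ≤ 1 := by
  have h1 := (abs_mul_weight_le 1 p).2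
  rw [one_mul] at h1
  have e : (wt 1 * mu δ).1 p = (weight δ p) ^ 2 * (p.2 * weight 1 p) := by
    change weight 1 p * (weight δ p * weight δ p * p.2) = _
    ring
  rw [e, abs_mul, abs_pow]
  calc |weight δ p| ^ 2 * |p.2 * weight 1 p| ≤ 1 ^ 2 * 1 := by
        gcongr
        exact abs_weight_le δ p
    _ = 1 := by norm_num

lemma isAdmissible_wt {δ : ℝ} (h : δ ∈ Icc (0 : ℝ) 1) : IsAdmissible (wt 1) δ :=
  ⟨h, abs_weight_le 1, 1, abs_wt_mul_mu_le δ⟩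

lemma isAdmissible_one {δ : ℝ} (h : δ ∈ Ioc (0 : ℝ) 1) : IsAdmissible 1 δ := by
  refine ⟨⟨h.1.le, h.2⟩, fun p => ?_, δ⁻¹, fun p => ?_⟩
  · change |(1 : ℝ)| ≤ 1; simp
  · have h1 := (abs_mul_weight_le δ p).2
    have h2 := abs_weight_le δ p
    have e : (1 * mu δ).1 p = δ⁻¹ * (weight δ p * (δ * p.2 * weight δ p)) := by
      change 1 * (weight δ p * weight δ p * p.2) = _
      have := h.1.ne'
      field_simp
    rw [e, abs_mul, abs_mul, abs_of_pos (inv_pos.2 h.1)]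
    calc _ ≤ δ⁻¹ * (1 * 1) := by gcongr; exact (inv_pos.2 h.1).le
      _ = δ⁻¹ := by ring

/-- Uniform bounds for the remaining coefficients of the spatial operator. -/
lemma exists_coefficient_bound : ∃ C : ℝ, 1 ≤ C ∧ ∀ ℓ δ, IsAdmissible ℓ δ →
    IsMultiplier (ℓ * dx (mu δ)).1 C ∧ IsMultiplier (ℓ * (wt δ * wt δ)).1 C ∧
    IsMultiplier (ℓ * (2 * wt δ * dy (wt δ))).1 C ∧
    IsMultiplier (ℓ * (wt δ * dy (dy (wt δ)))).1 C ∧ IsMultiplier (dy (wt δ)).1 C := by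
  obtain ⟨C, hC, hb⟩ := exists_weight_bound
  refine ⟨2 * C, by linarith, fun ℓ δ h => ?_⟩
  have h1 : ∀ p, |(dx (mu δ)).1 p| ≤ C := fun p => by
    rw [← dd_one_zero]; exact (hb δ h.mem 1 0 (by norm_num) p).2 (by norm_num)
  have h2 : ∀ p, |(dy (wt δ)).1 p| ≤ C := fun p => by
    rw [← dd_zero_one]; exact (hb δ h.mem 0 1 (by norm_num) p).1
  have h3 : ∀ p, |(dy (dy (wt δ))).1 p| ≤ C := fun p => by
    rw [← dd_zero_one (wt δ), dy_dd]; exact (hb δ h.mem 0 2 (by norm_num) p).1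
  have hC0 : (0 : ℝ) ≤ C := by linarith
  have key : ∀ (m : Smooth), (∀ p, |m.1 p| ≤ 2 * C) → IsMultiplier (ℓ * m).1 (2 * C) := by
    intro m hm
    refine .of_continuous (ℓ * m).continuous fun p => ?_
    change |ℓ.1 p * m.1 p| ≤ _
    rw [abs_mul]
    calc _ ≤ 1 * (2 * C) := mul_le_mul (h.le_one p) (hm p) (abs_nonneg _) zero_le_one
      _ = _ := one_mul _
  refine ⟨key _ fun p => (h1 p).trans (by linarith), key _ fun p => ?_, key _ fun p => ?_,
    key _ fun p => ?_, .of_continuous (dy (wt δ)).continuous fun p => (h2 p).trans (by linarith)⟩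
  · change |weight δ p * weight δ p| ≤ _
    rw [abs_mul]
    have := abs_weight_le δ p
    nlinarith [abs_nonneg (weight δ p)]
  · change |2 * weight δ p * (dy (wt δ)).1 p| ≤ _
    rw [abs_mul, abs_mul, abs_two]
    have := mul_le_mul (abs_weight_le δ p) (h2 p) (abs_nonneg _) zero_le_one
    linarith
  · change |weight δ p * (dy (dy (wt δ))).1 p| ≤ _
    rw [abs_mul]
    have := mul_le_mul (abs_weight_le δ p) (h3 p) (abs_nonneg _) zero_le_one
    linarith

namespace H4

/-- `∂_x : H⁴ → L²`. -/
def D10 : H4 →L[ℝ] L2 := D ⟨(1, 0), by decide⟩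

/-- `∂_y : H⁴ → L²`. -/
def D01 : H4 →L[ℝ] L2 := D ⟨(0, 1), by decide⟩

/-- `∂_y² : H⁴ → L²`. -/
def D02 : H4 →L[ℝ] L2 := D ⟨(0, 2), by decide⟩

lemma D10_toH4 (w : Test) : D10 (Test.toH4 w) = Test.toL2 (Test.dd 1 0 w) := rfl
lemma D01_toH4 (w : Test) : D01 (Test.toH4 w) = Test.toL2 (Test.dd 0 1 w) := rfl
lemma D02_toH4 (w : Test) : D02 (Test.toH4 w) = Test.toL2 (Test.dd 0 2 w) := rfl

/-- The transport part `ℓ (μ ∂_x + ∂_x μ / 2)` of the spatial operator. -/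
def opR (ℓ : Smooth) (δ : ℝ) : H4 →L[ℝ] L2 :=
  mulOp (ℓ * mu δ).1 ∘L D10 + (1 / 2 : ℝ) • (mulOp (ℓ * dx (mu δ)).1 ∘L incl)

/-- The operator `ℓ J ∂_y² (J ·)`, with `J = ⟨δ (x, y)⟩⁻¹`. -/
def opQ (ℓ : Smooth) (δ : ℝ) : H4 →L[ℝ] L2 :=
  mulOp (ℓ * (wt δ * wt δ)).1 ∘L D02 + mulOp (ℓ * (2 * wt δ * dy (wt δ))).1 ∘L D01
    + mulOp (ℓ * (wt δ * dy (dy (wt δ)))).1 ∘L incl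

/-- Multiplication by the diffusion coefficient `(1 + g)²`, on `L²`. -/
def coefOp (g : H4) : L2 →L[ℝ] L2 := (1 + mulH4 g) ∘L (1 + mulH4 g)

/-- The operator `ℓ (J y ∂_x (J ·) - J (1 + g)² ∂_y² (J ·))` from `H⁴` to `L²`. -/
def opL (ℓ : Smooth) (δ : ℝ) (g : H4) : H4 →L[ℝ] L2 := opR ℓ δ - coefOp g ∘L opQ ℓ δ

/-- The operator `∂_y (J ·)` from `H⁴` to `L²`. -/
def opE (δ : ℝ) : H4 →L[ℝ] L2 := mulOp (wt δ).1 ∘L D01 + mulOp (dy (wt δ)).1 ∘L incl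

lemma continuous_coefOp : Continuous coefOp := by
  unfold coefOp
  exact (continuous_const.add mulH4.continuous).clm_comp (continuous_const.add mulH4.continuous)

lemma continuous_opL (ℓ : Smooth) (δ : ℝ) : Continuous (opL ℓ δ) :=
  continuous_const.sub (continuous_coefOp.clm_comp continuous_const)

lemma inner_coefOp (g : H4) (f h : L2) : inner ℝ (coefOp g f) h = inner ℝ f (coefOp g h) := by
  have key : ∀ f h : L2, inner ℝ ((1 + mulH4 g) f) h = inner ℝ f ((1 + mulH4 g) h) := by
    intro f h
    rw [_root_.add_apply, _root_.add_apply, inner_add_left, inner_add_right, mulH4_apply,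
      g.isMultiplier_fn.inner_mulOp]
    rfl
  simp only [coefOp, ContinuousLinearMap.comp_apply]
  rw [key, key]

lemma norm_coefOp_le {g : H4} (hg : ‖g‖ ≤ 1 / 8) : ‖coefOp g‖ ≤ 4 := by
  have h1 : ‖(1 : L2 →L[ℝ] L2) + mulH4 g‖ ≤ 2 := by
    refine (norm_add_le _ _).trans ?_
    have := norm_mulH4_le g
    have h1 : ‖(1 : L2 →L[ℝ] L2)‖ ≤ 1 := ContinuousLinearMap.norm_id_le
    linarith
  refine (ContinuousLinearMap.opNorm_comp_le _ _).trans ?_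
  nlinarith [norm_nonneg ((1 : L2 →L[ℝ] L2) + mulH4 g)]

lemma coeFn_coefOp (g : H4) (f : L2) :
    (coefOp g f : ℝ × ℝ → ℝ) =ᵐ[volume] fun p => (1 + g.fn p) ^ 2 * f p := by
  have key : ∀ f : L2, ((1 + mulH4 g) f : ℝ × ℝ → ℝ) =ᵐ[volume] fun p => (1 + g.fn p) * f p := by
    intro f
    rw [_root_.add_apply, mulH4_apply]
    filter_upwards [Lp.coeFn_add ((1 : L2 →L[ℝ] L2) f) (mulOp g.fn f),
      g.isMultiplier_fn.coeFn_mulOp f] with p h1 h2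
    rw [h1, Pi.add_apply, h2]
    change f p + _ = _
    ring
  filter_upwards [key ((1 + mulH4 g) f), key f] with p h1 h2
  simp only [coefOp, ContinuousLinearMap.comp_apply]
  rw [h1, h2]; ring

lemma coefOp_toH4 (g w : Test) :
    coefOp (Test.toH4 g) (Test.toL2 w) = Test.toL2 (Test.coef g • w) := by
  have key : ∀ w : Test, (1 + mulH4 (Test.toH4 g)) (Test.toL2 w) = Test.toL2 ((1 + g.1) • w) := by
    intro w
    rw [_root_.add_apply, mulH4_toH4, Test.smooth_add_smul, map_add]
    congr 1
    change Test.toL2 w = _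
    congr 1
    ext p
    change _ = 1 * w.fn p
    rw [one_mul]
  simp only [coefOp, ContinuousLinearMap.comp_apply]
  rw [key, key, ← Test.smooth_mul_smul, Test.coef, sq]

lemma opE_toH4 {δ : ℝ} (h : δ ∈ Icc (0 : ℝ) 1) (w : Test) :
    opE δ (Test.toH4 w) = incl (Test.toH4 (Test.opD δ w)) := by
  obtain ⟨C, -, hb⟩ := exists_coefficient_bound
  obtain ⟨-, -, -, -, h5⟩ := hb _ _ (isAdmissible_wt h)
  have h0 : IsMultiplier (wt δ).1 1 := .of_continuous (wt δ).continuous (abs_weight_le δ)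
  rw [Test.incl_toH4]
  simp only [opE, _root_.add_apply, ContinuousLinearMap.comp_apply]
  rw [D01_toH4, Test.incl_toH4, h0.mulOp_toL2, h5.mulOp_toL2, ← map_add]
  congr 1
  change _ = Test.dd 0 1 (wt δ • w)
  rw [Test.dy_smul, add_comm]

/-- On test functions `opL` is `ℓ` times the classical operator `Test.opL`. -/
lemma opL_toH4 {ℓ : Smooth} {δ : ℝ} (h : IsAdmissible ℓ δ) (g w : Test) :
    opL ℓ δ (Test.toH4 g) (Test.toH4 w) = Test.toL2 (ℓ • Test.opL δ g w) := by
  obtain ⟨C, -, hb⟩ := exists_coefficient_bound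
  obtain ⟨h1, h2, h3, h4, -⟩ := hb _ _ h
  obtain ⟨C', hC'⟩ := h.bound
  have h0 : IsMultiplier (ℓ * mu δ).1 C' := .of_continuous (ℓ * mu δ).continuous hC'
  simp only [opL, opR, opQ, _root_.sub_apply, _root_.add_apply, _root_.smul_apply,
    ContinuousLinearMap.comp_apply]
  rw [D10_toH4, D01_toH4, D02_toH4, Test.incl_toH4, h0.mulOp_toL2, h1.mulOp_toL2, h2.mulOp_toL2,
    h3.mulOp_toL2, h4.mulOp_toL2, ← map_add, ← map_add, coefOp_toH4, ← Test.toL2.map_smul,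
    ← map_add, ← map_sub]
  congr 1
  have e : Test.dd 0 1 (Test.opD δ w) = wt δ • Test.dd 0 2 w + (2 * dy (wt δ)) • Test.dd 0 1 w
      + dy (dy (wt δ)) • w := by
    change Test.dd 0 1 (Test.dd 0 1 (wt δ • w)) = _
    rw [Test.dy_smul, map_add, Test.dy_smul, Test.dy_smul, Test.dd_add]
    ext p
    simp only [Test.add_fn, Test.smooth_smul_fn, Pi.add_apply, Pi.mul_apply]
    change _ = _ + 2 * (dy (wt δ)).1 p * _ + _
    ring
  rw [Test.opL, e]
  ext p
  simp only [Test.add_fn, Test.sub_fn, Test.smul_fn, Test.smooth_smul_fn, Pi.add_apply,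
    Pi.sub_apply, Pi.mul_apply, Pi.smul_apply, smul_eq_mul]
  change ℓ.1 p * (mu δ).1 p * _ + 1 / 2 * (ℓ.1 p * (dx (mu δ)).1 p * _) -
    (Test.coef g).1 p * (ℓ.1 p * ((wt δ).1 p * (wt δ).1 p) * _ +
      ℓ.1 p * (2 * (wt δ).1 p * (dy (wt δ)).1 p) * _ +
      ℓ.1 p * ((wt δ).1 p * (dy (dy (wt δ))).1 p) * _) =
    ℓ.1 p * (_ - (wt δ).1 p * (Test.coef g).1 p * (_ + 2 * (dy (wt δ)).1 p * _ + _))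
  ring

/-- The energy estimate for a coefficient in `H⁴`. -/
theorem energy_estimate : ∃ K : ℝ, 0 ≤ K ∧ ∀ δ ∈ Ioc (0 : ℝ) 1, ∀ g : H4, ‖g‖ < 1 / 8 →
    ∀ w : Test, 1 / 4 * ‖Test.toH4 (Test.opD δ w)‖ ^ 2 - K * ‖Test.toH4 w‖ ^ 2
      ≤ inner ℝ (opL 1 δ g (Test.toH4 w)) (Test.toL2 (Test.opP w)) := by
  obtain ⟨K, hK, h⟩ := Test.energy_estimate
  refine ⟨K, hK, fun δ hδ g hg w => ?_⟩
  obtain ⟨γ, hγ⟩ := Test.exists_seq_tendsto g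
  have h1 : Tendsto (fun n => inner ℝ (opL 1 δ (Test.toH4 (γ n)) (Test.toH4 w))
      (Test.toL2 (Test.opP w))) atTop
      (𝓝 (inner ℝ (opL 1 δ g (Test.toH4 w)) (Test.toL2 (Test.opP w)))) := by
    have : Continuous fun g => inner ℝ (opL 1 δ g (Test.toH4 w)) (Test.toL2 (Test.opP w)) :=
      ((continuous_opL 1 δ).clm_apply continuous_const).inner continuous_const
    exact (this.tendsto g).comp hγ
  refine ge_of_tendsto h1 ?_
  filter_upwards [hγ.norm.eventually (gt_mem_nhds hg)] with n hn
  rw [opL_toH4 (isAdmissible_one hδ)]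
  have e : (1 : Smooth) • Test.opL δ (γ n) w = Test.opL δ (γ n) w :=
    Subtype.ext (one_mul _)
  rw [e]
  exact h δ ⟨hδ.1.le, hδ.2⟩ (γ n) hn.le w

/-- The operators are bounded uniformly in `δ` and `g` after multiplication by `⟨(x, y)⟩⁻¹`. -/
lemma exists_opL_bound : ∃ C : ℝ, 0 ≤ C ∧ ∀ δ ∈ Icc (0 : ℝ) 1, ∀ g : H4, ‖g‖ ≤ 1 / 8 →
    ‖opL (wt 1) δ g‖ ≤ C := by
  obtain ⟨C, hC, hb⟩ := exists_coefficient_bound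
  refine ⟨(1 + 1 / 2 * C) + 4 * (C + C + C), by positivity, fun δ hδ g hg => ?_⟩
  obtain ⟨h1, h2, h3, h4, -⟩ := hb _ _ (isAdmissible_wt hδ)
  have h0 : IsMultiplier (wt 1 * mu δ).1 1 :=
    .of_continuous (wt 1 * mu δ).continuous (abs_wt_mul_mu_le δ)
  have key : ∀ {m : ℝ × ℝ → ℝ} {C : ℝ} (_ : IsMultiplier m C) (α : MultiIndex4) (u : H4),
      ‖mulOp m (D α u)‖ ≤ C * ‖u‖ := fun {m C} hm α u =>
    (hm.norm_mulOp_apply_le _).trans (mul_le_mul_of_nonneg_left (norm_D_le α u) hm.nonneg)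
  refine ContinuousLinearMap.opNorm_le_bound _ (by positivity) fun u => ?_
  have hR : ‖opR (wt 1) δ u‖ ≤ (1 + 1 / 2 * C) * ‖u‖ := by
    have e : opR (wt 1) δ u = mulOp (wt 1 * mu δ).1 (D ⟨(1, 0), by decide⟩ u)
      + (1 / 2 : ℝ) • mulOp (wt 1 * dx (mu δ)).1 (D MultiIndex4.zero u) := rfl
    have h5 := key h1 MultiIndex4.zero u
    have h6 := key h0 ⟨(1, 0), by decide⟩ u
    rw [e]
    refine (norm_add_le _ _).trans ?_
    rw [norm_smul, Real.norm_of_nonneg (by norm_num)]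
    linarith
  have hQ : ‖opQ (wt 1) δ u‖ ≤ (C + C + C) * ‖u‖ := by
    have h5 := key h2 ⟨(0, 2), by decide⟩ u
    have h6 := key h3 ⟨(0, 1), by decide⟩ u
    have h7 := key h4 MultiIndex4.zero u
    refine (norm_add₃_le).trans ?_
    refine (add_le_add (add_le_add h5 h6) h7).trans_eq ?_
    ring
  have e : opL (wt 1) δ g u = opR (wt 1) δ u - coefOp g (opQ (wt 1) δ u) := rfl
  rw [e, add_mul]
  refine (norm_sub_le _ _).trans (add_le_add hR ?_)
  refine ((coefOp g).le_of_opNorm_le (norm_coefOp_le hg) _).trans ?_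
  rw [mul_assoc]
  exact mul_le_mul_of_nonneg_left hQ (by norm_num)

/-- Multiplication by the weight is bounded on `H⁴`, uniformly in `δ`. -/
lemma exists_mul_wt : ∃ C : ℝ, 0 ≤ C ∧ ∀ δ ∈ Icc (0 : ℝ) 1, ∀ u : H4, ∃ u' : H4,
    incl u' = mulOp (weight δ) (incl u) ∧ ‖u'‖ ≤ C * ‖u‖ := by
  obtain ⟨C, hC, hb⟩ := exists_weight_bound
  refine ⟨64 * C, by positivity, fun δ hδ u => ?_⟩
  have h0 : IsMultiplier (wt δ).1 1 := .of_continuous (wt δ).continuous (abs_weight_le δ)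
  have hle : ∀ w : Test, ‖Test.toH4 (wt δ • w)‖ ≤ 64 * C * ‖Test.toH4 w‖ :=
    Test.norm_toH4_smul_le fun a b h p => (hb δ hδ a b (by omega) p).1
  obtain ⟨w, hw⟩ := Test.exists_seq_tendsto u
  have hc : CauchySeq fun n => Test.toH4 (wt δ • w n) := by
    have h1 := hw.cauchySeq
    rw [Metric.cauchySeq_iff'] at h1 ⊢
    intro ε hε
    obtain ⟨N, hN⟩ := h1 (ε / (64 * C)) (by positivity)
    refine ⟨N, fun n hn => ?_⟩
    have h2 := hN n hn
    rw [dist_eq_norm, ← map_sub] at h2 ⊢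
    rw [← Test.smooth_smul_sub]
    refine (hle _).trans_lt ?_
    rw [lt_div_iff₀ (by positivity)] at h2
    linarith
  obtain ⟨u', hu'⟩ := cauchySeq_tendsto_of_complete hc
  refine ⟨u', ?_, ?_⟩
  · have h1 := (incl.continuous.tendsto u').comp hu'
    have h2 := ((mulOp (weight δ)).continuous.tendsto _).comp ((incl.continuous.tendsto u).comp hw)
    refine tendsto_nhds_unique h1 (h2.congr fun n => ?_)
    simp only [Function.comp_apply]
    rw [Test.incl_toH4, Test.incl_toH4]
    exact h0.mulOp_toL2 (w n)
  · exact le_of_tendsto_of_tendsto hu'.norm (hw.norm.const_mul _) (Eventually.of_forall fun n =>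
      hle (w n))

/-! ### The weighted `L²` estimate -/

end H4

namespace Test

/-- The pointwise inequality behind the weighted estimate. -/
lemma weighted_density_le {k a b c D x y : ℝ} (hk : 0 < k) (h1 : |c| ≤ 2 * k) (hb : |b| ≤ 14 * k)
    (ha1 : 1 / 2 ≤ a) (hq2 : x ^ 2 ≤ y ^ 2) :
    -200 * (k * y ^ 2) ≤ -(1 / 2) * (c * y ^ 2) + (b * x * D + k * a * D ^ 2) := by
  have hy : 0 ≤ y ^ 2 := sq_nonneg y
  have t1 : -(1 / 2) * (c * y ^ 2) ≥ - (k * y ^ 2) := by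
    have := (abs_le.1 h1).2
    nlinarith
  have t2 : b * x * D ≥ - (14 * k * (|x| * |D|)) := by
    have := neg_abs_le (b * x * D)
    rw [abs_mul, abs_mul, mul_assoc] at this
    have h3 : |b| * (|x| * |D|) ≤ 14 * k * (|x| * |D|) := by gcongr
    linarith
  have t3 : k * a * D ^ 2 ≥ 1 / 2 * k * D ^ 2 := by
    have : 0 ≤ k * D ^ 2 := by positivity
    nlinarith
  have t4 : 14 * (|x| * |D|) ≤ 1 / 2 * D ^ 2 + 98 * x ^ 2 := by
    rw [← sq_abs x, ← sq_abs D]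
    nlinarith [sq_nonneg (|D| - 14 * |x|)]
  have t5 : k * (14 * (|x| * |D|)) ≤ k * (1 / 2 * D ^ 2 + 98 * x ^ 2) := by gcongr
  have t6 : k * x ^ 2 ≤ k * y ^ 2 := by gcongr
  have t7 : 0 ≤ k * y ^ 2 := by positivity
  nlinarith

/-- The weighted `L²` estimate behind uniqueness, for test functions. -/
lemma weighted_estimate {δ : ℝ} {g : Test} (hg : ‖toH4 g‖ ≤ 1 / 8) (z : Test) :
    - 200 * ‖toL2 (wt 1 • z)‖ ^ 2 ≤ inner ℝ (toL2 (wt 1 • opL δ g z)) (toL2 (wt 1 • z)) := by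
  set κ : Smooth := wt 1 * wt 1 with hκ
  have hκ0 : ∀ p, 0 < κ.1 p := fun p => mul_pos (weight_pos 1 p) (weight_pos 1 p)
  have e0 : inner ℝ (toL2 (wt 1 • opL δ g z)) (toL2 (wt 1 • z))
      = inner ℝ (toL2 (κ • opL δ g z)) (toL2 z) := by
    rw [hκ, smooth_mul_smul, inner_smul_left (wt 1) (wt 1 • opL δ g z)]
  have eN : ‖toL2 (wt 1 • z)‖ ^ 2 = ∫ p, κ.1 p * z.fn p ^ 2 := by
    rw [← real_inner_self_eq_norm_sq, inner_toL2_toL2]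
    refine integral_congr_ae (ae_of_all _ fun p => ?_)
    change (weight 1 p * z.fn p) * (weight 1 p * z.fn p) = weight 1 p * weight 1 p * z.fn p ^ 2
    ring
  have hdκx : ∀ p, |(dx κ).1 p * (mu δ).1 p| ≤ 2 * κ.1 p := by
    intro p
    have e : (dx κ).1 p * (mu δ).1 p
        = -(2 * κ.1 p * ((1 * p.1 * weight 1 p) * (1 * p.2 * weight 1 p) * weight δ p ^ 2)) := by
      rw [hκ, Derivation.leibniz, dx_wt]
      change (weight 1 p * -(1 * (1 * p.1 * weight 1 p) * weight 1 p ^ 2)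
        + weight 1 p * -(1 * (1 * p.1 * weight 1 p) * weight 1 p ^ 2)) *
        (weight δ p * weight δ p * p.2) = -(2 * (weight 1 p * weight 1 p) * _)
      ring
    have h1 := abs_mul_weight_le 1 p
    rw [e, abs_neg, abs_mul, abs_mul, abs_two, abs_of_pos (hκ0 p), abs_mul, abs_mul, abs_pow]
    have : |1 * p.1 * weight 1 p| * |1 * p.2 * weight 1 p| * |weight δ p| ^ 2 ≤ 1 * 1 * 1 ^ 2 := by
      gcongr
      · exact h1.1
      · exact h1.2
      · exact abs_weight_le δ p
    have hp := hκ0 p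
    nlinarith
  have hdκy : ∀ p, |(dy κ).1 p| ≤ 2 * κ.1 p := by
    intro p
    have e : (dy κ).1 p = -(2 * κ.1 p * ((1 * p.2 * weight 1 p) * weight 1 p)) := by
      rw [hκ, Derivation.leibniz, dy_wt]
      change (weight 1 p * -(1 * (1 * p.2 * weight 1 p) * weight 1 p ^ 2)
        + weight 1 p * -(1 * (1 * p.2 * weight 1 p) * weight 1 p ^ 2)) =
          -(2 * (weight 1 p * weight 1 p) * _)
      ring
    rw [e, abs_neg, abs_mul, abs_mul, abs_two, abs_of_pos (hκ0 p), abs_mul]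
    have : |1 * p.2 * weight 1 p| * |weight 1 p| ≤ 1 * 1 := by
      gcongr
      · exact (abs_mul_weight_le 1 p).2
      · exact abs_weight_le 1 p
    have hp := hκ0 p
    nlinarith
  -- the transport part
  have hT : inner ℝ (toL2 (κ • (mu δ • dd 1 0 z + (1 / 2 : ℝ) • (dx (mu δ) • z)))) (toL2 z)
      = ∫ p, -(1 / 2) * ((dx κ).1 p * (mu δ).1 p * z.fn p ^ 2) := by
    have h1 := inner_transport (κ * mu δ) z
    rw [smooth_smul_add, smooth_smul_smul, map_add, toL2.map_smul, inner_add_left,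
      real_inner_smul_left, ← smooth_mul_smul, h1, ← smooth_mul_smul, inner_toL2_toL2,
      inner_toL2_toL2, ← integral_const_mul, ← integral_const_mul, ← integral_add
        ((z.1 • (dx (κ * mu δ) • z)).integrable.const_mul (-(1 / 2)) |>.congr
          (ae_of_all _ fun p => by
            simp only [smooth_smul_fn, Pi.mul_apply]; rw [mul_comm (z.1.1 p)]; rfl))
        ((z.1 • ((κ * dx (mu δ)) • z)).integrable.const_mul (1 / 2) |>.congr
          (ae_of_all _ fun p => by
            simp only [smooth_smul_fn, Pi.mul_apply]; rw [mul_comm (z.1.1 p)]; rfl))]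
    refine integral_congr_ae (ae_of_all _ fun p => ?_)
    rw [Derivation.leibniz]
    change -(1 / 2) * (((κ.1 p * (dx (mu δ)).1 p + (mu δ).1 p * (dx κ).1 p) * z.fn p) * z.fn p)
      + 1 / 2 * ((κ.1 p * (dx (mu δ)).1 p * z.fn p) * z.fn p) = _
    ring
  -- the diffusion part
  set q : Test := wt δ • z with hq
  have hdq : dd 0 1 q = opD δ z := rfl
  have hDf : - inner ℝ (toL2 (κ • ((wt δ * coef g) • dd 0 1 (opD δ z)))) (toL2 z)
      = ∫ p, ((dy κ).1 p * (coef g).1 p + κ.1 p * (dy (coef g)).1 p) * q.fn p * (opD δ z).fn p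
        + κ.1 p * (coef g).1 p * (opD δ z).fn p ^ 2 := by
    have e1 : κ • ((wt δ * coef g) • dd 0 1 (opD δ z)) = (κ * (wt δ * coef g)) • dd 0 1 (opD δ z) :=
      (smooth_mul_smul _ _ _).symm
    have e2 : (κ * (wt δ * coef g)) • z = (κ * coef g) • q := by
      rw [hq, ← smooth_mul_smul]; congr 1; ring
    have e3 := inner_dd_right 0 1 ((κ * coef g) • q) (opD δ z)
    rw [e1, inner_smul_left, e2, real_inner_comm, e3, dy_smul, hdq, inner_toL2_toL2]
    norm_num
    refine integral_congr_ae (ae_of_all _ fun p => ?_)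
    change ((κ.1 p * (dy (coef g)).1 p + (coef g).1 p * (dy κ).1 p) * q.fn p
      + κ.1 p * (coef g).1 p * (opD δ z).fn p) * (opD δ z).fn p = _
    ring
  have hI1 : Integrable fun p => -(1 / 2) * ((dx κ).1 p * (mu δ).1 p * z.fn p ^ 2) := by
    refine ((dx κ * mu δ) • (z.1 • z)).integrable.const_mul (-(1 / 2)) |>.congr
      (ae_of_all _ fun p => ?_)
    change -(1 / 2) * ((dx κ).1 p * (mu δ).1 p * (z.fn p * z.fn p)) = _
    ring
  have hI2 : Integrable fun p =>
      ((dy κ).1 p * (coef g).1 p + κ.1 p * (dy (coef g)).1 p) * q.fn p * (opD δ z).fn p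
        + κ.1 p * (coef g).1 p * (opD δ z).fn p ^ 2 := by
    refine ((((dy κ * coef g + κ * dy (coef g)) * q.1) • opD δ z)
      + ((κ * coef g) • ((opD δ z).1 • opD δ z))).integrable.congr (ae_of_all _ fun p => ?_)
    change ((dy κ).1 p * (coef g).1 p + κ.1 p * (dy (coef g)).1 p) * q.fn p * (opD δ z).fn p
      + κ.1 p * (coef g).1 p * ((opD δ z).fn p * (opD δ z).fn p) = _
    ring
  have hsplit : inner ℝ (toL2 (κ • opL δ g z)) (toL2 z)
      = ∫ p, (-(1 / 2) * ((dx κ).1 p * (mu δ).1 p * z.fn p ^ 2) +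
        (((dy κ).1 p * (coef g).1 p + κ.1 p * (dy (coef g)).1 p) * q.fn p * (opD δ z).fn p
        + κ.1 p * (coef g).1 p * (opD δ z).fn p ^ 2)) := by
    rw [integral_add hI1 hI2, ← hT, ← hDf, Test.opL, smooth_smul_sub, map_sub, inner_sub_left]
    ring
  rw [e0, eN, hsplit, ← integral_const_mul]
  refine integral_mono ?_ (hI1.add hI2) fun p => ?_
  · refine (κ • (z.1 • z)).integrable.const_mul (-200) |>.congr (ae_of_all _ fun p => ?_)
    change -200 * (κ.1 p * (z.fn p * z.fn p)) = _
    ring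
  · obtain ⟨ha1, ha2, ha3⟩ := coef_bounds hg p
    have h1 := hdκx p
    have h2 := hdκy p
    have hk := hκ0 p
    have hq2 : q.fn p ^ 2 ≤ z.fn p ^ 2 := by
      change (weight δ p * z.fn p) ^ 2 ≤ _
      rw [mul_pow]
      have : weight δ p ^ 2 ≤ 1 := pow_le_one₀ (weight_pos δ p).le (weight_le_one δ p)
      nlinarith [sq_nonneg (z.fn p)]
    have hb : |(dy κ).1 p * (coef g).1 p + κ.1 p * (dy (coef g)).1 p| ≤ 14 * κ.1 p := by
      refine (abs_add_le _ _).trans ?_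
      rw [abs_mul, abs_mul, abs_of_pos hk, abs_of_pos (show 0 < (coef g).1 p by linarith)]
      have := mul_le_mul h2 ha2 (by linarith) (by positivity)
      nlinarith
    exact weighted_density_le hk h1 hb ha1 hq2

end Test

/-- The weighted `L²` estimate behind uniqueness. -/
theorem H4.weighted_estimate {δ : ℝ} (hδ : δ ∈ Icc (0 : ℝ) 1) {g : H4} (hg : ‖g‖ < 1 / 8) (z : H4) :
    - 200 * ‖mulOp (weight 1) (incl z)‖ ^ 2
      ≤ inner ℝ (opL (wt 1) δ g z) (mulOp (weight 1) (incl z)) := by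
  have h0 : IsMultiplier (wt 1).1 1 := .of_continuous (wt 1).continuous (abs_weight_le 1)
  obtain ⟨γ, hγ⟩ := Test.exists_seq_tendsto g
  obtain ⟨w, hw⟩ := Test.exists_seq_tendsto z
  have hc : Continuous fun q : H4 × H4 =>
      inner ℝ (opL (wt 1) δ q.1 q.2) (mulOp (weight 1) (incl q.2)) := by
    refine Continuous.inner ?_
      ((mulOp (weight 1)).continuous.comp (incl.continuous.comp continuous_snd))
    exact ((continuous_opL (wt 1) δ).comp continuous_fst).clm_apply continuous_snd
  have hc2 : Continuous fun z : H4 => - 200 * ‖mulOp (weight 1) (incl z)‖ ^ 2 := by fun_prop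
  refine le_of_tendsto_of_tendsto ((hc2.tendsto z).comp hw)
    ((hc.tendsto (g, z)).comp (hγ.prodMk_nhds hw)) ?_
  filter_upwards [hγ.norm.eventually (gt_mem_nhds hg)] with n hn
  simp only [Function.comp_apply]
  rw [Test.incl_toH4, opL_toH4 (isAdmissible_wt hδ)]
  have e := h0.mulOp_toL2 (w n)
  change mulOp (weight 1) (Test.toL2 (w n)) = _ at e
  rw [e]
  exact Test.weighted_estimate hn.le (w n)

/-! ### The Lions projection theorem and linear evolution equations -/

section Lions

variable {𝓗 H Φ : Type*} [NormedAddCommGroup 𝓗] [InnerProductSpace ℝ 𝓗] [CompleteSpace 𝓗]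
  [NormedAddCommGroup H] [InnerProductSpace ℝ H] [AddCommGroup Φ] [Module ℝ Φ]

/-- A linear functional that is bounded by `M ‖S φ‖` is represented as `⟨x, S φ⟩`. -/
lemma exists_inner_eq_of_abs_le (S : Φ →ₗ[ℝ] 𝓗) (ℓ : Φ →ₗ[ℝ] ℝ) {M : ℝ} (hM : 0 ≤ M)
    (h : ∀ φ, |ℓ φ| ≤ M * ‖S φ‖) : ∃ x : 𝓗, ‖x‖ ≤ M ∧ ∀ φ, inner ℝ x (S φ) = ℓ φ := by
  obtain ⟨r, hr⟩ := S.rangeRestrict.exists_rightInverse_of_surjective S.range_rangeRestrict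
  have hr' : ∀ y, S (r y) = y := fun y => congrArg Subtype.val (LinearMap.congr_fun hr y)
  let f : LinearMap.range S →L[ℝ] ℝ := LinearMap.mkContinuous (ℓ ∘ₗ r) M fun y => by
    simpa [hr'] using h (r y)
  obtain ⟨F, hF, hn⟩ := exists_extension_norm_eq (LinearMap.range S) f
  refine ⟨(InnerProductSpace.toDual ℝ 𝓗).symm F, ?_, fun φ => ?_⟩
  · rw [LinearIsometryEquiv.norm_map, hn]
    exact LinearMap.mkContinuous_norm_le _ hM _
  · rw [InnerProductSpace.toDual_symm_apply]
    refine (hF (S.rangeRestrict φ)).trans ?_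
    change ℓ (r (S.rangeRestrict φ)) = ℓ φ
    have h0 := h (r (S.rangeRestrict φ) - φ)
    rw [map_sub, map_sub, hr'] at h0
    have h1 : ((S.rangeRestrict φ : LinearMap.range S) : 𝓗) = S φ := rfl
    rw [h1, sub_self, norm_zero, mul_zero, abs_nonpos_iff] at h0
    linarith

/-- Lions' projection theorem: a bilinear form that is coercive on the image of the test space has
a solution in the closure of that image. -/
theorem lions_projection (ι S : Φ →ₗ[ℝ] 𝓗) (β : Φ →ₗ[ℝ] H) {c : ℝ} (hc : 0 < c)
    (h : ∀ φ, c * ‖ι φ‖ ^ 2 + 1 / 2 * ‖β φ‖ ^ 2 ≤ inner ℝ (ι φ) (S φ)) (u₀ : H) :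
    ∃ x ∈ closure (range ι), ‖x‖ ^ 2 ≤ 2 / c * ‖u₀‖ ^ 2 ∧
      ∀ φ, inner ℝ x (S φ) = inner ℝ u₀ (β φ) := by
  set W : Submodule ℝ 𝓗 := (LinearMap.range ι).topologicalClosure with hW
  have : CompleteSpace W := (Submodule.isClosed_topologicalClosure _).completeSpace_coe
  have hι : ∀ φ, ι φ ∈ W := fun φ => Submodule.le_topologicalClosure _ ⟨φ, rfl⟩
  -- projecting `S φ` onto the closure of the image makes the coercivity usable
  let P : Φ →ₗ[ℝ] W := W.orthogonalProjectionOnto.toLinearMap ∘ₗ S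
  have hP : ∀ (w : W) φ, inner ℝ w (P φ) = inner ℝ (w : 𝓗) (S φ) := fun w φ =>
    Submodule.inner_orthogonalProjectionOnto_eq_of_mem_left w (S φ)
  have key : ∀ φ, 1 / 2 * ‖β φ‖ ^ 2 ≤ ‖P φ‖ ^ 2 / c := by
    intro φ
    have h1 := h φ
    have h2 : inner ℝ (ι φ) (S φ) ≤ ‖ι φ‖ * ‖P φ‖ := by
      rw [← hP ⟨ι φ, hι φ⟩ φ]
      exact real_inner_le_norm _ _
    rw [le_div_iff₀ hc]
    have h3 : c * ‖ι φ‖ ≤ ‖P φ‖ := by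
      rcases (norm_nonneg (ι φ)).eq_or_lt with h0 | h0
      · rw [← h0]; simp
      · refine le_of_mul_le_mul_left ?_ h0
        nlinarith [sq_nonneg ‖β φ‖]
    have h4 : 1 / 2 * ‖β φ‖ ^ 2 ≤ ‖ι φ‖ * ‖P φ‖ := by
      nlinarith [mul_nonneg hc.le (sq_nonneg ‖ι φ‖)]
    calc 1 / 2 * ‖β φ‖ ^ 2 * c ≤ ‖ι φ‖ * ‖P φ‖ * c := by gcongr
      _ = c * ‖ι φ‖ * ‖P φ‖ := by ring
      _ ≤ ‖P φ‖ * ‖P φ‖ := by gcongr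
      _ = _ := by ring
  obtain ⟨x, hx, hxS⟩ := exists_inner_eq_of_abs_le P ((innerₛₗ ℝ u₀) ∘ₗ β)
    (M := ‖u₀‖ * Real.sqrt (2 / c)) (by positivity) fun φ => by
      change |inner ℝ u₀ (β φ)| ≤ _
      refine (abs_real_inner_le_norm _ _).trans ?_
      rw [mul_assoc]
      refine mul_le_mul_of_nonneg_left ?_ (norm_nonneg _)
      refine abs_le_of_sq_le_sq' ?_ (by positivity) |>.2
      rw [mul_pow, Real.sq_sqrt (by positivity)]
      have := key φ
      calc ‖β φ‖ ^ 2 = 2 * (1 / 2 * ‖β φ‖ ^ 2) := by ring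
        _ ≤ 2 * (‖P φ‖ ^ 2 / c) := by gcongr
        _ = _ := by ring
  refine ⟨x, x.2, ?_, fun φ => by rw [← hP, hxS]; rfl⟩
  have h1 : ‖(x : 𝓗)‖ ≤ ‖u₀‖ * Real.sqrt (2 / c) := hx
  calc ‖(x : 𝓗)‖ ^ 2 ≤ (‖u₀‖ * Real.sqrt (2 / c)) ^ 2 := by gcongr
    _ = 2 / c * ‖u₀‖ ^ 2 := by rw [mul_pow, Real.sq_sqrt (by positivity)]; ring

end Lions

section Evolution

variable {H K V Y : Type*} [NormedAddCommGroup H] [InnerProductSpace ℝ H] [CompleteSpace H]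
  [NormedAddCommGroup K] [InnerProductSpace ℝ K] [CompleteSpace K]
  [NormedAddCommGroup Y] [NormedSpace ℝ Y]
  [AddCommGroup V] [Module ℝ V]

/-- Lebesgue measure on the time interval `]0, τ]`. -/
abbrev timeMeasure (τ : ℝ) : Measure ℝ := volume.restrict (Ioc 0 τ)

lemma Continuous.memLp_time {E : Type*} [NormedAddCommGroup E] {f : ℝ → E} (hf : Continuous f)
    (τ : ℝ) (p : ℝ≥0∞) : MemLp f p (timeMeasure τ) := by
  obtain ⟨C, hC⟩ := (isCompact_Icc (a := (0 : ℝ)) (b := τ)).exists_bound_of_continuousOn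
    hf.continuousOn
  refine MemLp.of_bound hf.aestronglyMeasurable C ?_
  filter_upwards [ae_restrict_mem measurableSet_Ioc] with t ht using hC t ⟨ht.1.le, ht.2⟩

lemma memLp_continuous_smul {G : Type*} [NormedAddCommGroup G] [NormedSpace ℝ G] {η : ℝ → ℝ}
    (hη : Continuous η) {f : ℝ → G} {τ : ℝ} {p : ℝ≥0∞} (hf : MemLp f p (timeMeasure τ)) :
    MemLp (fun t => η t • f t) p (timeMeasure τ) := by
  obtain ⟨C, hC⟩ := (isCompact_Icc (a := (0 : ℝ)) (b := τ)).exists_bound_of_continuousOn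
    hη.continuousOn
  refine hf.of_le_mul (c := C) (hη.aestronglyMeasurable.smul hf.aestronglyMeasurable) ?_
  filter_upwards [ae_restrict_mem measurableSet_Ioc] with t ht
  rw [norm_smul]
  exact mul_le_mul_of_nonneg_right (hC t ⟨ht.1.le, ht.2⟩) (norm_nonneg _)

lemma norm_sq_Lp_time {G : Type*} [NormedAddCommGroup G] [InnerProductSpace ℝ G] {τ : ℝ}
    (f : Lp G 2 (timeMeasure τ)) : ‖f‖ ^ 2 = ∫ t in Ioc 0 τ, ‖f t‖ ^ 2 := by
  rw [← real_inner_self_eq_norm_sq, L2.inner_def]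
  simp only [real_inner_self_eq_norm_sq]

lemma MemLp.integrable_inner_two {α G : Type*} [MeasurableSpace α] {μ : Measure α}
    [NormedAddCommGroup G] [InnerProductSpace ℝ G] {f h : α → G} (hf : MemLp f 2 μ)
    (hh : MemLp h 2 μ) : Integrable (fun t => inner ℝ (f t) (h t)) μ := by
  refine (L2.integrable_inner (𝕜 := ℝ) (hf.toLp f) (hh.toLp h)).congr ?_
  filter_upwards [hf.coeFn_toLp, hh.coeFn_toLp] with t h1 h2
  rw [h1, h2]

/-- A linear family of square integrable functions as a linear map to `L²`. -/
def linearToLp {Φ E : Type*} [AddCommGroup Φ] [Module ℝ Φ] [NormedAddCommGroup E]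
    [NormedSpace ℝ E] {τ : ℝ} (F : Φ →ₗ[ℝ] (ℝ → E)) (hF : ∀ φ, MemLp (F φ) 2 (timeMeasure τ)) :
    Φ →ₗ[ℝ] Lp E 2 (timeMeasure τ) where
  toFun φ := (hF φ).toLp (F φ)
  map_add' φ ψ := by
    rw [← MemLp.toLp_add]
    exact MemLp.toLp_congr _ _ (by rw [map_add])
  map_smul' a φ := by
    rw [RingHom.id_apply, ← MemLp.toLp_const_smul]
    exact MemLp.toLp_congr _ _ (by rw [map_smul])

lemma coeFn_linearToLp {Φ E : Type*} [AddCommGroup Φ] [Module ℝ Φ] [NormedAddCommGroup E]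
    [NormedSpace ℝ E] {τ : ℝ} (F : Φ →ₗ[ℝ] (ℝ → E)) (hF : ∀ φ, MemLp (F φ) 2 (timeMeasure τ))
    (φ : Φ) : linearToLp F hF φ =ᵐ[timeMeasure τ] F φ := MemLp.coeFn_toLp (hF φ)

/-- The test functions of the evolution problem: functions `φ` of time with values in `V` for which
`j φ` is of class `C¹`, and `A φ` and `D φ` are square integrable. -/
def timeTests (j : V →ₗ[ℝ] H) (D : V →ₗ[ℝ] K) (A : ℝ → V →ₗ[ℝ] H) (τ : ℝ) :
    Submodule ℝ (ℝ → V) where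
  carrier := {φ | ContDiff ℝ 1 (fun t => j (φ t)) ∧
    MemLp (fun t => A t (φ t)) 2 (timeMeasure τ) ∧ MemLp (fun t => D (φ t)) 2 (timeMeasure τ)}
  zero_mem' := by
    simp only [mem_ofPred_eq, Pi.zero_apply, map_zero]
    exact ⟨contDiff_const, MemLp.zero', MemLp.zero'⟩
  add_mem' := fun {φ ψ} h h' => by
    simp only [mem_ofPred_eq, Pi.add_apply, map_add]
    exact ⟨h.1.add h'.1, h.2.1.add h'.2.1, h.2.2.add h'.2.2⟩
  smul_mem' := fun a φ h => by
    simp only [mem_ofPred_eq, Pi.smul_apply, map_smul]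
    exact ⟨contDiff_const.smul h.1, h.2.1.const_smul a, h.2.2.const_smul a⟩

/-- Existence for the weak form of `u' + A^* u = 0`, `u(0) = u₀`, when `A` is coercive: the
solution comes with its final value `u(τ)` and with `d = D u`, the latter expressed through a pair
of continuous operators for which `E (j w) = I (D w)`. -/
theorem exists_weak_evolution {τ : ℝ} (hτ : 0 ≤ τ) (j : V →ₗ[ℝ] H) (D : V →ₗ[ℝ] K)
    (A : ℝ → V →ₗ[ℝ] H) (hA : ∀ w, MemLp (fun t => A t w) 2 (timeMeasure τ)) {c : ℝ} (hc : 0 < c)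
    (hc' : c ≤ 1 / 2)
    (hco : ∀ᵐ t ∂timeMeasure τ, ∀ w, c * ‖j w‖ ^ 2 + c * ‖D w‖ ^ 2 ≤ inner ℝ (j w) (A t w))
    (E : H →L[ℝ] Y) (I : K →L[ℝ] Y) (hEI : ∀ w, E (j w) = I (D w)) (u₀ : H) :
    ∃ (u : ℝ → H) (d : ℝ → K) (u₁ : H), MemLp u 2 (timeMeasure τ) ∧ MemLp d 2 (timeMeasure τ) ∧
      (∫ t in Ioc 0 τ, ‖u t‖ ^ 2) + ‖u₁‖ ^ 2 + (∫ t in Ioc 0 τ, ‖d t‖ ^ 2) ≤ 2 / c * ‖u₀‖ ^ 2 ∧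
      (∀ᵐ t ∂timeMeasure τ, E (u t) = I (d t)) ∧
      ∀ η : ℝ → ℝ, ContDiff ℝ 1 η → ∀ w, (∫ t in Ioc 0 τ,
          (η t * inner ℝ (u t) (A t w) - deriv η t * inner ℝ (u t) (j w)))
        + η τ * inner ℝ u₁ (j w) = η 0 * inner ℝ u₀ (j w) := by
  let Φ := timeTests j D A τ
  have hder : ∀ (φ : Φ) t, HasDerivAt (fun s => j (φ.1 s)) (deriv (fun s => j (φ.1 s)) t) t :=
    fun φ t => (φ.2.1.differentiable (by norm_num) t).hasDerivAt
  have hderc : ∀ φ : Φ, Continuous (deriv fun s => j (φ.1 s)) := fun φ =>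
    φ.2.1.continuous_deriv (by norm_num)
  let F₁ : Φ →ₗ[ℝ] (ℝ → H) :=
    { toFun := fun φ t => j (φ.1 t)
      map_add' := fun φ ψ => by ext t; simp
      map_smul' := fun a φ => by ext t; simp }
  let F₂ : Φ →ₗ[ℝ] (ℝ → H) :=
    { toFun := fun φ t => A t (φ.1 t) - deriv (fun s => j (φ.1 s)) t
      map_add' := fun φ ψ => by
        funext t
        have h : deriv (fun s => j ((φ + ψ).1 s)) t = _ :=
          (((hder φ t).add (hder ψ t)).congr_of_eventuallyEq
            (Eventually.of_forall fun s => by simp)).deriv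
        rw [h]
        simp only [Submodule.coe_add, Pi.add_apply, map_add]
        abel
      map_smul' := fun a φ => by
        funext t
        have h : deriv (fun s => j ((a • φ).1 s)) t = _ :=
          (((hder φ t).const_smul a).congr_of_eventuallyEq
            (Eventually.of_forall fun s => by simp)).deriv
        rw [h]
        simp only [Submodule.coe_smul, Pi.smul_apply, map_smul, RingHom.id_apply, smul_sub] }
  let F₃ : Φ →ₗ[ℝ] (ℝ → K) :=
    { toFun := fun φ t => D (φ.1 t)
      map_add' := fun φ ψ => by ext t; simp
      map_smul' := fun a φ => by ext t; simp }
  have m₁ : ∀ φ, MemLp (F₁ φ) 2 (timeMeasure τ) := fun φ => φ.2.1.continuous.memLp_time τ 2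
  have m₂ : ∀ φ, MemLp (F₂ φ) 2 (timeMeasure τ) := fun φ =>
    φ.2.2.1.sub ((hderc φ).memLp_time τ 2)
  have m₃ : ∀ φ, MemLp (F₃ φ) 2 (timeMeasure τ) := fun φ => φ.2.2.2
  let β (t : ℝ) : Φ →ₗ[ℝ] H := LinearMap.proj t ∘ₗ F₁
  let 𝓗 := WithLp 2 (Lp H 2 (timeMeasure τ) × WithLp 2 (H × Lp K 2 (timeMeasure τ)))
  let mk : Lp H 2 (timeMeasure τ) × (H × Lp K 2 (timeMeasure τ)) →ₗ[ℝ] 𝓗 :=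
    { toFun := fun q => WithLp.toLp 2 (q.1, WithLp.toLp 2 q.2)
      map_add' := fun _ _ => rfl
      map_smul' := fun _ _ => rfl }
  let ι : Φ →ₗ[ℝ] 𝓗 := mk ∘ₗ (linearToLp F₁ m₁).prod ((β τ).prod (linearToLp F₃ m₃))
  let S : Φ →ₗ[ℝ] 𝓗 := mk ∘ₗ (linearToLp F₂ m₂).prod ((β τ).prod 0)
  have hnorm : ∀ x : 𝓗, ‖x‖ ^ 2 = ‖x.fst‖ ^ 2 + (‖x.snd.fst‖ ^ 2 + ‖x.snd.snd‖ ^ 2) := fun x => by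
    rw [WithLp.prod_norm_sq_eq_of_L2, WithLp.prod_norm_sq_eq_of_L2]
  have hS : ∀ (x : 𝓗) φ, inner ℝ x (S φ)
      = (∫ t in Ioc 0 τ, inner ℝ (x.fst t) (F₂ φ t)) + inner ℝ x.snd.fst (β τ φ) := fun x φ => by
    rw [WithLp.prod_inner_apply, WithLp.prod_inner_apply]
    change inner ℝ x.fst (linearToLp F₂ m₂ φ)
      + (inner ℝ x.snd.fst (β τ φ) + inner ℝ x.snd.snd 0) = _
    rw [inner_zero_right, add_zero, L2.inner_def]
    congr 1
    refine integral_congr_ae ?_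
    filter_upwards [coeFn_linearToLp F₂ m₂ φ] with t ht
    rw [ht]
  have hcoer : ∀ φ, c * ‖ι φ‖ ^ 2 + 1 / 2 * ‖β 0 φ‖ ^ 2 ≤ inner ℝ (ι φ) (S φ) := by
    intro φ
    have e1 : inner ℝ (ι φ) (S φ)
        = (∫ t in Ioc 0 τ, inner ℝ (F₁ φ t) (F₂ φ t)) + ‖β τ φ‖ ^ 2 := by
      rw [hS, ← real_inner_self_eq_norm_sq]
      congr 1
      refine integral_congr_ae ?_
      filter_upwards [coeFn_linearToLp F₁ m₁ φ] with t ht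
      rw [← ht]
      rfl
    have e2 : ‖ι φ‖ ^ 2 = (∫ t in Ioc 0 τ, ‖F₁ φ t‖ ^ 2)
        + (‖β τ φ‖ ^ 2 + ∫ t in Ioc 0 τ, ‖F₃ φ t‖ ^ 2) := by
      rw [hnorm]
      change ‖linearToLp F₁ m₁ φ‖ ^ 2 + (‖β τ φ‖ ^ 2 + ‖linearToLp F₃ m₃ φ‖ ^ 2) = _
      rw [norm_sq_Lp_time, norm_sq_Lp_time]
      congr 1
      · refine integral_congr_ae ?_
        filter_upwards [coeFn_linearToLp F₁ m₁ φ] with t ht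
        rw [ht]
      · congr 1
        refine integral_congr_ae ?_
        filter_upwards [coeFn_linearToLp F₃ m₃ φ] with t ht
        rw [ht]
    have hcd : Continuous fun t => inner ℝ (F₁ φ t) (deriv (fun s => j (φ.1 s)) t) :=
      φ.2.1.continuous.inner (hderc φ)
    have e3 : ∫ t in Ioc 0 τ, inner ℝ (F₁ φ t) (deriv (fun s => j (φ.1 s)) t)
        = 1 / 2 * (‖β τ φ‖ ^ 2 - ‖β 0 φ‖ ^ 2) := by
      have h1 : ∀ t, HasDerivAt (fun s => ‖F₁ φ s‖ ^ 2)
          (2 * inner ℝ (F₁ φ t) (deriv (fun s => j (φ.1 s)) t)) t := fun t => (hder φ t).norm_sq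
      have h2 := intervalIntegral.integral_eq_sub_of_hasDerivAt (a := 0) (b := τ)
        (fun t _ => h1 t) ((continuous_const.mul hcd).intervalIntegrable _ _)
      rw [intervalIntegral.integral_const_mul, intervalIntegral.integral_of_le hτ] at h2
      change _ = 1 / 2 * (‖F₁ φ τ‖ ^ 2 - ‖F₁ φ 0‖ ^ 2)
      rw [← h2]; ring
    have i₁ : IntegrableOn (fun t => ‖F₁ φ t‖ ^ 2) (Ioc 0 τ) := (m₁ φ).integrable_norm_pow (by simp)
    have i₃ : IntegrableOn (fun t => ‖F₃ φ t‖ ^ 2) (Ioc 0 τ) := (m₃ φ).integrable_norm_pow (by simp)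
    have i₁₃ : IntegrableOn (fun t => c * ‖F₁ φ t‖ ^ 2 + c * ‖F₃ φ t‖ ^ 2) (Ioc 0 τ) :=
      (i₁.const_mul c).add (i₃.const_mul c)
    have e4 : (∫ t in Ioc 0 τ, (c * ‖F₁ φ t‖ ^ 2 + c * ‖F₃ φ t‖ ^ 2
        - inner ℝ (F₁ φ t) (deriv (fun s => j (φ.1 s)) t)))
        ≤ ∫ t in Ioc 0 τ, inner ℝ (F₁ φ t) (F₂ φ t) := by
      refine integral_mono_ae (i₁₃.sub hcd.integrableOn_Ioc)
        (MemLp.integrable_inner_two (m₁ φ) (m₂ φ)) ?_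
      filter_upwards [hco] with t ht
      have h1 := ht (φ.1 t)
      change _ ≤ inner ℝ (F₁ φ t) (A t (φ.1 t) - deriv (fun s => j (φ.1 s)) t)
      rw [inner_sub_right]
      change c * ‖F₁ φ t‖ ^ 2 + c * ‖F₃ φ t‖ ^ 2 ≤ inner ℝ (F₁ φ t) (A t (φ.1 t)) at h1
      linarith
    rw [integral_sub i₁₃ hcd.integrableOn_Ioc,
      integral_add (i₁.const_mul c) (i₃.const_mul c), integral_const_mul, integral_const_mul,
      e3] at e4
    rw [e1, e2]
    nlinarith [sq_nonneg ‖β τ φ‖]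
  obtain ⟨x, hx, hxn, hxS⟩ := lions_projection ι S (β 0) hc hcoer u₀
  refine ⟨x.fst, x.snd.snd, x.snd.fst, Lp.memLp _, Lp.memLp _, ?_, ?_, ?_⟩
  · rw [← norm_sq_Lp_time, ← norm_sq_Lp_time]
    rw [hnorm] at hxn
    linarith
  · have hcl : IsClosed {x : 𝓗 | E.compLpL 2 (timeMeasure τ) x.fst
        = I.compLpL 2 (timeMeasure τ) x.snd.snd} := by
      refine isClosed_eq ?_ ?_
      · exact (E.compLpL 2 (timeMeasure τ)).continuous.comp
          (continuous_fst.comp (WithLp.prod_continuous_ofLp 2 _ _))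
      · exact (I.compLpL 2 (timeMeasure τ)).continuous.comp
          (continuous_snd.comp ((WithLp.prod_continuous_ofLp 2 _ _).comp
            (continuous_snd.comp (WithLp.prod_continuous_ofLp 2 _ _))))
    have hx' : E.compLpL 2 (timeMeasure τ) x.fst = I.compLpL 2 (timeMeasure τ) x.snd.snd := by
      refine closure_minimal (range_subset_iff.2 fun φ => ?_) hcl hx
      change E.compLpL 2 (timeMeasure τ) (linearToLp F₁ m₁ φ)
        = I.compLpL 2 (timeMeasure τ) (linearToLp F₃ m₃ φ)
      refine Lp.ext ?_
      filter_upwards [E.coeFn_compLpL (linearToLp F₁ m₁ φ), I.coeFn_compLpL (linearToLp F₃ m₃ φ),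
        coeFn_linearToLp F₁ m₁ φ, coeFn_linearToLp F₃ m₃ φ] with t h1 h2 h3 h4
      rw [h1, h2, h3, h4]
      exact hEI _
    filter_upwards [E.coeFn_compLpL x.fst, I.coeFn_compLpL x.snd.snd] with t h1 h2
    rw [← h1, ← h2, hx']
  · intro η hη w
    have hmem : (fun t => η t • w) ∈ Φ := by
      refine ⟨?_, ?_, ?_⟩
      · simp only [map_smul]
        exact hη.smul contDiff_const
      · simp only [map_smul]
        exact memLp_continuous_smul hη.continuous (hA w)
      · simp only [map_smul]
        exact (hη.continuous.smul continuous_const).memLp_time τ 2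
    have h1 := hxS ⟨_, hmem⟩
    rw [hS] at h1
    have h2 : ∀ t, β t ⟨_, hmem⟩ = η t • j w := fun t => map_smul j (η t) w
    rw [h2, h2, real_inner_smul_right, real_inner_smul_right] at h1
    rw [← h1]
    congr 1
    refine integral_congr_ae (ae_of_all _ fun t => ?_)
    change _ = inner ℝ (x.fst t) (A t (η t • w) - deriv (fun s => j (η s • w)) t)
    have h3 : HasDerivAt (fun s => j (η s • w)) (deriv η t • j w) t := by
      simp only [map_smul]
      exact (hη.differentiable (by norm_num) t).hasDerivAt.smul_const _
    rw [h3.deriv, map_smul, inner_sub_right, real_inner_smul_right, real_inner_smul_right]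

/-- Existence for the weak form of `u' + A^* u = 0`, `u(0) = u₀`, under a Gårding inequality. The
factor `e^{(κ + c) t}` reduces it to the coercive case. -/
theorem exists_weak_evolution_of_garding {τ T : ℝ} (hτ : 0 ≤ τ) (hT : τ ≤ T) (j : V →ₗ[ℝ] H)
    (D : V →ₗ[ℝ] K) (A : ℝ → V →ₗ[ℝ] H) (hA : ∀ w, MemLp (fun t => A t w) 2 (timeMeasure τ))
    {c κ : ℝ} (hc : 0 < c) (hc' : c ≤ 1 / 2) (hκ : 0 ≤ κ)
    (hco : ∀ᵐ t ∂timeMeasure τ, ∀ w, c * ‖D w‖ ^ 2 - κ * ‖j w‖ ^ 2 ≤ inner ℝ (j w) (A t w))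
    (E : H →L[ℝ] Y) (I : K →L[ℝ] Y) (hEI : ∀ w, E (j w) = I (D w)) (u₀ : H) :
    ∃ (u : ℝ → H) (d : ℝ → K) (u₁ : H), MemLp u 2 (timeMeasure τ) ∧ MemLp d 2 (timeMeasure τ) ∧
      ‖u₁‖ ^ 2 + (∫ t in Ioc 0 τ, ‖d t‖ ^ 2)
        ≤ Real.exp ((κ + c) * T) ^ 2 * (2 / c) * ‖u₀‖ ^ 2 ∧
      (∀ᵐ t ∂timeMeasure τ, E (u t) = I (d t)) ∧
      ∀ η : ℝ → ℝ, ContDiff ℝ 1 η → ∀ w, (∫ t in Ioc 0 τ,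
          (η t * inner ℝ (u t) (A t w) - deriv η t * inner ℝ (u t) (j w)))
        + η τ * inner ℝ u₁ (j w) = η 0 * inner ℝ u₀ (j w) := by
  set l := κ + c with hl
  have hl0 : 0 ≤ l := by positivity
  obtain ⟨u, d, u₁, hu, hd, hb, hrel, heq⟩ := exists_weak_evolution hτ j D
    (fun t => A t + l • j) (fun w => (hA w).add (continuous_const.memLp_time τ 2)) hc hc' (by
      filter_upwards [hco] with t ht w
      have h1 := ht w
      rw [LinearMap.add_apply, LinearMap.smul_apply, inner_add_right, real_inner_smul_right,
        real_inner_self_eq_norm_sq]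
      nlinarith) E I hEI u₀
  have he : Continuous fun t => Real.exp (l * t) := by fun_prop
  have hle : ∀ t ≤ τ, Real.exp (l * t) ≤ Real.exp (l * T) := fun t ht =>
    Real.exp_le_exp.2 (mul_le_mul_of_nonneg_left (ht.trans hT) hl0)
  have hmd := memLp_continuous_smul he hd
  refine ⟨fun t => Real.exp (l * t) • u t, fun t => Real.exp (l * t) • d t,
    Real.exp (l * τ) • u₁, memLp_continuous_smul he hu, hmd, ?_, ?_, fun η hη w => ?_⟩
  · have h1 : ‖Real.exp (l * τ) • u₁‖ ^ 2 ≤ Real.exp (l * T) ^ 2 * ‖u₁‖ ^ 2 := by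
      rw [norm_smul, mul_pow, Real.norm_of_nonneg (Real.exp_pos _).le]
      have := hle τ le_rfl
      gcongr
    have i1 : IntegrableOn (fun t => ‖d t‖ ^ 2) (Ioc 0 τ) := hd.integrable_norm_pow (by simp)
    have h2 : (∫ t in Ioc 0 τ, ‖Real.exp (l * t) • d t‖ ^ 2)
        ≤ Real.exp (l * T) ^ 2 * ∫ t in Ioc 0 τ, ‖d t‖ ^ 2 := by
      rw [← integral_const_mul]
      refine integral_mono_ae (hmd.integrable_norm_pow (by simp)) (i1.const_mul _) ?_
      filter_upwards [ae_restrict_mem measurableSet_Ioc] with t ht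
      rw [norm_smul, mul_pow, Real.norm_of_nonneg (Real.exp_pos _).le]
      have := hle t ht.2
      gcongr
    have h3 : 0 ≤ ∫ t in Ioc 0 τ, ‖u t‖ ^ 2 := integral_nonneg fun t => sq_nonneg _
    calc _ ≤ Real.exp (l * T) ^ 2 * (‖u₁‖ ^ 2 + ∫ t in Ioc 0 τ, ‖d t‖ ^ 2) := by
          rw [mul_add]; exact add_le_add h1 h2
      _ ≤ Real.exp (l * T) ^ 2 * (2 / c * ‖u₀‖ ^ 2) := by gcongr; linarith
      _ = _ := by ring
  · filter_upwards [hrel] with t ht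
    rw [map_smul, map_smul, ht]
  · have h1 := heq (fun t => Real.exp (l * t) * η t)
      ((Real.contDiff_exp.comp (contDiff_const.mul contDiff_id)).mul hη) w
    simp only [mul_zero, Real.exp_zero, one_mul] at h1
    rw [← h1, real_inner_smul_left]
    congr 1
    · refine integral_congr_ae (ae_of_all _ fun t => ?_)
      have h3 : HasDerivAt (fun t => Real.exp (l * t) * η t)
          (Real.exp (l * t) * (l * 1) * η t + Real.exp (l * t) * deriv η t) t :=
        (((hasDerivAt_id t).const_mul l).exp).mul
          (hη.differentiable (by norm_num) t).hasDerivAt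
      simp only []
      rw [h3.deriv, LinearMap.add_apply, LinearMap.smul_apply, inner_add_right,
        real_inner_smul_right, real_inner_smul_left, real_inner_smul_left]
      ring
    · ring

end Evolution

/-! ### Primitives of integrable functions with values in a Hilbert space -/

section Primitive

lemma continuous_primitive_Ioc {Y : Type*} [NormedAddCommGroup Y] [NormedSpace ℝ Y] {τ : ℝ}
    {F : ℝ → Y} (hF : IntegrableOn F (Ioc 0 τ)) :
    ∃ Z : ℝ → Y, Continuous Z ∧ ∀ t ∈ Icc 0 τ, ∫ s in Ioc 0 t, F s = Z t := by
  have h1 : Integrable ((Ioc 0 τ).indicator F) := hF.integrable_indicator measurableSet_Ioc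
  refine ⟨fun t => ∫ s in (0 : ℝ)..t, (Ioc 0 τ).indicator F s,
    intervalIntegral.continuous_primitive (fun a b => h1.intervalIntegrable) 0, fun t ht => ?_⟩
  simp only [intervalIntegral.integral_of_le ht.1]
  refine setIntegral_congr_fun measurableSet_Ioc fun s hs => ?_
  rw [indicator_of_mem (show s ∈ Ioc 0 τ from ⟨hs.1, hs.2.trans ht.2⟩)]

lemma integrableOn_inner_primitive {Y : Type*} [NormedAddCommGroup Y] [InnerProductSpace ℝ Y]
    {τ : ℝ} {F : ℝ → Y} (hF : IntegrableOn F (Ioc 0 τ)) :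
    IntegrableOn (fun t => inner ℝ (∫ s in Ioc 0 t, F s) (F t)) (Ioc 0 τ) := by
  obtain ⟨Z, hZ, hFZ⟩ := continuous_primitive_Ioc hF
  obtain ⟨C, hC⟩ := (isCompact_Icc (a := (0 : ℝ)) (b := τ)).exists_bound_of_continuousOn
    hZ.continuousOn
  have h3 : IntegrableOn (fun s => inner ℝ (Z s) (F s)) (Ioc 0 τ) := by
    refine (hF.norm.const_mul C).mono' (hZ.aestronglyMeasurable.inner hF.aestronglyMeasurable) ?_
    filter_upwards [ae_restrict_mem measurableSet_Ioc] with t ht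
    exact (norm_inner_le_norm _ _).trans
      (mul_le_mul_of_nonneg_right (hC t ⟨ht.1.le, ht.2⟩) (norm_nonneg _))
  refine h3.congr_fun (fun s hs => ?_) measurableSet_Ioc
  simp only [hFZ s ⟨hs.1.le, hs.2⟩]

variable {Y : Type*} [NormedAddCommGroup Y] [InnerProductSpace ℝ Y] [CompleteSpace Y]

lemma inner_setIntegral {s : Set ℝ} {F : ℝ → Y} (hF : IntegrableOn F s) (y : Y) :
    inner ℝ (∫ t in s, F t) y = ∫ t in s, inner ℝ (F t) y := by
  rw [real_inner_comm, ← integral_inner hF]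
  simp only [real_inner_comm]

/-- Fubini's theorem on the triangle `s ≤ t`. -/
lemma integral_inner_primitive {τ : ℝ} {F G : ℝ → Y} (hF : IntegrableOn F (Ioc 0 τ))
    (hG : IntegrableOn G (Ioc 0 τ)) :
    ∫ t in Ioc 0 τ, inner ℝ (∫ s in Ioc 0 t, F s) (G t)
      = ∫ s in Ioc 0 τ, inner ℝ (F s) (∫ t in Ioc s τ, G t) := by
  have hint : Integrable (fun q : ℝ × ℝ => inner ℝ (F q.2) (G q.1))
      ((timeMeasure τ).prod (timeMeasure τ)) := by
    have h1 : Integrable (fun q : ℝ × ℝ => ‖G q.1‖ * ‖F q.2‖)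
      ((timeMeasure τ).prod (timeMeasure τ)) := hG.norm.mul_prod hF.norm
    refine h1.mono' ?_ (ae_of_all _ fun q => ?_)
    · exact (hF.aestronglyMeasurable.comp_snd).inner (hG.aestronglyMeasurable.comp_fst)
    · rw [mul_comm]; exact abs_real_inner_le_norm _ _
  have hint' := hint.indicator (measurableSet_le measurable_snd measurable_fst :
    MeasurableSet {q : ℝ × ℝ | q.2 ≤ q.1})
  have hsw := integral_integral_swap (f := fun t s =>
    ({q : ℝ × ℝ | q.2 ≤ q.1}.indicator (fun q : ℝ × ℝ => inner ℝ (F q.2) (G q.1))) (t, s)) hint'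
  have e1 : ∀ t ∈ Ioc 0 τ, ∫ s in Ioc 0 τ,
      ({q : ℝ × ℝ | q.2 ≤ q.1}.indicator (fun q : ℝ × ℝ => inner ℝ (F q.2) (G q.1))) (t, s)
      = inner ℝ (∫ s in Ioc 0 t, F s) (G t) := by
    intro t ht
    rw [inner_setIntegral (hF.mono_set (Ioc_subset_Ioc_right ht.2))]
    have : (fun s => ({q : ℝ × ℝ | q.2 ≤ q.1}.indicator
        (fun q : ℝ × ℝ => inner ℝ (F q.2) (G q.1))) (t, s))
        = (Iic t).indicator fun s => inner ℝ (F s) (G t) := by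
      ext s; simp [indicator]
    rw [this, setIntegral_indicator measurableSet_Iic, Ioc_inter_Iic, min_eq_right ht.2]
  have e2 : ∀ s ∈ Ioc 0 τ, ∫ t in Ioc 0 τ,
      ({q : ℝ × ℝ | q.2 ≤ q.1}.indicator (fun q : ℝ × ℝ => inner ℝ (F q.2) (G q.1))) (t, s)
      = inner ℝ (F s) (∫ t in Ioc s τ, G t) := by
    intro s hs
    rw [← integral_inner (hG.mono_set (Ioc_subset_Ioc_left hs.1.le))]
    have : (fun t => ({q : ℝ × ℝ | q.2 ≤ q.1}.indicator
        (fun q : ℝ × ℝ => inner ℝ (F q.2) (G q.1))) (t, s))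
        = (Ici s).indicator fun t => inner ℝ (F s) (G t) := by
      ext t; simp [indicator]
    rw [this, setIntegral_indicator measurableSet_Ici]
    have : Ioc 0 τ ∩ Ici s = Icc s τ := by
      ext t
      simp only [mem_inter_iff, mem_Ioc, mem_Ici, mem_Icc]
      exact ⟨fun h => ⟨h.2, h.1.2⟩, fun h => ⟨⟨hs.1.trans_le h.1, h.2⟩, h.1⟩⟩
    rw [this, integral_Icc_eq_integral_Ioc]
  rw [← setIntegral_congr_fun measurableSet_Ioc e1, ← setIntegral_congr_fun measurableSet_Ioc e2]
  exact hsw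

/-- The energy identity for a primitive. -/
lemma norm_sq_primitive {τ : ℝ} {F : ℝ → Y} (hF : IntegrableOn F (Ioc 0 τ)) :
    ‖∫ t in Ioc 0 τ, F t‖ ^ 2 = 2 * ∫ t in Ioc 0 τ, inner ℝ (∫ s in Ioc 0 t, F s) (F t) := by
  have h1 := integral_inner_primitive hF hF
  have h2 : ∀ s ∈ Ioc 0 τ, inner ℝ (F s) (∫ t in Ioc s τ, F t)
      = inner ℝ (∫ t in Ioc 0 τ, F t) (F s) - inner ℝ (∫ t in Ioc 0 s, F t) (F s) := by
    intro s hs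
    rw [← inner_sub_left, real_inner_comm]
    congr 1
    have : Ioc 0 τ = Ioc 0 s ∪ Ioc s τ := (Ioc_union_Ioc_eq_Ioc hs.1.le hs.2).symm
    rw [this, setIntegral_union (Ioc_disjoint_Ioc_of_le le_rfl) measurableSet_Ioc
      (hF.mono_set (Ioc_subset_Ioc_right hs.2)) (hF.mono_set (Ioc_subset_Ioc_left hs.1.le))]
    abel
  have i1 : IntegrableOn (fun s => inner ℝ (∫ t in Ioc 0 τ, F t) (F s)) (Ioc 0 τ) :=
    hF.const_inner _
  have i2 := integrableOn_inner_primitive hF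
  rw [setIntegral_congr_fun measurableSet_Ioc h2, integral_sub i1 i2, integral_inner hF,
    real_inner_self_eq_norm_sq] at h1
  linarith

/-- A primitive `Z` of `F` for which `⟨Z, F⟩ ≤ C ‖Z‖²` vanishes, by Grönwall's inequality
for `‖Z‖²`. -/
lemma primitive_eq_zero {τ C : ℝ} {F : ℝ → Y} (hF : IntegrableOn F (Ioc 0 τ))
    (h : ∀ᵐ t ∂timeMeasure τ, inner ℝ (∫ s in Ioc 0 t, F s) (F t)
      ≤ C * ‖∫ s in Ioc 0 t, F s‖ ^ 2) :
    ∀ t ∈ Icc 0 τ, ∫ s in Ioc 0 t, F s = 0 := by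
  obtain ⟨Z, hZ, hFZ⟩ := continuous_primitive_Ioc hF
  have hZ2 : Continuous fun t => ‖Z t‖ ^ 2 := by fun_prop
  have hle : ∀ t ∈ Icc 0 τ, ‖Z t‖ ^ 2 ≤ 2 * C * ∫ s in (0 : ℝ)..t, ‖Z s‖ ^ 2 := by
    intro t ht
    rw [← hFZ t ht, norm_sq_primitive (hF.mono_set (Ioc_subset_Ioc_right ht.2)), mul_assoc,
      intervalIntegral.integral_of_le ht.1, ← integral_const_mul C]
    refine mul_le_mul_of_nonneg_left ?_ (by norm_num : (0 : ℝ) ≤ 2)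
    refine integral_mono_ae
      (integrableOn_inner_primitive (hF.mono_set (Ioc_subset_Ioc_right ht.2)))
      (hZ2.integrableOn_Ioc.const_mul C) ?_
    filter_upwards [ae_restrict_of_ae_restrict_of_subset (Ioc_subset_Ioc_right ht.2) h,
      ae_restrict_mem measurableSet_Ioc] with s hs hst
    rw [← hFZ s ⟨hst.1.le, hst.2.trans ht.2⟩]
    exact hs
  have hP : ∀ t, HasDerivAt (fun t => ∫ s in (0 : ℝ)..t, ‖Z s‖ ^ 2) (‖Z t‖ ^ 2) t := fun t =>
    intervalIntegral.integral_hasDerivAt_right (hZ2.intervalIntegrable _ _)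
      (hZ2.stronglyMeasurableAtFilter _ _) hZ2.continuousAt
  have h0 := norm_le_gronwallBound_of_norm_deriv_right_le (δ := 0) (K := 2 * C) (ε := 0)
    (a := 0) (b := τ) (continuous_iff_continuousAt.2 fun t => (hP t).continuousAt).continuousOn
    (fun t _ => (hP t).hasDerivWithinAt) (by simp) (fun t (ht : t ∈ Ico 0 τ) => by
      have h1 : 0 ≤ ∫ s in (0 : ℝ)..t, ‖Z s‖ ^ 2 :=
        intervalIntegral.integral_nonneg ht.1 fun s _ => sq_nonneg ‖Z s‖
      rw [Real.norm_of_nonneg (sq_nonneg _), Real.norm_of_nonneg h1, add_zero]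
      exact hle t ⟨ht.1, ht.2.le⟩)
  intro t ht
  have h1 := h0 t ht
  rw [gronwallBound_ε0_δ0] at h1
  have h2 := hle t ht
  rw [norm_le_zero_iff.1 h1, mul_zero] at h2
  rw [hFZ t ht]
  exact norm_eq_zero.1 (pow_eq_zero_iff two_ne_zero |>.1 (le_antisymm h2 (sq_nonneg _)))

/-- Integration by parts against a `C¹` function that vanishes at the final time. -/
lemma integral_by_parts {τ : ℝ} (hτ : 0 ≤ τ) {z F : ℝ → Y} {z₀ : Y} (hF : IntegrableOn F (Ioc 0 τ))
    (hz : ∀ᵐ t ∂timeMeasure τ, z t = z₀ - ∫ s in Ioc 0 t, F s) {Ψ Ψ' : ℝ → Y}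
    (hΨ : ∀ t, HasDerivAt Ψ (Ψ' t) t) (hc : Continuous Ψ') (hτΨ : Ψ τ = 0) :
    IntegrableOn (fun t => inner ℝ (F t) (Ψ t)) (Ioc 0 τ) ∧
    IntegrableOn (fun t => inner ℝ (z t) (Ψ' t)) (Ioc 0 τ) ∧
    ∫ t in Ioc 0 τ, (inner ℝ (F t) (Ψ t) - inner ℝ (z t) (Ψ' t)) = inner ℝ z₀ (Ψ 0) := by
  obtain ⟨Z, hZ, hFZ⟩ := continuous_primitive_Ioc hF
  have hΨc : Continuous Ψ := continuous_iff_continuousAt.2 fun t => (hΨ t).continuousAt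
  have hprim : ∀ s ≤ τ, ∫ t in Ioc s τ, Ψ' t = - Ψ s := by
    intro s hs
    rw [← intervalIntegral.integral_of_le hs, intervalIntegral.integral_eq_sub_of_hasDerivAt
      (fun t _ => hΨ t) (hc.intervalIntegrable _ _), hτΨ, zero_sub]
  have hz' : (fun t => inner ℝ (z t) (Ψ' t)) =ᵐ[timeMeasure τ]
      fun t => inner ℝ z₀ (Ψ' t) - inner ℝ (∫ s in Ioc 0 t, F s) (Ψ' t) := by
    filter_upwards [hz] with t ht
    rw [ht, inner_sub_left]
  have i0 : IntegrableOn (fun t => inner ℝ z₀ (Ψ' t)) (Ioc 0 τ) :=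
    (continuous_const.inner hc).integrableOn_Ioc
  have i1 : IntegrableOn (fun t => inner ℝ (∫ s in Ioc 0 t, F s) (Ψ' t)) (Ioc 0 τ) := by
    refine (hZ.inner hc).integrableOn_Ioc.congr_fun (fun s hs => ?_) measurableSet_Ioc
    simp only [hFZ s ⟨hs.1.le, hs.2⟩]
  have i2 : IntegrableOn (fun t => inner ℝ (F t) (Ψ t)) (Ioc 0 τ) := by
    obtain ⟨C, hC⟩ := (isCompact_Icc (a := (0 : ℝ)) (b := τ)).exists_bound_of_continuousOn
      hΨc.continuousOn
    refine (hF.norm.mul_const C).mono' (hF.aestronglyMeasurable.inner hΨc.aestronglyMeasurable) ?_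
    filter_upwards [ae_restrict_mem measurableSet_Ioc] with t ht
    exact (norm_inner_le_norm _ _).trans
      (mul_le_mul_of_nonneg_left (hC t ⟨ht.1.le, ht.2⟩) (norm_nonneg _))
  have i3 : IntegrableOn (fun t => inner ℝ (z t) (Ψ' t)) (Ioc 0 τ) := (i0.sub i1).congr hz'.symm
  refine ⟨i2, i3, ?_⟩
  rw [integral_sub i2 i3, integral_congr_ae hz', integral_sub i0 i1,
    integral_inner_primitive hF hc.integrableOn_Ioc, integral_inner hc.integrableOn_Ioc,
    hprim 0 hτ, setIntegral_congr_fun measurableSet_Ioc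
      (fun s hs => by simp only [hprim s hs.2, inner_neg_right] :
        EqOn (fun s => inner ℝ (F s) (∫ t in Ioc s τ, Ψ' t)) (fun s => - inner ℝ (F s) (Ψ s)) _),
    integral_neg, inner_neg_right]
  ring

/-- A function that satisfies `z' + F = 0`, `z(0) = z₀` in the sense of distributions on
`[0, τ[` is a primitive. -/
lemma eq_primitive_of_weak {τ : ℝ} (hτ : 0 ≤ τ) {z F : ℝ → Y} {z₀ : Y}
    (hz : IntegrableOn z (Ioc 0 τ)) (hF : IntegrableOn F (Ioc 0 τ))
    (h : ∀ η : ℝ → ℝ, ContDiff ℝ ∞ η → HasCompactSupport η → tsupport η ⊆ Iio τ →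
      ∫ t in Ioc 0 τ, (η t • F t - deriv η t • z t) = η 0 • z₀) :
    ∀ᵐ t ∂timeMeasure τ, z t = z₀ - ∫ s in Ioc 0 t, F s := by
  set y : ℝ → Y := fun t => z₀ - ∫ s in Ioc 0 t, F s with hy
  obtain ⟨Z, hZ, hFZ⟩ := continuous_primitive_Ioc hF
  have hyi : IntegrableOn y (Ioc 0 τ) := by
    refine (continuous_const.sub hZ : Continuous fun t => z₀ - Z t).integrableOn_Ioc.congr_fun
      (fun s hs => ?_) measurableSet_Ioc
    simp only [hy, hFZ s ⟨hs.1.le, hs.2⟩, Pi.sub_apply]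
  have hbd : ∀ {η : ℝ → ℝ} {f : ℝ → Y}, Continuous η → IntegrableOn f (Ioc 0 τ) →
      IntegrableOn (fun t => η t • f t) (Ioc 0 τ) := fun hη hf =>
    memLp_one_iff_integrable.1 (memLp_continuous_smul hη (memLp_one_iff_integrable.2 hf))
  have key : ∀ η : ℝ → ℝ, ContDiff ℝ ∞ η → HasCompactSupport η → tsupport η ⊆ Iio τ →
      ∫ t in Ioc 0 τ, deriv η t • (z t - y t) = 0 := by
    intro η hη hc hs
    have hd : Continuous (deriv η) := hη.continuous_deriv (by simp)
    have hητ : η τ = 0 := by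
      by_contra h0
      exact lt_irrefl τ (hs (subset_tsupport η h0))
    have iF := hbd hη.continuous hF
    have iy := hbd hd hyi
    have iz := hbd hd hz
    have h2 : ∫ t in Ioc 0 τ, (η t • F t - deriv η t • y t) = η 0 • z₀ := by
      refine ext_inner_right ℝ fun f => ?_
      have h3 := (integral_by_parts hτ hF (ae_of_all _ fun t => rfl : ∀ᵐ t ∂timeMeasure τ, y t = _)
        (Ψ := fun t => η t • f) (Ψ' := fun t => deriv η t • f)
        (fun t => ((hη.differentiable (by simp)) t).hasDerivAt.smul_const f)
        (hd.smul continuous_const) (by rw [hητ, zero_smul])).2.2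
      have iFy : IntegrableOn (fun t => η t • F t - deriv η t • y t) (Ioc 0 τ) := iF.sub iy
      rw [inner_setIntegral iFy, real_inner_smul_left, ← real_inner_smul_right, ← h3]
      refine integral_congr_ae (ae_of_all _ fun t => ?_)
      simp only [inner_sub_left, real_inner_smul_left, real_inner_smul_right]
    have h1 := h η hη hc hs
    rw [← h2, integral_sub iF iz, integral_sub iF iy] at h1
    simp only [smul_sub]
    rw [integral_sub iz iy]
    have := sub_right_inj.1 h1
    rw [this, sub_self]
  have hzero : ∀ᵐ t, t ∈ Ioo 0 τ → (z - y) t = 0 := by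
    refine isOpen_Ioo.ae_eq_zero_of_integral_contDiff_smul_eq_zero
      ((hz.sub hyi).mono_set Ioo_subset_Ioc_self).locallyIntegrableOn fun χ hχ hχc hχs => ?_
    have hτχ : ∀ᶠ t in 𝓝 τ, χ t = 0 := by
      have : (tsupport χ)ᶜ ∈ 𝓝 τ := (isClosed_tsupport χ).isOpen_compl.mem_nhds fun h0 =>
        lt_irrefl τ (hχs h0).2
      filter_upwards [this] with t ht using image_eq_zero_of_notMem_tsupport ht
    obtain ⟨ε, hε, hball⟩ := Metric.eventually_nhds_iff.1 hτχ
    have hχ0 : ∀ t, τ - ε < t → χ t = 0 := fun t ht => by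
      rcases lt_or_ge t (τ + ε) with h1 | h1
      · refine hball ?_
        rw [Real.dist_eq, abs_lt]
        constructor <;> linarith
      · by_contra h0
        linarith [(hχs (subset_tsupport χ h0)).2]
    have hci : ∀ a b, IntervalIntegrable χ volume a b := fun a b =>
      hχ.continuous.intervalIntegrable a b
    set X : ℝ → ℝ := fun t => ∫ s in τ..t, χ s with hX
    have hXd : ∀ t, HasDerivAt X (χ t) t := fun t =>
      intervalIntegral.integral_hasDerivAt_right (hci _ _)
        (hχ.continuous.stronglyMeasurableAtFilter _ _) hχ.continuous.continuousAt
    have hXs : ContDiff ℝ ∞ X := by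
      rw [contDiff_infty_iff_deriv]
      refine ⟨fun t => (hXd t).differentiableAt, ?_⟩
      rwa [funext fun t => (hXd t).deriv]
    have hX0 : ∀ t, τ - ε < t → X t = 0 := fun t ht => by
      refine intervalIntegral.integral_zero_ae (ae_of_all _ fun s hs => hχ0 s ?_)
      have := hs.1
      rcases le_total τ t with h1 | h1
      · rw [min_eq_left h1] at this; linarith
      · rw [min_eq_right h1] at this; linarith
    -- `η` is the primitive of `χ` that vanishes at `τ`, cut off at negative times
    set η : ℝ → ℝ := fun t => Real.smoothTransition (t + 1) * X t with hη
    have hηs : ContDiff ℝ ∞ η :=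
      (Real.smoothTransition.contDiff.comp (contDiff_id.add contDiff_const)).mul hXs
    have hsub : tsupport η ⊆ Icc (-1) (τ - ε) := by
      refine closure_minimal (fun t ht => ?_) isClosed_Icc
      by_contra h0
      refine ht ?_
      rw [mem_Icc, not_and_or, not_le, not_le] at h0
      rcases h0 with h1 | h1
      · simp only [hη]
        rw [Real.smoothTransition.zero_of_nonpos (by linarith), zero_mul]
      · simp only [hη, hX0 t h1, mul_zero]
    have h1 := key η hηs (isCompact_Icc.of_isClosed_subset (isClosed_tsupport η) hsub)
      (hsub.trans fun t ht => by have := ht.2; simp only [mem_Iio]; linarith)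
    have hηd : ∀ t ∈ Ioc 0 τ, deriv η t = χ t := by
      intro t ht
      have : η =ᶠ[𝓝 t] X := by
        filter_upwards [lt_mem_nhds ht.1] with s hs
        simp only [hη]
        rw [Real.smoothTransition.one_of_one_le (by linarith), one_mul]
      rw [this.deriv_eq, (hXd t).deriv]
    rw [setIntegral_congr_fun measurableSet_Ioc (fun t ht => by simp only [hηd t ht, Pi.sub_apply] :
      EqOn (fun t => deriv η t • (z t - y t)) (fun t => χ t • (z - y) t) _)] at h1
    rw [← h1]
    symm
    refine setIntegral_eq_integral_of_forall_compl_eq_zero fun t ht => ?_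
    have : χ t = 0 := by
      by_contra h0
      exact ht (Ioo_subset_Ioc_self (hχs (subset_tsupport χ h0)))
    rw [this, zero_smul]
  rw [ae_restrict_iff' measurableSet_Ioc]
  filter_upwards [hzero,
    (compl_mem_ae_iff.2 (measure_singleton τ) : ({τ} : Set ℝ)ᶜ ∈ ae volume)] with t ht hne h2
  exact sub_eq_zero.1 (ht ⟨h2.1, lt_of_le_of_ne h2.2 hne⟩)

end Primitive

/-! ### Test functions of time and space as `C¹` functions of time -/

namespace Test

/-- Dominated convergence for test functions in `L²`. -/
lemma tendsto_toL2 {ι : Type*} {l : Filter ι} [l.IsCountablyGenerated] {w : ι → Test} {w₀ : Test}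
    {B : ℝ} {S : Set (ℝ × ℝ)} (hS : IsCompact S)
    (hB : ∀ᶠ i in l, ∀ p, |(w i).fn p - w₀.fn p| ≤ S.indicator (fun _ => B) p)
    (hlim : ∀ p, Tendsto (fun i => (w i).fn p) l (𝓝 (w₀.fn p))) :
    Tendsto (fun i => toL2 (w i)) l (𝓝 (toL2 w₀)) := by
  rw [tendsto_iff_norm_sub_tendsto_zero]
  have hsq : ∀ i, ‖toL2 (w i) - toL2 w₀‖ ^ 2 = ∫ p, ((w i).fn p - w₀.fn p) ^ 2 := fun i => by
    rw [← map_sub, ← real_inner_self_eq_norm_sq, inner_toL2_toL2]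
    congr 1; ext p
    rw [sub_fn, Pi.sub_apply, sq]
  have h : Tendsto (fun i => ‖toL2 (w i) - toL2 w₀‖ ^ 2) l (𝓝 0) := by
    simp only [hsq]
    rw [← integral_zero (ℝ × ℝ) ℝ]
    refine tendsto_integral_filter_of_dominated_convergence (S.indicator fun _ => B ^ 2)
      (Eventually.of_forall fun i =>
        (((w i).continuous.sub w₀.continuous).pow 2).aestronglyMeasurable) ?_ ?_ ?_
    · filter_upwards [hB] with i hi
      refine ae_of_all _ fun p => ?_
      have := hi p
      rw [Real.norm_of_nonneg (sq_nonneg _), ← sq_abs]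
      by_cases hp : p ∈ S
      · rw [indicator_of_mem hp] at this ⊢
        gcongr
      · rw [indicator_of_notMem hp] at this ⊢
        rw [le_antisymm this (abs_nonneg _)]; norm_num
    · exact (integrable_indicator_iff hS.measurableSet).2
        (integrableOn_const hS.measure_lt_top.ne)
    · refine ae_of_all _ fun p => ?_
      have := ((hlim p).sub_const (w₀.fn p)).pow 2
      simpa using this
  have := h.sqrt
  simpa [Real.sqrt_sq (norm_nonneg _)] using this

end Test

/-- Smooth functions of time and space with compact support. -/
structure IsSpaceTimeTest (φ : ℝ × (ℝ × ℝ) → ℝ) : Prop where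
  contDiff : ContDiff ℝ ∞ φ
  hasCompactSupport : HasCompactSupport φ

namespace IsSpaceTimeTest

variable {φ : ℝ × (ℝ × ℝ) → ℝ}

lemma eq_zero_of_notMem {t : ℝ} {p : ℝ × ℝ} (hp : p ∉ Prod.snd '' tsupport φ) : φ (t, p) = 0 := by
  by_contra h0
  exact hp ⟨_, subset_tsupport φ h0, rfl⟩

lemma isCompact_image (h : IsSpaceTimeTest φ) : IsCompact (Prod.snd '' tsupport φ) :=
  h.hasCompactSupport.isCompact.image continuous_snd

/-- The test function `φ(t, ·)` on the plane. -/
def slice (h : IsSpaceTimeTest φ) (t : ℝ) : Test :=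
  Test.mk (fun p => φ (t, p)) (h.contDiff.comp (contDiff_const.prodMk contDiff_id))
    (HasCompactSupport.intro h.isCompact_image fun _ hp => eq_zero_of_notMem hp)

lemma hasDerivAt (h : IsSpaceTimeTest φ) (t : ℝ) (p : ℝ × ℝ) :
    HasDerivAt (fun s => φ (s, p)) (fderiv ℝ φ (t, p) (1, 0)) t := by
  have h1 : HasDerivAt (fun s : ℝ => (s, p)) ((1 : ℝ), (0 : ℝ × ℝ)) t :=
    (hasDerivAt_id t).prodMk (hasDerivAt_const t p)
  exact ((h.contDiff.differentiable (by simp)) (t, p)).hasFDerivAt.comp_hasDerivAt t h1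

/-- The time derivative of a test function. -/
lemma timeDeriv (h : IsSpaceTimeTest φ) :
    IsSpaceTimeTest fun q => deriv (fun s => φ (s, q.2)) q.1 := by
  have e : (fun q : ℝ × (ℝ × ℝ) => deriv (fun s => φ (s, q.2)) q.1)
      = fun q => fderiv ℝ φ q (1, 0) := by
    ext q; exact (h.hasDerivAt q.1 q.2).deriv
  rw [e]
  exact ⟨(h.contDiff.fderiv_right (m := ∞) (by simp)).clm_apply contDiff_const,
    h.hasCompactSupport.fderiv_apply (𝕜 := ℝ) (1, 0)⟩

lemma smooth_mul (h : IsSpaceTimeTest φ) (m : Smooth) : IsSpaceTimeTest fun q => m.1 q.2 * φ q :=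
  ⟨(m.contDiff.comp contDiff_snd).mul h.contDiff, h.hasCompactSupport.mul_left⟩

lemma continuous_toL2_slice (h : IsSpaceTimeTest φ) :
    Continuous fun t => Test.toL2 (h.slice t) := by
  obtain ⟨M, hM⟩ := h.hasCompactSupport.exists_bound_of_continuous h.contDiff.continuous
  refine continuous_iff_continuousAt.2 fun t => ?_
  refine Test.tendsto_toL2 (B := M + M) h.isCompact_image (Eventually.of_forall fun s p => ?_)
    fun p => ?_
  · change |φ (s, p) - φ (t, p)| ≤ _
    by_cases hp : p ∈ Prod.snd '' tsupport φ
    · rw [indicator_of_mem hp]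
      exact (abs_sub _ _).trans (add_le_add (hM _) (hM _))
    · rw [indicator_of_notMem hp, eq_zero_of_notMem hp, eq_zero_of_notMem hp]; simp
  · exact (h.hasDerivAt t p).continuousAt

lemma hasDerivAt_toL2_slice (h : IsSpaceTimeTest φ) (t : ℝ) :
    HasDerivAt (fun t => Test.toL2 (h.slice t)) (Test.toL2 (h.timeDeriv.slice t)) t := by
  obtain ⟨L, hL⟩ := (h.contDiff.of_le (by exact WithTop.coe_le_coe.2 le_top) :
    ContDiff ℝ 1 φ).lipschitzWith_of_hasCompactSupport h.hasCompactSupport (by simp)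
  have hd : ∀ p, |deriv (fun s => φ (s, p)) t| ≤ L := fun p => by
    have h1 : LipschitzWith L fun s => φ (s, p) := by
      simpa [Function.comp_def] using hL.comp (LipschitzWith.prodMk_right p)
    simpa using norm_deriv_le_of_lipschitz h1 (x₀ := t)
  rw [hasDerivAt_iff_tendsto_slope]
  have e : slope (fun t => Test.toL2 (h.slice t)) t
      = fun s => Test.toL2 ((s - t)⁻¹ • (h.slice s - h.slice t)) := by
    ext1 s
    rw [slope_def_module, Test.toL2.map_smul, map_sub]
  rw [e]
  refine Test.tendsto_toL2 (B := L + L) h.isCompact_image ?_ fun p => ?_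
  · filter_upwards [self_mem_nhdsWithin] with s hs p
    change |(s - t)⁻¹ * (φ (s, p) - φ (t, p)) - deriv (fun s => φ (s, p)) t| ≤ _
    by_cases hp : p ∈ Prod.snd '' tsupport φ
    · rw [indicator_of_mem hp]
      refine (abs_sub _ _).trans (add_le_add ?_ (hd p))
      have h1 := hL.dist_le_mul (s, p) (t, p)
      have h2 : dist (s, p) (t, p) = |s - t| := by
        rw [Prod.dist_eq, dist_self, max_eq_left dist_nonneg, Real.dist_eq]
      rw [h2, Real.dist_eq] at h1
      have h3 : 0 < |s - t| := abs_pos.2 (sub_ne_zero.2 hs)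
      rw [abs_mul, abs_inv, inv_mul_le_iff₀ h3, mul_comm]
      exact h1
    · have : (fun s => φ (s, p)) = fun _ => 0 := funext fun s => eq_zero_of_notMem hp
      rw [indicator_of_notMem hp, eq_zero_of_notMem hp, eq_zero_of_notMem hp, this]
      simp
  · have h1 := (h.hasDerivAt t p)
    have h2 := h1.deriv ▸ hasDerivAt_iff_tendsto_slope.1 h1
    refine h2.congr fun s => ?_
    rw [slope_def_module]
    rfl

end IsSpaceTimeTest

/-! ### The operators and weak derivatives -/

lemma hasWeakDeriv_of_inner {a b : ℕ} {f h : L2}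
    (H : ∀ ψ : Test, inner ℝ f (Test.toL2 (Test.dd a b ψ))
      = (-1) ^ (a + b) * inner ℝ h (Test.toL2 ψ)) : HasWeakDeriv a b f h where
  locallyIntegrable_left := (Lp.memLp f).locallyIntegrable (by norm_num)
  locallyIntegrable_right := (Lp.memLp h).locallyIntegrable (by norm_num)
  integral_eq φ hφ hc := by
    have h1 := H (Test.mk φ hφ hc)
    rw [Test.inner_toL2, Test.inner_toL2] at h1
    rw [Test.dd_fn] at h1
    exact h1

namespace H4

/-- The operator `∂_x (J ·)` from `H⁴` to `L²`. -/
def opX (δ : ℝ) : H4 →L[ℝ] L2 := mulOp (wt δ).1 ∘L D10 + mulOp (dx (wt δ)).1 ∘L incl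

/-- The operator `∂_y² (J ·)` from `H⁴` to `L²`. -/
def opYY (δ : ℝ) : H4 →L[ℝ] L2 :=
  mulOp (wt δ).1 ∘L D02 + mulOp (2 * dy (wt δ)).1 ∘L D01 + mulOp (dy (dy (wt δ))).1 ∘L incl

variable {δ : ℝ}

lemma isMultiplier_weight (δ : ℝ) : IsMultiplier (weight δ) 1 :=
  .of_continuous (wt δ).continuous (abs_weight_le δ)

lemma exists_isMultiplier_deriv (hδ : δ ∈ Icc (0 : ℝ) 1) : ∃ C, IsMultiplier (dx (wt δ)).1 C ∧
    IsMultiplier (2 * dy (wt δ)).1 C ∧ IsMultiplier (dy (dy (wt δ))).1 C := by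
  obtain ⟨C, hC, hb⟩ := exists_weight_bound
  have h1 : ∀ p, |(dx (wt δ)).1 p| ≤ C := fun p => by
    rw [← dd_one_zero]; exact (hb δ hδ 1 0 (by norm_num) p).1
  have h2 : ∀ p, |(dy (wt δ)).1 p| ≤ C := fun p => by
    rw [← dd_zero_one]; exact (hb δ hδ 0 1 (by norm_num) p).1
  have h3 : ∀ p, |(dy (dy (wt δ))).1 p| ≤ C := fun p => by
    rw [← dd_zero_one (wt δ), dy_dd]; exact (hb δ hδ 0 2 (by norm_num) p).1
  refine ⟨2 * C, .of_continuous (dx (wt δ)).continuous fun p => (h1 p).trans (by linarith),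
    .of_continuous (2 * dy (wt δ)).continuous fun p => ?_,
    .of_continuous (dy (dy (wt δ))).continuous fun p => (h3 p).trans (by linarith)⟩
  change |2 * (dy (wt δ)).1 p| ≤ _
  rw [abs_mul, abs_two]
  linarith [h2 p]

lemma hasWeakDeriv_of_toH4 {a b : ℕ} {G : H4 →L[ℝ] L2}
    (hG : ∀ w : Test, G (Test.toH4 w) = Test.toL2 (Test.dd a b (wt δ • w))) (v : H4) :
    HasWeakDeriv a b (fun q => weight δ q * v.fn q) (G v) := by
  refine (hasWeakDeriv_of_inner (f := mulOp (weight δ) (incl v)) (h := G v) fun ψ => ?_).congr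
    ((isMultiplier_weight δ).coeFn_mulOp (incl v)) (EventuallyEq.refl _ _)
  have hc1 : Continuous fun v => inner ℝ (mulOp (weight δ) (incl v)) (Test.toL2 (Test.dd a b ψ)) :=
    ((mulOp (weight δ)).continuous.comp incl.continuous).inner continuous_const
  have hc2 : Continuous fun v => (-1) ^ (a + b) * inner ℝ (G v) (Test.toL2 ψ) :=
    continuous_const.mul (G.continuous.inner continuous_const)
  refine congrFun (Test.denseRange_toH4.equalizer hc1 hc2 (funext fun w => ?_)) v
  simp only [Function.comp_apply]
  have e : mulOp (weight δ) (Test.toL2 w) = Test.toL2 (wt δ • w) :=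
    (isMultiplier_weight δ).mulOp_toL2 (m := wt δ) w
  rw [hG, Test.incl_toH4, e, Test.inner_dd_right]

lemma hasWeakDeriv_opX (hδ : δ ∈ Icc (0 : ℝ) 1) (v : H4) :
    HasWeakDeriv 1 0 (fun q => weight δ q * v.fn q) (opX δ v) := by
  obtain ⟨C, h1, -, -⟩ := exists_isMultiplier_deriv hδ
  refine hasWeakDeriv_of_toH4 (fun w => ?_) v
  have h0 : IsMultiplier (wt δ).1 1 := isMultiplier_weight δ
  simp only [opX, _root_.add_apply, ContinuousLinearMap.comp_apply]
  rw [D10_toH4, Test.incl_toH4, h0.mulOp_toL2, h1.mulOp_toL2, ← map_add, Test.dx_smul, add_comm]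

lemma hasWeakDeriv_opYY (hδ : δ ∈ Icc (0 : ℝ) 1) (v : H4) :
    HasWeakDeriv 0 2 (fun q => weight δ q * v.fn q) (opYY δ v) := by
  obtain ⟨C, -, h1, h2⟩ := exists_isMultiplier_deriv hδ
  refine hasWeakDeriv_of_toH4 (fun w => ?_) v
  have h0 : IsMultiplier (wt δ).1 1 := isMultiplier_weight δ
  simp only [opYY, _root_.add_apply, ContinuousLinearMap.comp_apply]
  rw [D02_toH4, D01_toH4, Test.incl_toH4, h0.mulOp_toL2, h1.mulOp_toL2, h2.mulOp_toL2, ← map_add,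
    ← map_add]
  congr 1
  have e : Test.dd 0 2 (wt δ • w) = Test.dd 0 1 (Test.dd 0 1 (wt δ • w)) := by rw [Test.dd_add]
  rw [e, Test.dy_smul, map_add, Test.dy_smul, Test.dy_smul, Test.dd_add]
  ext p
  simp only [Test.add_fn, Test.smooth_smul_fn, Pi.add_apply, Pi.mul_apply]
  change _ + 2 * (dy (wt δ)).1 p * _ + _ = _
  ring

/-- The pointwise form of `opL`. -/
lemma coeFn_opL (hδ : δ ∈ Icc (0 : ℝ) 1) (g v : H4) :
    (opL (wt 1) δ g v : ℝ × ℝ → ℝ) =ᵐ[volume] fun p => weight 1 p *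
      (weight δ p * p.2 * weakDeriv 1 0 (fun q => weight δ q * v.fn q) p
        - weight δ p * (1 + g.fn p) ^ 2 * weakDeriv 0 2 (fun q => weight δ q * v.fn q) p) := by
  obtain ⟨C, -, hb⟩ := exists_coefficient_bound
  obtain ⟨a1, a2, a3, a4, -⟩ := hb _ _ (isAdmissible_wt hδ)
  have a0 : IsMultiplier (wt 1 * mu δ).1 1 :=
    .of_continuous (wt 1 * mu δ).continuous (abs_wt_mul_mu_le δ)
  obtain ⟨C', b1, b2, b3⟩ := exists_isMultiplier_deriv hδ
  have b0 : IsMultiplier (wt δ).1 1 := isMultiplier_weight δ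
  have eL : opL (wt 1) δ g v = opR (wt 1) δ v - coefOp g (opQ (wt 1) δ v) := rfl
  have eR : opR (wt 1) δ v = mulOp (wt 1 * mu δ).1 (D10 v)
      + (1 / 2 : ℝ) • mulOp (wt 1 * dx (mu δ)).1 (incl v) := rfl
  have eQ : opQ (wt 1) δ v = mulOp (wt 1 * (wt δ * wt δ)).1 (D02 v)
      + mulOp (wt 1 * (2 * wt δ * dy (wt δ))).1 (D01 v)
      + mulOp (wt 1 * (wt δ * dy (dy (wt δ)))).1 (incl v) := rfl
  have eX : opX δ v = mulOp (wt δ).1 (D10 v) + mulOp (dx (wt δ)).1 (incl v) := rfl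
  have eY : opYY δ v = mulOp (wt δ).1 (D02 v) + mulOp (2 * dy (wt δ)).1 (D01 v)
      + mulOp (dy (dy (wt δ))).1 (incl v) := rfl
  have hR : (opR (wt 1) δ v : ℝ × ℝ → ℝ) =ᵐ[volume]
      fun p => weight 1 p *
        (weight δ p * p.2 * weakDeriv 1 0 (fun q => weight δ q * v.fn q) p) := by
    have hX : (opX δ v : ℝ × ℝ → ℝ) =ᵐ[volume] _ := eX ▸ Lp.coeFn_add _ _
    have hR' : (opR (wt 1) δ v : ℝ × ℝ → ℝ) =ᵐ[volume] _ := eR ▸ Lp.coeFn_add _ _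
    filter_upwards [(hasWeakDeriv_opX hδ v).weakDeriv_ae_eq, hX, hR',
      Lp.coeFn_smul (1 / 2 : ℝ) (mulOp (wt 1 * dx (mu δ)).1 (incl v)), a0.coeFn_mulOp (D10 v),
      a1.coeFn_mulOp (incl v), b0.coeFn_mulOp (D10 v), b1.coeFn_mulOp (incl v)]
      with p h1 h2 h3 h4 h5 h6 h7 h8
    rw [h1, h2, h3, Pi.add_apply, Pi.add_apply, h4, Pi.smul_apply, h5, h6, h7, h8, dx_mu, dx_wt]
    change weight 1 p * (weight δ p * weight δ p * p.2) * _
      + (1 / 2 : ℝ) * (weight 1 p * -(2 * (δ * p.1 * weight δ p) * (δ * p.2 * weight δ p)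
        * weight δ p ^ 2) * _)
      = weight 1 p * (weight δ p * p.2 * (weight δ p * _ +
        -(δ * (δ * p.1 * weight δ p) * weight δ p ^ 2) * _))
    ring
  have hQ : (opQ (wt 1) δ v : ℝ × ℝ → ℝ) =ᵐ[volume]
      fun p => weight 1 p * (weight δ p * weakDeriv 0 2 (fun q => weight δ q * v.fn q) p) := by
    have hX : (opYY δ v : ℝ × ℝ → ℝ) =ᵐ[volume] _ := eY ▸ Lp.coeFn_add _ _
    have hR' : (opQ (wt 1) δ v : ℝ × ℝ → ℝ) =ᵐ[volume] _ := eQ ▸ Lp.coeFn_add _ _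
    filter_upwards [(hasWeakDeriv_opYY hδ v).weakDeriv_ae_eq, hX, hR',
      Lp.coeFn_add (mulOp (wt 1 * (wt δ * wt δ)).1 (D02 v))
        (mulOp (wt 1 * (2 * wt δ * dy (wt δ))).1 (D01 v)),
      Lp.coeFn_add (mulOp (wt δ).1 (D02 v)) (mulOp (2 * dy (wt δ)).1 (D01 v)),
      a2.coeFn_mulOp (D02 v), a3.coeFn_mulOp (D01 v), a4.coeFn_mulOp (incl v),
      b0.coeFn_mulOp (D02 v), b2.coeFn_mulOp (D01 v), b3.coeFn_mulOp (incl v)]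
      with p h1 h2 h3 h4 h5 h6 h7 h8 h9 h10 h11
    rw [h1, h2, h3, Pi.add_apply, Pi.add_apply, h4, h5, Pi.add_apply, Pi.add_apply, h6, h7, h8, h9,
      h10, h11]
    change weight 1 p * (weight δ p * weight δ p) * _
      + weight 1 p * (2 * weight δ p * (dy (wt δ)).1 p) * _
      + weight 1 p * (weight δ p * (dy (dy (wt δ))).1 p) * _
      = weight 1 p * (weight δ p * (weight δ p * _ + 2 * (dy (wt δ)).1 p * _ + _))
    ring
  rw [eL]
  filter_upwards [Lp.coeFn_sub (opR (wt 1) δ v) (coefOp g (opQ (wt 1) δ v)),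
    coeFn_coefOp g (opQ (wt 1) δ v), hR, hQ] with p h1 h2 h3 h4
  rw [h1, Pi.sub_apply, h2, h3, h4]
  ring

/-- The spatial integral in the weak formulation, for functions `χ = ∂_t φ` and `ψ = φ` of
space. -/
lemma integral_weak_form (hδ : δ ∈ Icc (0 : ℝ) 1) (g v : H4) (χ ψ : Test) :
    ∫ p : ℝ × ℝ, (-(v.fn p * χ.fn p)
        + (weight δ p * p.2 * weakDeriv 1 0 (fun q => weight δ q * v.fn q) p
          - weight δ p * (1 + g.fn p) ^ 2 * weakDeriv 0 2 (fun q => weight δ q * v.fn q) p)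
            * ψ.fn p)
      = inner ℝ (opL (wt 1) δ g v) (Test.toL2 (wtInv • ψ)) - inner ℝ (incl v) (Test.toL2 χ) := by
  have i1 : ∀ (f : L2) (w : Test), Integrable fun p => f p * w.fn p := fun f w =>
    integrable_mul_test ((Lp.memLp f).locallyIntegrable (by norm_num)) w.contDiff
      w.hasCompactSupport
  rw [Test.inner_toL2, Test.inner_toL2, ← integral_sub (i1 _ _) (i1 _ _)]
  refine integral_congr_ae ?_
  filter_upwards [coeFn_opL hδ g v] with p hp
  rw [hp, Test.smooth_smul_fn, Pi.mul_apply]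
  have h1 := wt_one_mul_wtInv p
  change _ = _ * (wtInv.1 p * ψ.fn p) - v.fn p * χ.fn p
  have : ∀ A : ℝ, weight 1 p * A * (wtInv.1 p * ψ.fn p) = A * ψ.fn p := fun A => by
    calc _ = weight 1 p * wtInv.1 p * (A * ψ.fn p) := by ring
      _ = _ := by rw [h1, one_mul]
  rw [this]
  ring

end H4

/-! ### Weak solutions and the integrated equation -/

/-- A measurable coefficient `g` with `‖g(t)‖ < 1/8` for almost all times. -/
structure IsCoefficient (T : ℝ) (g : ℝ → H4) : Prop where
  aestronglyMeasurable : AEStronglyMeasurable g (timeMeasure T)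
  norm_lt : ∀ᵐ t ∂timeMeasure T, ‖g t‖ < 1 / 8

/-- The integrated form of the modified problem, in `L²` and multiplied by `⟨(x, y)⟩⁻¹` so that all
terms are square integrable. -/
def IsMild (δ : ℝ) (g : ℝ → H4) (v₀ : H4) (v : ℝ → H4) (t : ℝ) : Prop :=
  mulOp (weight 1) (H4.incl (v t)) = mulOp (weight 1) (mulOp (weight δ) (H4.incl v₀))
    - ∫ s in Ioc 0 t, H4.opL (wt 1) δ (g s) (v s)

lemma H4.norm_opL_apply_le (ℓ : Smooth) (δ : ℝ) {g : H4} (hg : ‖g‖ ≤ 1 / 8) (u : H4) :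
    ‖H4.opL ℓ δ g u‖ ≤ (‖H4.opR ℓ δ‖ + 4 * ‖H4.opQ ℓ δ‖) * ‖u‖ := by
  have e : H4.opL ℓ δ g u = H4.opR ℓ δ u - H4.coefOp g (H4.opQ ℓ δ u) := rfl
  have h1 := (H4.opR ℓ δ).le_opNorm u
  have h2 := (H4.opQ ℓ δ).le_opNorm u
  have h3 := (H4.coefOp g).le_of_opNorm_le (H4.norm_coefOp_le hg) (H4.opQ ℓ δ u)
  rw [e]
  refine (norm_sub_le _ _).trans ?_
  linarith

namespace IsCoefficient

variable {T : ℝ} {g v : ℝ → H4}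

lemma mono {τ : ℝ} (hg : IsCoefficient T g) (h : τ ≤ T) : IsCoefficient τ g where
  aestronglyMeasurable := hg.1.mono_measure (Measure.restrict_mono (Ioc_subset_Ioc_right h) le_rfl)
  norm_lt := ae_restrict_of_ae_restrict_of_subset (Ioc_subset_Ioc_right h) hg.2

lemma aestronglyMeasurable_opL (hg : IsCoefficient T g) (ℓ : Smooth) (δ : ℝ)
    (hv : AEStronglyMeasurable v (timeMeasure T)) :
    AEStronglyMeasurable (fun t => H4.opL ℓ δ (g t) (v t)) (timeMeasure T) := by
  have hc : Continuous fun q : H4 × H4 => H4.opL ℓ δ q.1 q.2 :=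
    ((H4.continuous_opL ℓ δ).comp continuous_fst).clm_apply continuous_snd
  exact hc.comp_aestronglyMeasurable (f := fun t => (g t, v t)) (hg.1.prodMk hv)

lemma memLp_opL (hg : IsCoefficient T g) (ℓ : Smooth) (δ : ℝ) {p : ℝ≥0∞}
    (hv : MemLp v p (timeMeasure T)) :
    MemLp (fun t => H4.opL ℓ δ (g t) (v t)) p (timeMeasure T) := by
  refine hv.of_le_mul (c := ‖H4.opR ℓ δ‖ + 4 * ‖H4.opQ ℓ δ‖)
    (hg.aestronglyMeasurable_opL ℓ δ hv.1) ?_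
  filter_upwards [hg.2] with t ht
  exact H4.norm_opL_apply_le ℓ δ ht.le (v t)

lemma integrableOn_opL (hg : IsCoefficient T g) (ℓ : Smooth) (δ : ℝ)
    (hv : MemLp v 2 (timeMeasure T)) :
    IntegrableOn (fun t => H4.opL ℓ δ (g t) (v t)) (Ioc 0 T) :=
  (hg.memLp_opL ℓ δ hv).integrable (by norm_num)

end IsCoefficient

section WeakForm

variable {T δ : ℝ} {g v : ℝ → H4} {v₀ : H4}

lemma eq_of_inner_toL2 {f h : L2} (H : ∀ w, inner ℝ f (Test.toL2 w) = inner ℝ h (Test.toL2 w)) :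
    f = h := by
  rw [← sub_eq_zero]
  exact Test.eq_zero_of_inner fun w => by rw [inner_sub_left, H, sub_self]

/-- The product of functions of time and of space. -/
lemma isSpaceTimeTest_mul {η : ℝ → ℝ} (hη : ContDiff ℝ ∞ η) (hc : HasCompactSupport η) (w : Test) :
    IsSpaceTimeTest fun q => η q.1 * w.fn q.2 := by
  refine ⟨(hη.comp contDiff_fst).mul (w.contDiff.comp contDiff_snd), ?_⟩
  refine HasCompactSupport.intro (hc.isCompact.prod w.hasCompactSupport.isCompact) fun q hq => ?_
  rw [mem_prod, not_and_or] at hq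
  rcases hq with h | h
  · rw [image_eq_zero_of_notMem_tsupport h, zero_mul]
  · rw [image_eq_zero_of_notMem_tsupport h, mul_zero]

lemma isTestFunction_mul {η : ℝ → ℝ} (hη : ContDiff ℝ ∞ η) (hc : HasCompactSupport η)
    (hs : tsupport η ⊆ Iio T) (w : Test) : IsTestFunction T fun q => η q.1 * w.fn q.2 := by
  obtain ⟨h1, h2⟩ := isSpaceTimeTest_mul hη hc w
  refine ⟨h1, h2, ?_⟩
  have : tsupport (fun q : ℝ × (ℝ × ℝ) => η q.1 * w.fn q.2) ⊆ tsupport η ×ˢ univ := by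
    refine closure_minimal (fun q hq => ⟨subset_tsupport η ?_, mem_univ _⟩)
      ((isClosed_tsupport η).prod isClosed_univ)
    exact left_ne_zero_of_mul hq
  exact this.trans (prod_mono hs Subset.rfl)

/-- Weak solutions satisfy the integrated equation. -/
theorem IsModifiedWeakSolution.isMild (hT : 0 ≤ T) (hg : IsCoefficient T g)
    (hδ : δ ∈ Icc (0 : ℝ) 1) (h : IsModifiedWeakSolution δ T g v₀ v) :
    ∀ᵐ t ∂timeMeasure T, IsMild δ g v₀ v t := by
  have hv : MemLp v 2 (timeMeasure T) := h.1.mono_exponent le_top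
  have hF := hg.integrableOn_opL (wt 1) δ hv
  have hz : IntegrableOn (fun t => mulOp (weight 1) (H4.incl (v t))) (Ioc 0 T) :=
    (((mulOp (weight 1)) ∘L H4.incl).comp_memLp' hv).integrable (by norm_num)
  refine eq_primitive_of_weak hT hz hF fun η hη hc hs => eq_of_inner_toL2 fun w => ?_
  have hd : Continuous (deriv η) := hη.continuous_deriv (by simp)
  have hi : IntegrableOn (fun t => η t • H4.opL (wt 1) δ (g t) (v t)
      - deriv η t • mulOp (weight 1) (H4.incl (v t))) (Ioc 0 T) :=
    (memLp_one_iff_integrable.1 (memLp_continuous_smul hη.continuous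
      (memLp_one_iff_integrable.2 hF))).sub (memLp_one_iff_integrable.1 (memLp_continuous_smul hd
      (memLp_one_iff_integrable.2 hz)))
  rw [inner_setIntegral hi, real_inner_smul_left]
  have hJ : ∀ f : L2, inner ℝ (mulOp (weight 1) f) (Test.toL2 w)
      = inner ℝ f (Test.toL2 (wt 1 • w)) := fun f => by
    have h0 : IsMultiplier (wt 1).1 1 := H4.isMultiplier_weight 1
    rw [(H4.isMultiplier_weight 1).inner_mulOp, ← h0.mulOp_toL2]
    rfl
  have hw : wtInv • (wt 1 • w) = w := by
    ext p
    change wtInv.1 p * (weight 1 p * w.fn p) = w.fn p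
    rw [← mul_assoc, mul_comm (wtInv.1 p), wt_one_mul_wtInv, one_mul]
  have key := h.2 _ (isTestFunction_mul hη hc hs (wt 1 • w))
  have e1 : ∀ t, ∫ p : ℝ × ℝ, (-((v t).fn p * deriv (fun s => η s * (wt 1 • w).fn p) t)
        + (weight δ p * p.2 * weakDeriv 1 0 (fun q => weight δ q * (v t).fn q) p
          - weight δ p * (1 + (g t).fn p) ^ 2 * weakDeriv 0 2 (fun q => weight δ q * (v t).fn q) p)
            * (η t * (wt 1 • w).fn p))
      = inner ℝ (η t • H4.opL (wt 1) δ (g t) (v t)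
      - deriv η t • mulOp (weight 1) (H4.incl (v t))) (Test.toL2 w) := by
    intro t
    have h1 := H4.integral_weak_form hδ (g t) (v t) (deriv η t • (wt 1 • w)) (η t • (wt 1 • w))
    have h2 : wtInv • (η t • (wt 1 • w)) = η t • w := by
      conv_rhs => rw [← hw]
      ext p
      change wtInv.1 p * (η t * (weight 1 p * w.fn p)) = η t * (wtInv.1 p * (weight 1 p * w.fn p))
      ring
    rw [h2, Test.toL2.map_smul, Test.toL2.map_smul, real_inner_smul_right, real_inner_smul_right,
      ← hJ] at h1
    rw [inner_sub_left, real_inner_smul_left, real_inner_smul_left, ← h1]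
    refine integral_congr_ae (ae_of_all _ fun p => ?_)
    have h3 : deriv (fun s => η s * (wt 1 • w).fn p) t = (deriv η t • (wt 1 • w)).fn p :=
      ((hη.differentiable (by simp) t).hasDerivAt.mul_const _).deriv
    simp only [h3]
    rfl
  have e2 : ∫ t in Ioc 0 T, inner ℝ (η t • H4.opL (wt 1) δ (g t) (v t)
      - deriv η t • mulOp (weight 1) (H4.incl (v t))) (Test.toL2 w)
      = ∫ p : ℝ × ℝ, weight δ p * v₀.fn p * (η 0 * (wt 1 • w).fn p) := by
    refine Eq.trans ?_ (sub_eq_zero.1 key)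
    exact integral_congr_ae (ae_of_all _ fun t => (e1 t).symm)
  rw [e2, hJ, Test.inner_toL2, ← integral_const_mul]
  refine integral_congr_ae ?_
  filter_upwards [(H4.isMultiplier_weight δ).coeFn_mulOp (H4.incl v₀)] with p hp
  rw [hp]
  change weight δ p * v₀.fn p * _ = η 0 * (weight δ p * v₀.fn p * _)
  ring

/-- Bounded solutions of the integrated equation are weak solutions. -/
theorem isModifiedWeakSolution_of_isMild (hT : 0 ≤ T) (hg : IsCoefficient T g)
    (hδ : δ ∈ Icc (0 : ℝ) 1) (hv : MemLp v ∞ (timeMeasure T))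
    (h : ∀ᵐ t ∂timeMeasure T, IsMild δ g v₀ v t) : IsModifiedWeakSolution δ T g v₀ v := by
  refine ⟨hv, fun φ hφ => ?_⟩
  have hF := hg.integrableOn_opL (wt 1) δ (hv.mono_exponent le_top)
  have hφ' : IsSpaceTimeTest φ := ⟨hφ.1, hφ.2⟩
  have hm := hφ'.smooth_mul wtInv
  have hφT : ∀ p, φ (T, p) = 0 := fun p => by
    by_contra h0
    exact lt_irrefl T (hφ.3 (subset_tsupport φ h0)).1
  have hT0 : Test.toL2 (hm.slice T) = 0 := by
    have : hm.slice T = 0 := by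
      ext p
      change wtInv.1 p * φ (T, p) = 0
      rw [hφT, mul_zero]
    rw [this, map_zero]
  obtain ⟨i1, i2, key⟩ := integral_by_parts hT hF h hm.hasDerivAt_toL2_slice
    hm.timeDeriv.continuous_toL2_slice hT0
  have hJ : ∀ (f : L2) (w : Test), inner ℝ (mulOp (weight 1) f) (Test.toL2 (wtInv • w))
      = inner ℝ f (Test.toL2 w) := fun f w => by
    have h0 : IsMultiplier (wt 1).1 1 := H4.isMultiplier_weight 1
    have hw : wt 1 • (wtInv • w) = w := by
      ext p
      change weight 1 p * (wtInv.1 p * w.fn p) = w.fn p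
      rw [← mul_assoc, wt_one_mul_wtInv, one_mul]
    rw [(H4.isMultiplier_weight 1).inner_mulOp]
    have e := h0.mulOp_toL2 (wtInv • w)
    rw [hw] at e
    rw [← e]
    rfl
  have hslice : ∀ t, hm.slice t = wtInv • hφ'.slice t := fun t => rfl
  have hslice' : ∀ t, hm.timeDeriv.slice t = wtInv • hφ'.timeDeriv.slice t := fun t => by
    ext p
    change deriv (fun s => wtInv.1 p * φ (s, p)) t = wtInv.1 p * deriv (fun s => φ (s, p)) t
    exact ((hφ'.hasDerivAt t p).differentiableAt.hasDerivAt.const_mul _).deriv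
  simp only [hslice, hslice', hJ] at key
  rw [sub_eq_zero]
  refine Eq.trans (integral_congr_ae (ae_of_all _ fun t => ?_)) (key.trans ?_)
  · have h1 := H4.integral_weak_form hδ (g t) (v t) (hφ'.timeDeriv.slice t) (hφ'.slice t)
    exact h1
  · rw [Test.inner_toL2]
    refine integral_congr_ae ?_
    filter_upwards [(H4.isMultiplier_weight δ).coeFn_mulOp (H4.incl v₀)] with p hp
    rw [hp]
    rfl

/-- The original problem is the modified problem with `δ = 0`. -/
lemma isWeakSolution_iff : IsWeakSolution T g v₀ v ↔ IsModifiedWeakSolution 0 T g v₀ v := by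
  have h1 : ∀ p, weight 0 p = 1 := fun p => by simp [weight]
  constructor
  · rintro ⟨h2, h3⟩
    refine ⟨h2, fun φ hφ => ?_⟩
    simpa only [h1, one_mul] using h3 φ hφ
  · rintro ⟨h2, h3⟩
    refine ⟨h2, fun φ hφ => ?_⟩
    simpa only [h1, one_mul] using h3 φ hφ

end WeakForm

/-! ### Transposed operators -/

namespace H4

open ContinuousLinearMap (adjoint)

/-- The transpose of `opR`, from `L²` to `H⁴`. -/
def opRt (ℓ : Smooth) (δ : ℝ) : L2 →L[ℝ] H4 :=
  adjoint D10 ∘L mulOp (ℓ * mu δ).1 + adjoint incl ∘L ((1 / 2 : ℝ) • mulOp (ℓ * dx (mu δ)).1)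

/-- The transpose of `opQ`, from `L²` to `H⁴`. -/
def opQt (ℓ : Smooth) (δ : ℝ) : L2 →L[ℝ] H4 :=
  adjoint D02 ∘L mulOp (ℓ * (wt δ * wt δ)).1 + adjoint D01 ∘L mulOp (ℓ * (2 * wt δ * dy (wt δ))).1
    + adjoint incl ∘L mulOp (ℓ * (wt δ * dy (dy (wt δ)))).1

/-- The transpose of `opL`, from `L²` to `H⁴`. -/
def opLt (ℓ : Smooth) (δ : ℝ) (g : H4) : L2 →L[ℝ] H4 := opRt ℓ δ - opQt ℓ δ ∘L coefOp g

/-- The transpose of `opE`, from `L²` to `H⁴`. -/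
def opEt (δ : ℝ) : L2 →L[ℝ] H4 :=
  adjoint D01 ∘L mulOp (wt δ).1 + adjoint incl ∘L mulOp (dy (wt δ)).1

variable {ℓ : Smooth} {δ : ℝ}

lemma inner_mulOp_comp {m : ℝ × ℝ → ℝ} {C : ℝ} (h : IsMultiplier m C) (D : H4 →L[ℝ] L2) (u : H4)
    (f : L2) : inner ℝ (mulOp m (D u)) f = inner ℝ u (adjoint D (mulOp m f)) := by
  rw [h.inner_mulOp, ContinuousLinearMap.adjoint_inner_right]

lemma inner_opL (h : IsAdmissible ℓ δ) (g u : H4) (f : L2) :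
    inner ℝ (opL ℓ δ g u) f = inner ℝ u (opLt ℓ δ g f) := by
  obtain ⟨C, -, hb⟩ := exists_coefficient_bound
  obtain ⟨a1, a2, a3, a4, -⟩ := hb _ _ h
  obtain ⟨C', hC'⟩ := h.bound
  have a0 : IsMultiplier (ℓ * mu δ).1 C' := .of_continuous (ℓ * mu δ).continuous hC'
  have hR : ∀ f, inner ℝ (opR ℓ δ u) f = inner ℝ u (opRt ℓ δ f) := fun f => by
    have e1 : opR ℓ δ u = mulOp (ℓ * mu δ).1 (D10 u)
      + (1 / 2 : ℝ) • mulOp (ℓ * dx (mu δ)).1 (incl u) := rfl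
    have e2 : opRt ℓ δ f = adjoint D10 (mulOp (ℓ * mu δ).1 f)
      + adjoint incl ((1 / 2 : ℝ) • mulOp (ℓ * dx (mu δ)).1 f) := rfl
    rw [e1, e2, inner_add_left, inner_add_right, inner_mulOp_comp a0,
      ContinuousLinearMap.adjoint_inner_right incl, real_inner_smul_left, real_inner_smul_right,
      a1.inner_mulOp]
  have hQ : ∀ f, inner ℝ (opQ ℓ δ u) f = inner ℝ u (opQt ℓ δ f) := fun f => by
    have e1 : opQ ℓ δ u = mulOp (ℓ * (wt δ * wt δ)).1 (D02 u)
      + mulOp (ℓ * (2 * wt δ * dy (wt δ))).1 (D01 u)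
      + mulOp (ℓ * (wt δ * dy (dy (wt δ)))).1 (incl u) := rfl
    have e2 : opQt ℓ δ f = adjoint D02 (mulOp (ℓ * (wt δ * wt δ)).1 f)
      + adjoint D01 (mulOp (ℓ * (2 * wt δ * dy (wt δ))).1 f)
      + adjoint incl (mulOp (ℓ * (wt δ * dy (dy (wt δ)))).1 f) := rfl
    rw [e1, e2, inner_add_left, inner_add_right, inner_add_left, inner_add_right,
      inner_mulOp_comp a2, inner_mulOp_comp a3, inner_mulOp_comp a4]
  have e1 : opL ℓ δ g u = opR ℓ δ u - coefOp g (opQ ℓ δ u) := rfl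
  have e2 : opLt ℓ δ g f = opRt ℓ δ f - opQt ℓ δ (coefOp g f) := rfl
  rw [e1, e2, inner_sub_left, inner_sub_right, hR, inner_coefOp, hQ]

lemma inner_opE (hδ : δ ∈ Icc (0 : ℝ) 1) (u : H4) (f : L2) :
    inner ℝ (opE δ u) f = inner ℝ u (opEt δ f) := by
  obtain ⟨C, -, hb⟩ := exists_coefficient_bound
  obtain ⟨-, -, -, -, a1⟩ := hb _ _ (isAdmissible_wt hδ)
  have a0 : IsMultiplier (wt δ).1 1 := isMultiplier_weight δ
  have e1 : opE δ u = mulOp (wt δ).1 (D01 u) + mulOp (dy (wt δ)).1 (incl u) := rfl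
  have e2 : opEt δ f = adjoint D01 (mulOp (wt δ).1 f) + adjoint incl (mulOp (dy (wt δ)).1 f) := rfl
  rw [e1, e2, inner_add_left, inner_add_right, inner_mulOp_comp a0, inner_mulOp_comp a1]

lemma norm_le_of_inner_eq {B : H4 → L2} {C : ℝ} (hC : 0 ≤ C) (hB : ∀ u, ‖B u‖ ≤ C * ‖u‖) {f : L2}
    {x : H4} (h : ∀ u, inner ℝ (B u) f = inner ℝ u x) : ‖x‖ ≤ C * ‖f‖ := by
  rcases (norm_nonneg x).eq_or_lt with h0 | h0
  · rw [← h0]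
    positivity
  · refine le_of_mul_le_mul_left ?_ h0
    calc ‖x‖ * ‖x‖ = inner ℝ (B x) f := by rw [h, real_inner_self_eq_norm_mul_norm]
      _ ≤ ‖B x‖ * ‖f‖ := real_inner_le_norm _ _
      _ ≤ C * ‖x‖ * ‖f‖ := by gcongr; exact hB x
      _ = _ := by ring

lemma continuous_opLt (ℓ : Smooth) (δ : ℝ) : Continuous (opLt ℓ δ) :=
  continuous_const.sub (continuous_const.clm_comp continuous_coefOp)

/-- The inclusion of `H⁴` in the space of functions `f` for which `⟨(x, y)⟩⁻¹ f ∈ L²`. -/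
lemma weighted_incl_injective {u v : H4}
    (h : mulOp (weight 1) (incl u) = mulOp (weight 1) (incl v)) : u = v := by
  refine incl_injective (Lp.ext ?_)
  filter_upwards [(isMultiplier_weight 1).coeFn_mulOp (incl u),
    (isMultiplier_weight 1).coeFn_mulOp (incl v)] with p h1 h2
  rw [h, h2] at h1
  exact (mul_left_cancel₀ (weight_pos 1 p).ne' h1).symm

/-- Multiplying the spatial operator by the weight. -/
lemma mulOp_opL_one (hδ : δ ∈ Ioc (0 : ℝ) 1) (g u : H4) :
    mulOp (weight 1) (opL 1 δ g u) = opL (wt 1) δ g u := by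
  have hc1 : Continuous fun q : H4 × H4 => mulOp (weight 1) (opL 1 δ q.1 q.2) :=
    (mulOp (weight 1)).continuous.comp
      (((continuous_opL 1 δ).comp continuous_fst).clm_apply continuous_snd)
  have hc2 : Continuous fun q : H4 × H4 => opL (wt 1) δ q.1 q.2 :=
    ((continuous_opL (wt 1) δ).comp continuous_fst).clm_apply continuous_snd
  refine congrFun ((Test.denseRange_toH4.prodMap Test.denseRange_toH4).equalizer hc1 hc2
    (funext fun q => ?_)) (g, u)
  simp only [Function.comp_apply, Prod.map_fst, Prod.map_snd]
  rw [opL_toH4 (isAdmissible_one hδ), opL_toH4 (isAdmissible_wt ⟨hδ.1.le, hδ.2⟩)]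
  have h0 : IsMultiplier (wt 1).1 1 := isMultiplier_weight 1
  refine (h0.mulOp_toL2 _).trans ?_
  congr 1
  ext p
  change weight 1 p * (1 * _) = weight 1 p * _
  rw [one_mul]

end H4

/-! ### Uniqueness -/

section Uniqueness

variable {T δ : ℝ} {g v w : ℝ → H4} {v₀ : H4}

/-- Square integrable solutions of the integrated equation are unique. -/
theorem IsMild.unique (hg : IsCoefficient T g) (hδ : δ ∈ Icc (0 : ℝ) 1)
    (hv : MemLp v 2 (timeMeasure T)) (hw : MemLp w 2 (timeMeasure T))
    (h : ∀ᵐ t ∂timeMeasure T, IsMild δ g v₀ v t) (h' : ∀ᵐ t ∂timeMeasure T, IsMild δ g v₀ w t) :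
    v =ᵐ[timeMeasure T] w := by
  have iv := hg.integrableOn_opL (wt 1) δ hv
  have iw := hg.integrableOn_opL (wt 1) δ hw
  have hF := hg.integrableOn_opL (wt 1) δ (hv.sub hw)
  have hz : ∀ᵐ t ∂timeMeasure T, mulOp (weight 1) (H4.incl (v t - w t))
      = - ∫ s in Ioc 0 t, H4.opL (wt 1) δ (g s) ((v - w) s) := by
    filter_upwards [h, h', ae_restrict_mem measurableSet_Ioc] with t h1 h2 ht
    have hs : Ioc 0 t ⊆ Ioc 0 T := Ioc_subset_Ioc_right ht.2
    simp only [Pi.sub_apply, map_sub]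
    rw [integral_sub (iv.mono_set hs) (iw.mono_set hs), h1, h2]
    abel
  have h0 := primitive_eq_zero (C := 200) hF (by
    filter_upwards [hz, hg.2] with t h1 h2
    have h3 := H4.weighted_estimate hδ h2 (v t - w t)
    rw [h1, norm_neg, inner_neg_right, real_inner_comm] at h3
    simp only [Pi.sub_apply] at h3 ⊢
    linarith)
  filter_upwards [hz, ae_restrict_mem measurableSet_Ioc] with t h1 ht
  rw [h0 t ⟨ht.1.le, ht.2⟩, neg_zero] at h1
  refine sub_eq_zero.1 (H4.weighted_incl_injective ?_)
  rw [h1, map_zero, map_zero]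

end Uniqueness

/-! ### Existence for the modified problem -/

section Existence

/-- The modified problem on `]0, τ]`, with the value at time `τ`. -/
lemma exists_mild_with_final_value {T : ℝ} : ∃ C : ℝ, 0 < C ∧ ∀ τ ∈ Ioc 0 T,
    ∀ δ ∈ Ioc (0 : ℝ) 1, ∀ g : ℝ → H4, IsCoefficient τ g → ∀ v₀ v₁ : H4,
      H4.incl v₁ = mulOp (weight δ) (H4.incl v₀) →
      ∃ (u d : ℝ → H4) (u₁ : H4), MemLp u 2 (timeMeasure τ) ∧ MemLp d 2 (timeMeasure τ) ∧
        ‖u₁‖ ^ 2 + (∫ t in Ioc 0 τ, ‖d t‖ ^ 2) ≤ C * ‖v₁‖ ^ 2 ∧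
        (∀ᵐ t ∂timeMeasure τ, H4.opE δ (u t) = H4.incl (d t)) ∧
        (∀ᵐ t ∂timeMeasure τ, IsMild δ g v₀ u t) ∧
        mulOp (weight 1) (H4.incl u₁) = mulOp (weight 1) (mulOp (weight δ) (H4.incl v₀))
          - ∫ s in Ioc 0 τ, H4.opL (wt 1) δ (g s) (u s) := by
  obtain ⟨K, hK, hen⟩ := H4.energy_estimate
  refine ⟨Real.exp ((K + 1 / 4) * T) ^ 2 * (2 / (1 / 4)), by positivity,
    fun τ hτ δ hδ g hg v₀ v₁ hv₁ => ?_⟩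
  have hδ' : δ ∈ Icc (0 : ℝ) 1 := ⟨hδ.1.le, hδ.2⟩
  have hadm := isAdmissible_one hδ
  let A : ℝ → Test →ₗ[ℝ] H4 := fun t =>
    (H4.opLt 1 δ (g t)).toLinearMap ∘ₗ Test.toL2 ∘ₗ Test.opP
  have hAw : ∀ t w u, inner ℝ u (A t w)
      = inner ℝ (H4.opL 1 δ (g t) u) (Test.toL2 (Test.opP w)) := fun t w u =>
    (H4.inner_opL hadm (g t) u _).symm
  have hA : ∀ w, MemLp (fun t => A t w) 2 (timeMeasure τ) := fun w => by
    have hc : Continuous fun g => H4.opLt 1 δ g (Test.toL2 (Test.opP w)) :=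
      (H4.continuous_opLt 1 δ).clm_apply continuous_const
    refine MemLp.of_bound (hc.comp_aestronglyMeasurable hg.1)
      ((‖H4.opR 1 δ‖ + 4 * ‖H4.opQ 1 δ‖) * ‖Test.toL2 (Test.opP w)‖) ?_
    filter_upwards [hg.2] with t ht
    exact H4.norm_le_of_inner_eq (by positivity) (H4.norm_opL_apply_le 1 δ ht.le)
      fun u => H4.inner_opL hadm (g t) u _
  obtain ⟨u, d, u₁, hu, hd, hb, hrel, heq⟩ := exists_weak_evolution_of_garding (T := T)
    hτ.1.le hτ.2 Test.toH4 (Test.toH4 ∘ₗ Test.opD δ) A hA (c := 1 / 4) (κ := K)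
    (by norm_num) (by norm_num) hK (by
      filter_upwards [hg.2] with t ht w
      rw [hAw]
      exact hen δ hδ (g t) ht w) (H4.opE δ) H4.incl (fun w => H4.opE_toH4 hδ' w) v₁
  have iG := hg.integrableOn_opL 1 δ hu
  have iz : IntegrableOn (fun t => H4.incl (u t)) (Ioc 0 τ) :=
    (H4.incl.comp_memLp' hu).integrable (by norm_num)
  -- the weak form as an identity in `L²`
  have key : ∀ η : ℝ → ℝ, ContDiff ℝ 1 η →
      (∫ t in Ioc 0 τ, (η t • H4.opL 1 δ (g t) (u t) - deriv η t • H4.incl (u t)))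
        + η τ • H4.incl u₁ = η 0 • H4.incl v₁ := by
    intro η hη
    rw [← sub_eq_zero]
    refine Test.eq_zero_of_inner_opP fun w => ?_
    have h1 := heq η hη w
    have hi : IntegrableOn (fun t => η t • H4.opL 1 δ (g t) (u t) - deriv η t • H4.incl (u t))
        (Ioc 0 τ) :=
      (memLp_one_iff_integrable.1 (memLp_continuous_smul hη.continuous
        (memLp_one_iff_integrable.2 iG))).sub (memLp_one_iff_integrable.1
        (memLp_continuous_smul (hη.continuous_deriv le_rfl) (memLp_one_iff_integrable.2 iz)))
    rw [inner_sub_left, inner_add_left, inner_setIntegral hi, real_inner_smul_left,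
      real_inner_smul_left, sub_eq_zero]
    rw [Test.inner_toH4, Test.inner_toH4] at h1
    rw [← h1]
    congr 1
    refine integral_congr_ae (ae_of_all _ fun t => ?_)
    simp only []
    rw [hAw, Test.inner_toH4, inner_sub_left, real_inner_smul_left, real_inner_smul_left]
  have hJ : ∀ t ≤ τ, mulOp (weight 1) (H4.incl v₁ - ∫ s in Ioc 0 t, H4.opL 1 δ (g s) (u s))
      = mulOp (weight 1) (mulOp (weight δ) (H4.incl v₀))
        - ∫ s in Ioc 0 t, H4.opL (wt 1) δ (g s) (u s) := fun t ht => by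
    rw [map_sub, hv₁, ← ContinuousLinearMap.integral_comp_comm _
      (iG.mono_set (Ioc_subset_Ioc_right ht))]
    simp only [H4.mulOp_opL_one hδ]
  refine ⟨u, d, u₁, hu, hd, hb, hrel, ?_, ?_⟩
  · have h1 := eq_primitive_of_weak (z₀ := H4.incl v₁) hτ.1.le iz iG fun η hη hc hs => by
      have h2 := key η (hη.of_le (by exact WithTop.coe_le_coe.2 le_top))
      have h3 : η τ = 0 := by
        by_contra h0
        exact lt_irrefl τ (hs (subset_tsupport η h0))
      rwa [h3, zero_smul, add_zero] at h2
    filter_upwards [h1, ae_restrict_mem measurableSet_Ioc] with t ht hmem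
    rw [IsMild, ht, hJ t hmem.2]
  · have h1 := key (fun _ => 1) contDiff_const
    simp only [deriv_const', zero_smul, sub_zero, one_smul] at h1
    rw [← hJ τ le_rfl, ← h1]
    congr 1
    abel

/-- Existence for the modified problem, with bounds uniform in `δ`. -/
theorem exists_mild_of_pos {T : ℝ} (hT : 0 < T) : ∃ C : ℝ, 0 < C ∧ ∀ δ ∈ Ioc (0 : ℝ) 1,
    ∀ g : ℝ → H4, IsCoefficient T g → ∀ v₀ : H4, ∃ v d : ℝ → H4,
      AEStronglyMeasurable v (timeMeasure T) ∧ MemLp d 2 (timeMeasure T) ∧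
      (∀ t ∈ Icc 0 T, ‖v t‖ ^ 2 ≤ C * ‖v₀‖ ^ 2) ∧ (∫ t in Ioc 0 T, ‖d t‖ ^ 2) ≤ C * ‖v₀‖ ^ 2 ∧
      (∀ᵐ t ∂timeMeasure T, H4.opE δ (v t) = H4.incl (d t)) ∧
      ∀ t ∈ Icc 0 T, IsMild δ g v₀ v t := by
  obtain ⟨C, hC, h⟩ := exists_mild_with_final_value (T := T)
  obtain ⟨C', hC', hm⟩ := H4.exists_mul_wt
  refine ⟨(C + 1) * (C' ^ 2 + 1), by positivity, fun δ hδ g hg v₀ => ?_⟩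
  obtain ⟨v₁, hv₁, hv₁n⟩ := hm δ ⟨hδ.1.le, hδ.2⟩ v₀
  have hCv : (C + 1) * ‖v₁‖ ^ 2 ≤ (C + 1) * (C' ^ 2 + 1) * ‖v₀‖ ^ 2 := by
    have h1 : ‖v₁‖ ^ 2 ≤ C' ^ 2 * ‖v₀‖ ^ 2 := by rw [← mul_pow]; gcongr
    rw [mul_assoc]
    gcongr
    nlinarith [sq_nonneg ‖v₀‖]
  have hCv' : C * ‖v₁‖ ^ 2 ≤ (C + 1) * (C' ^ 2 + 1) * ‖v₀‖ ^ 2 := by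
    nlinarith [sq_nonneg ‖v₁‖]
  choose! u d u₁ hu hd hb hrel hmild hfin using fun τ (hτ : τ ∈ Ioc 0 T) =>
    h τ hτ δ hδ g (hg.mono hτ.2) v₀ v₁ hv₁
  have hTT : T ∈ Ioc 0 T := ⟨hT, le_rfl⟩
  have hδ' : δ ∈ Icc (0 : ℝ) 1 := ⟨hδ.1.le, hδ.2⟩
  classical
  let v : ℝ → H4 := fun t => if t ∈ Ioc 0 T then u₁ t else v₁
  have hint : ∀ τ ∈ Ioc 0 T, ∫ s in Ioc 0 τ, H4.opL (wt 1) δ (g s) (u τ s)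
      = ∫ s in Ioc 0 τ, H4.opL (wt 1) δ (g s) (u T s) := by
    intro τ hτ
    have hs : Ioc 0 τ ⊆ Ioc 0 T := Ioc_subset_Ioc_right hτ.2
    have h1 := IsMild.unique (hg.mono hτ.2) hδ' (hu τ hτ)
      ((hu T hTT).mono_measure (Measure.restrict_mono hs le_rfl)) (hmild τ hτ)
      (ae_restrict_of_ae_restrict_of_subset hs (hmild T hTT))
    refine integral_congr_ae ?_
    filter_upwards [h1] with s hs
    rw [hs]
  have hvT : v =ᵐ[timeMeasure T] u T := by
    filter_upwards [hmild T hTT, ae_restrict_mem measurableSet_Ioc] with t h1 ht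
    refine H4.weighted_incl_injective ?_
    rw [h1, ← hint t ht, ← hfin t ht]
    simp only [v, if_pos ht]
  refine ⟨v, d T, (hu T hTT).1.congr hvT.symm, hd T hTT, fun t ht => ?_, ?_, ?_, fun t ht => ?_⟩
  · by_cases h0 : t ∈ Ioc 0 T
    · simp only [v, if_pos h0]
      have h1 := hb t h0
      have h2 : 0 ≤ ∫ s in Ioc 0 t, ‖d t s‖ ^ 2 := integral_nonneg fun s => sq_nonneg _
      linarith
    · simp only [v, if_neg h0]
      nlinarith [sq_nonneg ‖v₁‖]
  · have h1 := hb T hTT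
    have h2 := sq_nonneg ‖u₁ T‖
    linarith
  · filter_upwards [hvT, hrel T hTT] with t h1 h2
    rw [h1, h2]
  · have h2 : ∫ s in Ioc 0 t, H4.opL (wt 1) δ (g s) (v s)
        = ∫ s in Ioc 0 t, H4.opL (wt 1) δ (g s) (u T s) := by
      refine integral_congr_ae ?_
      filter_upwards [ae_restrict_of_ae_restrict_of_subset (Ioc_subset_Ioc_right ht.2) hvT]
        with s hs
      rw [hs]
    rw [IsMild, h2]
    by_cases h0 : t ∈ Ioc 0 T
    · rw [← hint t h0, ← hfin t h0]
      simp only [v, if_pos h0]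
    · have : t = 0 := by
        by_contra h3
        exact h0 ⟨lt_of_le_of_ne ht.1 (Ne.symm h3), ht.2⟩
      subst this
      simp only [v, if_neg h0, Ioc_self, Measure.restrict_empty, integral_zero_measure,
        sub_zero, hv₁]

end Existence

/-! ### Weak continuity in time -/

namespace H4

open ContinuousLinearMap (adjoint)

/-- The map `u ↦ ⟨(x, y)⟩⁻¹ u` from `H⁴` to `L²`. -/
def weightedIncl : H4 →L[ℝ] L2 := mulOp (weight 1) ∘L incl

lemma weightedIncl_apply (u : H4) : weightedIncl u = mulOp (weight 1) (incl u) := rfl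

lemma denseRange_adjoint_weightedIncl : DenseRange (adjoint weightedIncl) := by
  have h : (LinearMap.range (adjoint weightedIncl).toLinearMap).topologicalClosure = ⊤ := by
    rw [Submodule.topologicalClosure_eq_top_iff, Submodule.eq_bot_iff]
    intro u hu
    rw [Submodule.mem_orthogonal'] at hu
    refine weighted_incl_injective ?_
    rw [map_zero, map_zero]
    refine ext_inner_right ℝ fun f => ?_
    have h1 := hu _ ⟨f, rfl⟩
    rw [inner_zero_left, ← h1]
    exact (ContinuousLinearMap.adjoint_inner_right weightedIncl u f).symm
  have h2 : closure (range (adjoint weightedIncl)) = univ := by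
    have := congrArg (fun S : Submodule ℝ H4 => (S : Set H4)) h
    exact this
  exact dense_iff_closure_eq.2 h2

end H4

lemma memLp_of_bound_time {G : Type*} [NormedAddCommGroup G] {T M : ℝ} {v : ℝ → G} (p : ℝ≥0∞)
    (hv : AEStronglyMeasurable v (timeMeasure T)) (hM : ∀ t ∈ Icc 0 T, ‖v t‖ ≤ M) :
    MemLp v p (timeMeasure T) := by
  refine MemLp.of_bound hv M ?_
  filter_upwards [ae_restrict_mem measurableSet_Ioc] with t ht using hM t ⟨ht.1.le, ht.2⟩

/-- Bounded solutions of the integrated equation are weakly continuous. -/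
theorem weaklyContinuous_of_isMild {T δ M : ℝ} {g v : ℝ → H4} {v₀ : H4} (hg : IsCoefficient T g)
    (hv : AEStronglyMeasurable v (timeMeasure T)) (hM : ∀ t ∈ Icc 0 T, ‖v t‖ ≤ M)
    (h : ∀ t ∈ Icc 0 T, IsMild δ g v₀ v t) : WeaklyContinuous T v := by
  obtain ⟨Z, hZ, hFZ⟩ := continuous_primitive_Ioc
    (hg.integrableOn_opL (wt 1) δ (memLp_of_bound_time 2 hv hM))
  have h1 : ∀ f : L2, ContinuousOn (fun t => inner ℝ (v t)
      (ContinuousLinearMap.adjoint H4.weightedIncl f)) (Icc 0 T) := by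
    intro f
    have : Continuous fun t => inner ℝ (mulOp (weight 1) (mulOp (weight δ) (H4.incl v₀)) - Z t) f :=
      (continuous_const.sub hZ).inner continuous_const
    refine this.continuousOn.congr fun t ht => ?_
    simp only [ContinuousLinearMap.adjoint_inner_right]
    rw [H4.weightedIncl_apply, h t ht, hFZ t ht]
  intro u
  refine continuousOn_of_uniform_approx_of_continuousOn fun s hs => ?_
  obtain ⟨ε, hε, hεs⟩ := Metric.mem_uniformity_dist.1 hs
  have hM1 : 0 < |M| + 1 := by positivity
  obtain ⟨f, hf⟩ := H4.denseRange_adjoint_weightedIncl.exists_dist_lt u (div_pos hε hM1)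
  refine ⟨_, h1 f, fun t ht => hεs ?_⟩
  rw [Real.dist_eq, ← inner_sub_right]
  rw [dist_eq_norm, lt_div_iff₀ hM1] at hf
  calc _ ≤ ‖v t‖ * ‖u - ContinuousLinearMap.adjoint H4.weightedIncl f‖ :=
        abs_real_inner_le_norm _ _
    _ ≤ (|M| + 1) * ‖u - ContinuousLinearMap.adjoint H4.weightedIncl f‖ := by
        gcongr
        have := (hM t ht).trans (le_abs_self M)
        linarith
    _ < ε := by rw [mul_comm]; exact hf

/-! ### Weak limits along ultrafilters -/

section WeakLimits

variable {H : Type*} [NormedAddCommGroup H] [InnerProductSpace ℝ H]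

lemma norm_sq_toLp_time {T : ℝ} {f : ℝ → H} (hf : MemLp f 2 (timeMeasure T)) :
    ‖hf.toLp f‖ ^ 2 = ∫ t in Ioc 0 T, ‖f t‖ ^ 2 := by
  rw [norm_sq_Lp_time]
  refine integral_congr_ae ?_
  filter_upwards [hf.coeFn_toLp] with t ht
  rw [ht]

lemma inner_toLp_time {T : ℝ} {f h : ℝ → H} (hf : MemLp f 2 (timeMeasure T))
    (hh : MemLp h 2 (timeMeasure T)) :
    inner ℝ (hf.toLp f) (hh.toLp h) = ∫ t in Ioc 0 T, inner ℝ (f t) (h t) := by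
  rw [L2.inner_def]
  refine integral_congr_ae ?_
  filter_upwards [hf.coeFn_toLp, hh.coeFn_toLp] with t h1 h2
  rw [h1, h2]

/-- Bounded families in a Hilbert space have weak limits along ultrafilters. -/
lemma exists_weak_limit [CompleteSpace H] {ι : Type*} (U : Ultrafilter ι) {f : ι → H} {M : ℝ}
    (hM : ∀ i, ‖f i‖ ≤ M) :
    ∃ x, ‖x‖ ≤ M ∧ ∀ h, Tendsto (fun i => inner ℝ (f i) h) U (𝓝 (inner ℝ x h)) := by
  have hM0 : 0 ≤ M := by
    obtain ⟨i⟩ := U.neBot.nonempty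
    exact (norm_nonneg _).trans (hM i)
  have hb : ∀ h i, |inner ℝ (f i) h| ≤ M * ‖h‖ := fun h i =>
    (abs_real_inner_le_norm _ _).trans (mul_le_mul_of_nonneg_right (hM i) (norm_nonneg _))
  have hex : ∀ h, ∃ l ∈ Icc (-(M * ‖h‖)) (M * ‖h‖), Tendsto (fun i => inner ℝ (f i) h) U (𝓝 l) := by
    intro h
    obtain ⟨l, hl, hle⟩ := isCompact_Icc.ultrafilter_le_nhds
      (U.map fun i => inner ℝ (f i) h) (s := Icc (-(M * ‖h‖)) (M * ‖h‖)) (by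
        rw [le_principal_iff]
        exact Filter.mem_map.2 (Eventually.of_forall fun i : ι => abs_le.1 (hb h i)))
    exact ⟨l, hl, hle⟩
  choose L hL hlim using hex
  let Λ : H →L[ℝ] ℝ := LinearMap.mkContinuous
    { toFun := L
      map_add' := fun a b => by
        refine tendsto_nhds_unique (hlim (a + b)) (((hlim a).add (hlim b)).congr fun i => ?_)
        rw [inner_add_right]
      map_smul' := fun c a => by
        refine tendsto_nhds_unique (hlim (c • a)) (((hlim a).const_mul c).congr fun i => ?_)
        rw [real_inner_smul_right] } M fun h => abs_le.2 (hL h)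
  refine ⟨(InnerProductSpace.toDual ℝ H).symm Λ, ?_, fun h => ?_⟩
  · rw [LinearIsometryEquiv.norm_map]
    exact LinearMap.mkContinuous_norm_le _ hM0 _
  · rw [InnerProductSpace.toDual_symm_apply]
    exact hlim h

/-- Weak limits along ultrafilters in the space of square integrable functions of time. -/
lemma exists_weak_limit_time [CompleteSpace H] {ι : Type*} (U : Ultrafilter ι) {T : ℝ}
    {v : ι → ℝ → H} {M : ℝ} (hv : ∀ i, MemLp (v i) 2 (timeMeasure T))
    (hM : ∀ i, ∫ t in Ioc 0 T, ‖v i t‖ ^ 2 ≤ M) :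
    ∃ V : ℝ → H, MemLp V 2 (timeMeasure T) ∧ ∫ t in Ioc 0 T, ‖V t‖ ^ 2 ≤ M ∧
      ∀ k : ℝ → H, MemLp k 2 (timeMeasure T) →
        Tendsto (fun i => ∫ t in Ioc 0 T, inner ℝ (v i t) (k t)) U
          (𝓝 (∫ t in Ioc 0 T, inner ℝ (V t) (k t))) := by
  have hM0 : 0 ≤ M := by
    obtain ⟨i⟩ := U.neBot.nonempty
    exact (integral_nonneg fun t => sq_nonneg _).trans (hM i)
  obtain ⟨V, hVn, hV⟩ := exists_weak_limit U (f := fun i => (hv i).toLp (v i)) (M := Real.sqrt M)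
    fun i => Real.le_sqrt_of_sq_le (by rw [norm_sq_toLp_time]; exact hM i)
  refine ⟨V, Lp.memLp V, ?_, fun k hk => ?_⟩
  · rw [← norm_sq_Lp_time]
    calc ‖V‖ ^ 2 ≤ Real.sqrt M ^ 2 := by gcongr
      _ = M := Real.sq_sqrt hM0
  · have h1 := hV (hk.toLp k)
    simp only [inner_toLp_time] at h1
    convert h1 using 2
    rw [L2.inner_def]
    refine integral_congr_ae ?_
    filter_upwards [hk.coeFn_toLp] with t ht
    rw [ht]

/-- The pairing of a weakly convergent family with a family that converges pointwise and is
dominated. -/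
lemma tendsto_integral_inner {T : ℝ} {U : Ultrafilter ℝ} (hU : (U : Filter ℝ) ≤ 𝓝[>] 0)
    {v : ℝ → ℝ → H} {V : ℝ → H} {M : ℝ} (hv : ∀ i, MemLp (v i) 2 (timeMeasure T))
    (hM : ∀ i, ∫ t in Ioc 0 T, ‖v i t‖ ^ 2 ≤ M)
    (hweak : ∀ k : ℝ → H, MemLp k 2 (timeMeasure T) →
        Tendsto (fun i => ∫ t in Ioc 0 T, inner ℝ (v i t) (k t)) U
          (𝓝 (∫ t in Ioc 0 T, inner ℝ (V t) (k t))))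
    {K : ℝ → ℝ → H} {k : ℝ → ℝ} (hk : MemLp k 2 (timeMeasure T))
    (hK : ∀ δ ∈ Icc (0 : ℝ) 1, AEStronglyMeasurable (K δ) (timeMeasure T))
    (hdom : ∀ δ ∈ Icc (0 : ℝ) 1, ∀ᵐ t ∂timeMeasure T, ‖K δ t‖ ≤ k t)
    (hlim : ∀ᵐ t ∂timeMeasure T, Tendsto (fun δ => K δ t) (𝓝[>] 0) (𝓝 (K 0 t))) :
    Tendsto (fun δ => ∫ t in Ioc 0 T, inner ℝ (v δ t) (K δ t)) U
      (𝓝 (∫ t in Ioc 0 T, inner ℝ (V t) (K 0 t))) := by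
  have h01 : (0 : ℝ) ∈ Icc (0 : ℝ) 1 := by simp
  have hmem : ∀ᶠ δ in 𝓝[>] (0 : ℝ), δ ∈ Icc (0 : ℝ) 1 :=
    mem_of_superset (Ioc_mem_nhdsGT zero_lt_one) Ioc_subset_Icc_self
  have hKm : ∀ δ ∈ Icc (0 : ℝ) 1, MemLp (K δ) 2 (timeMeasure T) := fun δ hδ =>
    hk.mono' (hK δ hδ) (hdom δ hδ)
  have hstrong : Tendsto (fun δ => ∫ t in Ioc 0 T, ‖K δ t - K 0 t‖ ^ 2) (𝓝[>] 0) (𝓝 0) := by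
    suffices h0 : Tendsto (fun δ => ∫ t in Ioc 0 T, ‖K δ t - K 0 t‖ ^ 2) (𝓝[>] 0)
      (𝓝 (∫ t in Ioc 0 T, (0 : ℝ))) by simpa using h0
    have hk2 : Integrable (fun t => 4 * ‖k t‖ ^ 2) (timeMeasure T) :=
      (hk.integrable_norm_pow (by simp)).const_mul 4
    refine tendsto_integral_filter_of_dominated_convergence (fun t => 4 * ‖k t‖ ^ 2) ?_ ?_ hk2 ?_
    · filter_upwards [hmem] with δ hδ
      exact ((hK δ hδ).sub (hK 0 h01)).norm.pow 2
    · filter_upwards [hmem] with δ hδ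
      filter_upwards [hdom δ hδ, hdom 0 h01] with t h1 h2
      rw [Real.norm_of_nonneg (sq_nonneg _)]
      have h3 := norm_sub_le (K δ t) (K 0 t)
      have h4 : k t ≤ ‖k t‖ := le_abs_self _
      calc ‖K δ t - K 0 t‖ ^ 2 ≤ (2 * ‖k t‖) ^ 2 := by gcongr; linarith
        _ = _ := by ring
    · filter_upwards [hlim] with t ht
      have := (ht.sub_const (K 0 t)).norm.pow 2
      simpa using this
  have hM0 : 0 ≤ M := (integral_nonneg fun t => sq_nonneg _).trans (hM 0)
  have h1 : Tendsto (fun δ => ∫ t in Ioc 0 T, inner ℝ (v δ t) (K δ t - K 0 t)) U (𝓝 0) := by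
    have h2 : Tendsto (fun δ => Real.sqrt M * Real.sqrt (∫ t in Ioc 0 T, ‖K δ t - K 0 t‖ ^ 2)) U
        (𝓝 0) := by
      have := (hstrong.mono_left hU).sqrt.const_mul (Real.sqrt M)
      simpa using this
    refine squeeze_zero_norm' ?_ h2
    filter_upwards [hU hmem] with δ hδ
    have hd := (hKm δ hδ).sub (hKm 0 h01)
    have h3 := abs_real_inner_le_norm ((hv δ).toLp (v δ)) (hd.toLp _)
    rw [inner_toLp_time] at h3
    refine h3.trans (mul_le_mul ?_ ?_ (norm_nonneg _) (Real.sqrt_nonneg _))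
    · exact Real.le_sqrt_of_sq_le (by rw [norm_sq_toLp_time]; exact hM δ)
    · exact Real.le_sqrt_of_sq_le (by rw [norm_sq_toLp_time]; rfl)
  have h2 := h1.add (hweak _ (hKm 0 h01))
  rw [zero_add] at h2
  refine h2.congr' ?_
  filter_upwards [hU hmem] with δ hδ
  have i1 : Integrable (fun t => inner ℝ (v δ t) (K δ t - K 0 t)) (timeMeasure T) :=
    MemLp.integrable_inner_two (hv δ) ((hKm δ hδ).sub (hKm 0 h01))
  rw [← integral_add i1 (MemLp.integrable_inner_two (hv δ) (hKm 0 h01))]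
  refine integral_congr_ae (ae_of_all _ fun t => ?_)
  simp only []
  rw [← inner_add_right, sub_add_cancel]

end WeakLimits

/-! ### The limit of the modified problems -/

namespace H4

open ContinuousLinearMap (adjoint)

lemma eventually_mem_Icc : ∀ᶠ δ in 𝓝[>] (0 : ℝ), δ ∈ Icc (0 : ℝ) 1 :=
  mem_of_superset (Ioc_mem_nhdsGT zero_lt_one) Ioc_subset_Icc_self

lemma zero_mem_Icc : (0 : ℝ) ∈ Icc (0 : ℝ) 1 := by simp

/-- Strong convergence of multiplication operators whose symbol depends continuously on `δ`. -/
lemma tendsto_mulOp_zero {m : ℝ → ℝ × ℝ → ℝ} {C : ℝ}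
    (hm : ∀ δ ∈ Icc (0 : ℝ) 1, IsMultiplier (m δ) C)
    (hc : ∀ p, Continuous fun δ => m δ p) (f : L2) :
    Tendsto (fun δ => mulOp (m δ) f) (𝓝[>] 0) (𝓝 (mulOp (m 0) f)) :=
  tendsto_mulOp (eventually_mem_Icc.mono hm) (hm 0 zero_mem_Icc)
    (fun p => ((hc p).tendsto 0).mono_left nhdsWithin_le_nhds) f

lemma tendsto_opLt (g : H4) (f : L2) :
    Tendsto (fun δ => opLt (wt 1) δ g f) (𝓝[>] 0) (𝓝 (opLt (wt 1) 0 g f)) := by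
  obtain ⟨C, -, hb⟩ := exists_coefficient_bound
  have hb' := fun δ hδ => hb (wt 1) δ (isAdmissible_wt hδ)
  have hmul : ∀ {m : ℝ → Smooth}, (∀ p, Continuous fun δ => (m δ).1 p) →
      ∀ p, Continuous fun δ => (wt 1 * m δ).1 p := fun hm p => continuous_const.mul (hm p)
  have c0 : ∀ p, Continuous fun δ => (mu δ).1 p := fun p =>
    ((continuous_wt p).mul (continuous_wt p)).mul continuous_const
  have c1 := isWtPoly_dx_mu.continuous
  have c2 : ∀ p, Continuous fun δ => (wt δ * wt δ).1 p := fun p =>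
    (continuous_wt p).mul (continuous_wt p)
  have c3 : ∀ p, Continuous fun δ => (2 * wt δ * dy (wt δ)).1 p := fun p =>
    (continuous_const.mul (continuous_wt p)).mul (isWtPoly_dy_wt.continuous p)
  have c4 : ∀ p, Continuous fun δ => (wt δ * dy (dy (wt δ))).1 p := fun p =>
    (continuous_wt p).mul (isWtPoly_dy_dy_wt.continuous p)
  have t0 := fun f => tendsto_mulOp_zero (m := fun δ => (wt 1 * mu δ).1) (fun δ _ =>
    .of_continuous (wt 1 * mu δ).continuous (abs_wt_mul_mu_le δ)) (hmul c0) f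
  have t1 := fun f => tendsto_mulOp_zero (m := fun δ => (wt 1 * dx (mu δ)).1)
    (fun δ hδ => (hb' δ hδ).1) (hmul c1) f
  have t2 := fun f => tendsto_mulOp_zero (m := fun δ => (wt 1 * (wt δ * wt δ)).1)
    (fun δ hδ => (hb' δ hδ).2.1) (hmul c2) f
  have t3 := fun f => tendsto_mulOp_zero (m := fun δ => (wt 1 * (2 * wt δ * dy (wt δ))).1)
    (fun δ hδ => (hb' δ hδ).2.2.1) (hmul c3) f
  have t4 := fun f => tendsto_mulOp_zero (m := fun δ => (wt 1 * (wt δ * dy (dy (wt δ)))).1)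
    (fun δ hδ => (hb' δ hδ).2.2.2.1) (hmul c4) f
  have hR : Tendsto (fun δ => opRt (wt 1) δ f) (𝓝[>] 0) (𝓝 (opRt (wt 1) 0 f)) :=
    (((adjoint D10).continuous.tendsto _).comp (t0 f)).add
      (((adjoint incl).continuous.tendsto _).comp ((t1 f).const_smul (1 / 2 : ℝ)))
  have hQ : ∀ f, Tendsto (fun δ => opQt (wt 1) δ f) (𝓝[>] 0) (𝓝 (opQt (wt 1) 0 f)) := fun f =>
    ((((adjoint D02).continuous.tendsto _).comp (t2 f)).add
      (((adjoint D01).continuous.tendsto _).comp (t3 f))).add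
      (((adjoint incl).continuous.tendsto _).comp (t4 f))
  exact hR.sub (hQ (coefOp g f))

lemma tendsto_opEt (f : L2) : Tendsto (fun δ => opEt δ f) (𝓝[>] 0) (𝓝 (opEt 0 f)) := by
  obtain ⟨C, -, hb⟩ := exists_coefficient_bound
  have t0 := tendsto_mulOp_zero (m := fun δ => (wt δ).1) (fun δ _ => isMultiplier_weight δ)
    continuous_wt f
  have t1 := tendsto_mulOp_zero (m := fun δ => (dy (wt δ)).1)
    (fun δ hδ => (hb _ _ (isAdmissible_wt hδ)).2.2.2.2) isWtPoly_dy_wt.continuous f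
  exact (((adjoint D01).continuous.tendsto _).comp t0).add
    (((adjoint incl).continuous.tendsto _).comp t1)

lemma exists_opLt_bound : ∃ C : ℝ, 0 ≤ C ∧ ∀ δ ∈ Icc (0 : ℝ) 1, ∀ g : H4, ‖g‖ ≤ 1 / 8 →
    ∀ f, ‖opLt (wt 1) δ g f‖ ≤ C * ‖f‖ := by
  obtain ⟨C, hC, hb⟩ := exists_opL_bound
  exact ⟨C, hC, fun δ hδ g hg f => norm_le_of_inner_eq hC
    (fun u => (opL (wt 1) δ g).le_of_opNorm_le (hb δ hδ g hg) u)
    fun u => inner_opL (isAdmissible_wt hδ) g u f⟩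

lemma exists_opEt_bound : ∃ C : ℝ, 0 ≤ C ∧ ∀ δ ∈ Icc (0 : ℝ) 1, ∀ f, ‖opEt δ f‖ ≤ C * ‖f‖ := by
  obtain ⟨C, hC, hb⟩ := exists_coefficient_bound
  refine ⟨1 + C, by linarith, fun δ hδ f => norm_le_of_inner_eq (by linarith) (fun u => ?_)
    fun u => inner_opE hδ u f⟩
  have a0 : IsMultiplier (wt δ).1 1 := isMultiplier_weight δ
  have a1 := (hb _ _ (isAdmissible_wt hδ)).2.2.2.2
  have e1 : opE δ u = mulOp (wt δ).1 (D01 u) + mulOp (dy (wt δ)).1 (incl u) := rfl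
  have h1 := a0.norm_mulOp_apply_le (D01 u)
  have h2 := a1.norm_mulOp_apply_le (incl u)
  have h3 : ‖D01 u‖ ≤ ‖u‖ := norm_D_le _ u
  have h4 : C * ‖incl u‖ ≤ C * ‖u‖ := mul_le_mul_of_nonneg_left (norm_D_le _ u) (by linarith)
  rw [e1]
  refine (norm_add_le _ _).trans ?_
  linarith

lemma opE_zero (u : H4) : opE 0 u = D01 u := by
  have e1 : opE 0 u = mulOp (wt 0).1 (D01 u) + mulOp (dy (wt 0)).1 (incl u) := rfl
  have a0 : IsMultiplier (wt 0).1 1 := isMultiplier_weight 0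
  have a1 : IsMultiplier (dy (wt 0)).1 0 := by
    refine .of_continuous (dy (wt 0)).continuous fun p => ?_
    rw [dy_wt]
    change |-(0 * _ * _)| ≤ (0 : ℝ)
    simp
  have h1 : mulOp (dy (wt 0)).1 (incl u) = 0 := by
    have := a1.norm_mulOp_apply_le (incl u)
    rw [zero_mul] at this
    exact norm_le_zero_iff.1 this
  rw [e1, h1, add_zero]
  refine Lp.ext ?_
  filter_upwards [a0.coeFn_mulOp (D01 u)] with p hp
  rw [hp]
  change weight 0 p * _ = _
  rw [weight_zero, one_mul]

end H4

/-! ### Passage to the limit along ultrafilters -/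

section Limit

open ContinuousLinearMap (adjoint)

variable {T M : ℝ} {g : ℝ → H4} {U : Ultrafilter ℝ} {v : ℝ → ℝ → H4} {V : ℝ → H4}

lemma IsCoefficient.aestronglyMeasurable_opLt (hg : IsCoefficient T g) (δ : ℝ) {f : ℝ → L2}
    (hf : AEStronglyMeasurable f (timeMeasure T)) :
    AEStronglyMeasurable (fun t => H4.opLt (wt 1) δ (g t) (f t)) (timeMeasure T) := by
  have hc : Continuous fun q : H4 × L2 => H4.opLt (wt 1) δ q.1 q.2 :=
    ((H4.continuous_opLt (wt 1) δ).comp continuous_fst).clm_apply continuous_snd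
  exact hc.comp_aestronglyMeasurable (f := fun t => (g t, f t)) (hg.1.prodMk hf)

/-- The spatial operators of the modified problems pass to the limit along weakly convergent
families. -/
lemma tendsto_integral_opL (hU : (U : Filter ℝ) ≤ 𝓝[>] 0) (hg : IsCoefficient T g)
    (hv : ∀ δ, MemLp (v δ) 2 (timeMeasure T)) (hM : ∀ δ, ∫ t in Ioc 0 T, ‖v δ t‖ ^ 2 ≤ M)
    (hweak : ∀ k : ℝ → H4, MemLp k 2 (timeMeasure T) →
        Tendsto (fun δ => ∫ t in Ioc 0 T, inner ℝ (v δ t) (k t)) U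
          (𝓝 (∫ t in Ioc 0 T, inner ℝ (V t) (k t))))
    {f : ℝ → L2} (hf : MemLp f 2 (timeMeasure T)) :
    Tendsto (fun δ => ∫ t in Ioc 0 T, inner ℝ (H4.opL (wt 1) δ (g t) (v δ t)) (f t)) U
      (𝓝 (∫ t in Ioc 0 T, inner ℝ (H4.opL (wt 1) 0 (g t) (V t)) (f t))) := by
  obtain ⟨C, -, hC⟩ := H4.exists_opLt_bound
  have h := tendsto_integral_inner hU hv hM hweak
    (K := fun δ t => H4.opLt (wt 1) δ (g t) (f t)) (k := fun t => C * ‖f t‖) (hf.norm.const_mul C)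
    (fun δ _ => hg.aestronglyMeasurable_opLt δ hf.1)
    (fun δ hδ => by filter_upwards [hg.2] with t ht using hC δ hδ _ ht.le _)
    (ae_of_all _ fun t => H4.tendsto_opLt (g t) (f t))
  simp only [← H4.inner_opL (isAdmissible_wt H4.zero_mem_Icc)] at h
  refine h.congr' ?_
  filter_upwards [hU H4.eventually_mem_Icc] with δ hδ
  simp only [← H4.inner_opL (isAdmissible_wt hδ)]

lemma tendsto_integral_opE (hU : (U : Filter ℝ) ≤ 𝓝[>] 0)
    (hv : ∀ δ, MemLp (v δ) 2 (timeMeasure T)) (hM : ∀ δ, ∫ t in Ioc 0 T, ‖v δ t‖ ^ 2 ≤ M)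
    (hweak : ∀ k : ℝ → H4, MemLp k 2 (timeMeasure T) →
        Tendsto (fun δ => ∫ t in Ioc 0 T, inner ℝ (v δ t) (k t)) U
          (𝓝 (∫ t in Ioc 0 T, inner ℝ (V t) (k t))))
    {f : ℝ → L2} (hf : MemLp f 2 (timeMeasure T)) :
    Tendsto (fun δ => ∫ t in Ioc 0 T, inner ℝ (H4.opE δ (v δ t)) (f t)) U
      (𝓝 (∫ t in Ioc 0 T, inner ℝ (H4.opE 0 (V t)) (f t))) := by
  obtain ⟨C, -, hC⟩ := H4.exists_opEt_bound
  have h := tendsto_integral_inner hU hv hM hweak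
    (K := fun δ t => H4.opEt δ (f t)) (k := fun t => C * ‖f t‖) (hf.norm.const_mul C)
    (fun δ _ => (H4.opEt δ).continuous.comp_aestronglyMeasurable hf.1)
    (fun δ hδ => ae_of_all _ fun t => hC δ hδ _)
    (ae_of_all _ fun t => H4.tendsto_opEt (f t))
  simp only [← H4.inner_opE H4.zero_mem_Icc] at h
  refine h.congr' ?_
  filter_upwards [hU H4.eventually_mem_Icc] with δ hδ
  simp only [← H4.inner_opE hδ]

/-- Bounded operators preserve weak convergence in `L²` of time. -/
lemma tendsto_integral_clm {H : Type*} [NormedAddCommGroup H] [InnerProductSpace ℝ H]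
    [CompleteSpace H] (B : H4 →L[ℝ] H)
    (hweak : ∀ k : ℝ → H4, MemLp k 2 (timeMeasure T) →
        Tendsto (fun δ => ∫ t in Ioc 0 T, inner ℝ (v δ t) (k t)) U
          (𝓝 (∫ t in Ioc 0 T, inner ℝ (V t) (k t))))
    {f : ℝ → H} (hf : MemLp f 2 (timeMeasure T)) :
    Tendsto (fun δ => ∫ t in Ioc 0 T, inner ℝ (B (v δ t)) (f t)) U
      (𝓝 (∫ t in Ioc 0 T, inner ℝ (B (V t)) (f t))) := by
  simpa only [Function.comp_apply, ContinuousLinearMap.adjoint_inner_right] using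
    hweak _ ((adjoint B).comp_memLp' hf)

lemma integral_inner_indicator {F : ℝ → L2} {t : ℝ} (ht : t ≤ T) (hF : IntegrableOn F (Ioc 0 T))
    (f : L2) : ∫ s in Ioc 0 T, inner ℝ (F s) ((Ioc 0 t).indicator (fun _ => f) s)
      = inner ℝ (∫ s in Ioc 0 t, F s) f := by
  have hs : Ioc 0 t ⊆ Ioc 0 T := Ioc_subset_Ioc_right ht
  have e : ∫ s in Ioc 0 t, inner ℝ (F s) f
      = ∫ s in Ioc 0 T, (Ioc 0 t).indicator (fun s => inner ℝ (F s) f) s := by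
    rw [setIntegral_indicator measurableSet_Ioc, inter_eq_self_of_subset_right hs]
  rw [inner_setIntegral (hF.mono_set hs), e]
  refine integral_congr_ae (ae_of_all _ fun s => ?_)
  by_cases h : s ∈ Ioc 0 t
  · simp only [indicator_of_mem h]
  · simp only [indicator_of_notMem h, inner_zero_right]

lemma isMild_iff {δ t : ℝ} {v₀ : H4} {w : ℝ → H4} : IsMild δ g v₀ w t ↔ H4.weightedIncl (w t)
      = mulOp (weight 1) (mulOp (weight δ) (H4.incl v₀))
        - ∫ s in Ioc 0 t, H4.opL (wt 1) δ (g s) (w s) := Iff.rfl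

lemma tendsto_initial_value (v₀ : H4) :
    Tendsto (fun δ => mulOp (weight 1) (mulOp (weight δ) (H4.incl v₀))) (𝓝[>] 0)
      (𝓝 (mulOp (weight 1) (mulOp (weight 0) (H4.incl v₀)))) :=
  ((mulOp (weight 1)).continuous.tendsto _).comp
    (H4.tendsto_mulOp_zero (fun δ _ => H4.isMultiplier_weight δ) continuous_wt _)

/-- A weak limit in `L²` of time of solutions of the modified problems solves the integrated
equation with `δ = 0`. -/
lemma isMild_of_tendsto (hT : 0 ≤ T) (hU : (U : Filter ℝ) ≤ 𝓝[>] 0) (hg : IsCoefficient T g)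
    {v₀ : H4} (hv : ∀ δ, MemLp (v δ) 2 (timeMeasure T))
    (hM : ∀ δ, ∫ t in Ioc 0 T, ‖v δ t‖ ^ 2 ≤ M) (hV : MemLp V 2 (timeMeasure T))
    (hweak : ∀ k : ℝ → H4, MemLp k 2 (timeMeasure T) →
        Tendsto (fun δ => ∫ t in Ioc 0 T, inner ℝ (v δ t) (k t)) U
          (𝓝 (∫ t in Ioc 0 T, inner ℝ (V t) (k t))))
    (hmild : ∀ δ ∈ Ioc (0 : ℝ) 1, ∀ t ∈ Icc 0 T, IsMild δ g v₀ (v δ) t) :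
    ∀ᵐ t ∂timeMeasure T, IsMild 0 g v₀ V t := by
  have hF := fun δ {w : ℝ → H4} (hw : MemLp w 2 (timeMeasure T)) => hg.integrableOn_opL (wt 1) δ hw
  have hJV : MemLp (fun t => H4.weightedIncl (V t)) 2 (timeMeasure T) :=
    H4.weightedIncl.comp_memLp' hV
  refine eq_primitive_of_weak hT (hJV.integrable (by norm_num)) (hF 0 hV) fun η hη hc hs =>
    ext_inner_right ℝ fun f => ?_
  have hd : Continuous (deriv η) := hη.continuous_deriv (by simp)
  have m1 : MemLp (fun t => η t • f) 2 (timeMeasure T) :=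
    (hη.continuous.smul continuous_const : Continuous fun _ => _ • _).memLp_time _ _
  have m2 : MemLp (fun t => deriv η t • f) 2 (timeMeasure T) :=
    (hd.smul continuous_const : Continuous fun _ => _ • _).memLp_time _ _
  have hηT : η T • f = 0 := by
    rw [image_eq_zero_of_notMem_tsupport fun h => lt_irrefl T (hs h), zero_smul]
  have hder : ∀ t, HasDerivAt (fun t => η t • f) (deriv η t • f) t := fun t =>
    (hη.differentiable (by simp) t).hasDerivAt.smul_const f
  have hmem : ∀ᶠ δ in (U : Filter ℝ), δ ∈ Ioc (0 : ℝ) 1 := hU (Ioc_mem_nhdsGT zero_lt_one)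
  have l1 := (tendsto_integral_opL hU hg hv hM hweak m1).sub
    (tendsto_integral_clm H4.weightedIncl hweak m2)
  have l2 := ((tendsto_initial_value v₀).mono_left hU).inner
    (𝕜 := ℝ) (tendsto_const_nhds (x := η 0 • f))
  have e : ∀ᶠ δ in (U : Filter ℝ),
      (∫ t in Ioc 0 T, inner ℝ (H4.opL (wt 1) δ (g t) (v δ t)) (η t • f))
        - ∫ t in Ioc 0 T, inner ℝ (H4.weightedIncl (v δ t)) (deriv η t • f)
      = inner ℝ (mulOp (weight 1) (mulOp (weight δ) (H4.incl v₀))) (η 0 • f) := by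
    filter_upwards [hmem] with δ hδ
    obtain ⟨i1, i2, h⟩ := integral_by_parts hT (z := fun t => H4.weightedIncl (v δ t))
      (z₀ := mulOp (weight 1) (mulOp (weight δ) (H4.incl v₀))) (hF δ (hv δ)) (by
        filter_upwards [ae_restrict_mem measurableSet_Ioc] with t ht
        exact hmild δ hδ t ⟨ht.1.le, ht.2⟩) hder (hd.smul continuous_const) hηT
    rw [← h, integral_sub i1 i2]
  have key := tendsto_nhds_unique (l1.congr' e) l2
  have hi1 : IntegrableOn (fun t => η t • H4.opL (wt 1) 0 (g t) (V t)) (Ioc 0 T) :=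
    memLp_one_iff_integrable.1 (memLp_continuous_smul hη.continuous
      (memLp_one_iff_integrable.2 (hF 0 hV)))
  have hi2 : IntegrableOn (fun t => deriv η t • H4.weightedIncl (V t)) (Ioc 0 T) :=
    (memLp_continuous_smul hd hJV).integrable (by norm_num)
  simp only [real_inner_smul_right] at key
  change inner ℝ (∫ t in Ioc 0 T, (η t • H4.opL (wt 1) 0 (g t) (V t)
    - deriv η t • H4.weightedIncl (V t))) f = _
  rw [integral_sub hi1 hi2, inner_sub_left, inner_setIntegral hi1, inner_setIntegral hi2,
    real_inner_smul_left]
  simp only [real_inner_smul_left]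
  exact key

/-- Solutions of the modified problems have weak limits, at every time, that solve the problem
with `δ = 0`. -/
theorem exists_limit (hT : 0 ≤ T) (hU : (U : Filter ℝ) ≤ 𝓝[>] 0) (hg : IsCoefficient T g)
    {v₀ : H4} {d : ℝ → ℝ → H4} {N : ℝ} (hv : ∀ δ, AEStronglyMeasurable (v δ) (timeMeasure T))
    (hM : ∀ δ, ∀ t ∈ Icc 0 T, ‖v δ t‖ ≤ M) (hd : ∀ δ, MemLp (d δ) 2 (timeMeasure T))
    (hN : ∀ δ, ∫ t in Ioc 0 T, ‖d δ t‖ ^ 2 ≤ N)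
    (hE : ∀ δ ∈ Ioc (0 : ℝ) 1, ∀ᵐ t ∂timeMeasure T, H4.opE δ (v δ t) = H4.incl (d δ t))
    (hmild : ∀ δ ∈ Ioc (0 : ℝ) 1, ∀ t ∈ Icc 0 T, IsMild δ g v₀ (v δ) t) :
    ∃ w e : ℝ → H4, AEStronglyMeasurable w (timeMeasure T) ∧ (∀ t ∈ Icc 0 T, ‖w t‖ ≤ M) ∧
      MemLp e 2 (timeMeasure T) ∧ (∫ t in Ioc 0 T, ‖e t‖ ^ 2 ≤ N) ∧
      (∀ᵐ t ∂timeMeasure T, H4.opE 0 (w t) = H4.incl (e t)) ∧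
      (∀ t ∈ Icc 0 T, IsMild 0 g v₀ w t) ∧
      ∀ t ∈ Icc 0 T, ∀ h, Tendsto (fun δ => inner ℝ (v δ t) h) U (𝓝 (inner ℝ (w t) h)) := by
  have hv2 : ∀ δ, MemLp (v δ) 2 (timeMeasure T) := fun δ => memLp_of_bound_time 2 (hv δ) (hM δ)
  have hM2 : ∀ δ, ∫ t in Ioc 0 T, ‖v δ t‖ ^ 2 ≤ ∫ t in Ioc 0 T, M ^ 2 := by
    intro δ
    refine setIntegral_mono_on ((hv2 δ).integrable_norm_pow (by simp)) (by simp) measurableSet_Ioc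
      fun t ht => ?_
    have := hM δ t ⟨ht.1.le, ht.2⟩
    gcongr
  obtain ⟨V, hV, -, hweak⟩ := exists_weak_limit_time U hv2 hM2
  obtain ⟨e, he, heN, hweak_e⟩ := exists_weak_limit_time U hd hN
  have hpt : ∀ t, ∃ x : H4, t ∈ Icc 0 T → ‖x‖ ≤ M ∧
      ∀ h, Tendsto (fun δ => inner ℝ (v δ t) h) U (𝓝 (inner ℝ x h)) := by
    intro t
    by_cases ht : t ∈ Icc 0 T
    · obtain ⟨x, hx⟩ := exists_weak_limit U fun δ => hM δ t ht
      exact ⟨x, fun _ => hx⟩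
    · exact ⟨0, fun h => absurd h ht⟩
  choose w hw using hpt
  have hmem : ∀ᶠ δ in (U : Filter ℝ), δ ∈ Ioc (0 : ℝ) 1 := hU (Ioc_mem_nhdsGT zero_lt_one)
  have hVm := isMild_of_tendsto hT hU hg hv2 hM2 hV hweak hmild
  have hwV : ∀ t ∈ Icc 0 T, H4.weightedIncl (w t)
      = mulOp (weight 1) (mulOp (weight 0) (H4.incl v₀))
        - ∫ s in Ioc 0 t, H4.opL (wt 1) 0 (g s) (V s) := by
    intro t ht
    refine ext_inner_right ℝ fun f => ?_
    have hf : MemLp ((Ioc 0 t).indicator fun _ => f) 2 (timeMeasure T) :=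
      (memLp_const f).indicator measurableSet_Ioc
    have l1 := (((tendsto_initial_value v₀).mono_left hU).inner (𝕜 := ℝ)
      (tendsto_const_nhds (x := f))).sub (tendsto_integral_opL hU hg hv2 hM2 hweak hf)
    have l2 := (hw t ht).2 (adjoint H4.weightedIncl f)
    simp only [ContinuousLinearMap.adjoint_inner_right] at l2
    rw [inner_sub_left, ← integral_inner_indicator ht.2 (hg.integrableOn_opL _ _ hV)]
    refine tendsto_nhds_unique l2 (l1.congr' ?_)
    filter_upwards [hmem] with δ hδ
    rw [integral_inner_indicator ht.2 (hg.integrableOn_opL _ _ (hv2 δ)), ← inner_sub_left,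
      isMild_iff.1 (hmild δ hδ t ht)]
  have hwV' : w =ᵐ[timeMeasure T] V := by
    filter_upwards [hVm, ae_restrict_mem measurableSet_Ioc] with t h1 ht
    refine H4.weighted_incl_injective ?_
    rw [← H4.weightedIncl_apply, hwV t ⟨ht.1.le, ht.2⟩, h1]
  refine ⟨w, e, hV.1.congr hwV'.symm, fun t ht => (hw t ht).1, he, heN, ?_, fun t ht => ?_,
    fun t ht => (hw t ht).2⟩
  · -- the difference of the two sides is orthogonal to itself
    have hEV : MemLp (fun t => H4.opE 0 (V t)) 2 (timeMeasure T) := (H4.opE 0).comp_memLp' hV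
    have hIe : MemLp (fun t => H4.incl (e t)) 2 (timeMeasure T) := H4.incl.comp_memLp' he
    set k : ℝ → L2 := fun t => H4.opE 0 (V t) - H4.incl (e t) with hk
    have hkm : MemLp k 2 (timeMeasure T) := hEV.sub hIe
    have l1 := tendsto_integral_opE hU hv2 hM2 hweak hkm
    have l2 := tendsto_integral_clm H4.incl hweak_e hkm
    have h1 := tendsto_nhds_unique l1 (l2.congr' (by
      filter_upwards [hmem] with δ hδ
      refine integral_congr_ae ?_
      filter_upwards [hE δ hδ] with t ht
      rw [ht]))
    have h2 : ∫ t in Ioc 0 T, ‖k t‖ ^ 2 = 0 := by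
      have i1 : Integrable (fun t => inner ℝ (H4.opE 0 (V t)) (k t)) (timeMeasure T) :=
        MemLp.integrable_inner_two hEV hkm
      have i2 : Integrable (fun t => inner ℝ (H4.incl (e t)) (k t)) (timeMeasure T) :=
        MemLp.integrable_inner_two hIe hkm
      refine Eq.trans ?_ (sub_eq_zero.2 h1)
      rw [← integral_sub i1 i2]
      refine integral_congr_ae (ae_of_all _ fun t => ?_)
      exact (real_inner_self_eq_norm_sq (k t)).symm.trans (inner_sub_left _ _ _)
    rw [integral_eq_zero_iff_of_nonneg (fun t => sq_nonneg _)
      (hkm.integrable_norm_pow (by simp))] at h2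
    filter_upwards [h2, hwV'] with t ht1 ht2
    rw [ht2]
    exact sub_eq_zero.1 (norm_eq_zero.1 (pow_eq_zero_iff two_ne_zero |>.1 ht1))
  · rw [isMild_iff, hwV t ht]
    congr 1
    refine setIntegral_congr_ae measurableSet_Ioc ?_
    have := (ae_restrict_iff' measurableSet_Ioc).1 hwV'
    filter_upwards [this] with s hs h1
    rw [hs (Ioc_subset_Ioc_right ht.2 h1)]

end Limit

/-! ### Solutions defined at every time -/

section Uniqueness

variable {T δ M : ℝ} {g v w : ℝ → H4} {v₀ : H4}

lemma isCoefficient_of_eLpNorm_le (hg : MemLp g ∞ (volume.restrict (Icc 0 T)))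
    (h : eLpNorm g ∞ (volume.restrict (Icc 0 T)) ≤ ENNReal.ofReal (1 / 16)) :
    IsCoefficient T g := by
  have hs : timeMeasure T ≤ volume.restrict (Icc 0 T) :=
    Measure.restrict_mono Ioc_subset_Icc_self le_rfl
  refine ⟨hg.1.mono_measure hs, ?_⟩
  refine (ae_restrict_of_ae_restrict_of_subset Ioc_subset_Icc_self ?_ : ∀ᵐ t ∂timeMeasure T, _)
  filter_upwards [enorm_ae_le_eLpNormEssSup g (volume.restrict (Icc 0 T))] with t ht
  rw [← eLpNorm_exponent_top] at ht
  have h1 := ht.trans h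
  rw [← ofReal_norm, ENNReal.ofReal_le_ofReal_iff (by norm_num)] at h1
  linarith

/-- Weak solutions agree with a bounded solution of the integrated equation. -/
lemma IsModifiedWeakSolution.ae_eq (hT : 0 ≤ T) (hg : IsCoefficient T g)
    (hδ : δ ∈ Icc (0 : ℝ) 1) (hw : IsModifiedWeakSolution δ T g v₀ w)
    (hv : AEStronglyMeasurable v (timeMeasure T)) (hM : ∀ t ∈ Icc 0 T, ‖v t‖ ≤ M)
    (h : ∀ t ∈ Icc 0 T, IsMild δ g v₀ v t) : w =ᵐ[timeMeasure T] v := by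
  refine IsMild.unique hg hδ (hw.1.mono_exponent le_top) (memLp_of_bound_time 2 hv hM)
    (hw.isMild hT hg hδ) ?_
  filter_upwards [ae_restrict_mem measurableSet_Ioc] with t ht using h t ⟨ht.1.le, ht.2⟩

lemma isModifiedWeakSolution_of_forall_isMild (hT : 0 ≤ T) (hg : IsCoefficient T g)
    (hδ : δ ∈ Icc (0 : ℝ) 1) (hv : AEStronglyMeasurable v (timeMeasure T))
    (hM : ∀ t ∈ Icc 0 T, ‖v t‖ ≤ M) (h : ∀ t ∈ Icc 0 T, IsMild δ g v₀ v t) :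
    IsModifiedWeakSolution δ T g v₀ v := by
  refine isModifiedWeakSolution_of_isMild hT hg hδ (memLp_of_bound_time ∞ hv hM) ?_
  filter_upwards [ae_restrict_mem measurableSet_Ioc] with t ht using h t ⟨ht.1.le, ht.2⟩

/-- Solutions of the integrated equation at all times are unique at all times. -/
lemma IsMild.unique_of_forall (hg : IsCoefficient T g) (hδ : δ ∈ Icc (0 : ℝ) 1)
    (hv : MemLp v 2 (timeMeasure T)) (hw : MemLp w 2 (timeMeasure T))
    (h : ∀ t ∈ Icc 0 T, IsMild δ g v₀ v t) (h' : ∀ t ∈ Icc 0 T, IsMild δ g v₀ w t) :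
    ∀ t ∈ Icc 0 T, v t = w t := by
  have hae : v =ᵐ[timeMeasure T] w := by
    refine IsMild.unique (v₀ := v₀) hg hδ hv hw ?_ ?_
    · filter_upwards [ae_restrict_mem measurableSet_Ioc] with t ht using h t ⟨ht.1.le, ht.2⟩
    · filter_upwards [ae_restrict_mem measurableSet_Ioc] with t ht using h' t ⟨ht.1.le, ht.2⟩
  intro t ht
  refine H4.weighted_incl_injective ?_
  rw [h t ht, h' t ht]
  congr 1
  refine setIntegral_congr_ae measurableSet_Ioc ?_
  filter_upwards [(ae_restrict_iff' measurableSet_Ioc).1 hae] with s hs h1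
  rw [hs (Ioc_subset_Ioc_right ht.2 h1)]

/-- The integrated equation with `δ = 0` contains the initial condition. -/
lemma IsMild.apply_zero (h : IsMild 0 g v₀ v 0) : v 0 = v₀ := by
  refine H4.weighted_incl_injective ?_
  have h0 : weight 0 = fun _ => 1 := funext weight_zero
  have h1 := h
  rw [IsMild, Ioc_self, Measure.restrict_empty, integral_zero_measure, sub_zero, h0, mulOp_one]
    at h1
  exact h1

end Uniqueness

end

theorem proposition3p2 :
    ∃ ε₀ : ℝ, 0 < ε₀ ∧ ∃ δ₀ : ℝ, 0 < δ₀ ∧ ∀ T : ℝ, 0 < T → ∃ B₀ : ℝ, 0 < B₀ ∧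
      ∀ (v₀ : H4) (g : ℝ → H4),
        MemLp g ∞ (volume.restrict (Icc 0 T)) →
        eLpNorm g ∞ (volume.restrict (Icc 0 T)) ≤ ENNReal.ofReal ε₀ →
        ‖v₀‖ ≤ ε₀ →
        ∃ v : ℝ → H4,
          -- `v` is the unique weak solution (up to null sets of times)
          IsWeakSolution T g v₀ v ∧
          (∀ w : ℝ → H4, IsWeakSolution T g v₀ w → w =ᵐ[volume.restrict (Ioc 0 T)] v) ∧
          -- and it is represented by its weakly continuous version
          WeaklyContinuous T v ∧ v 0 = v₀ ∧
          -- energy bound, with `dv = ∂_y v` in `L²(]0, T]; H⁴)`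
          (∃ dv : ℝ → H4, MemLp dv 2 (volume.restrict (Ioc 0 T)) ∧
            (∀ᵐ s ∂(volume.restrict (Ioc 0 T)), HasWeakDeriv 0 1 (v s).fn (dv s).fn) ∧
            ∀ t ∈ Ioc 0 T, ‖v t‖ ^ 2 + 1 / 4 * ∫ s in Ioc 0 t, ‖dv s‖ ^ 2 ≤ B₀ * ‖v₀‖ ^ 2) ∧
          -- `v` is the weak limit of the unique solutions of the modified problems
          ∃ vm : ℝ → ℝ → H4,
            (∀ δ ∈ Ioc 0 δ₀,
              IsModifiedWeakSolution δ T g v₀ (vm δ) ∧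
              (∀ w : ℝ → H4, IsModifiedWeakSolution δ T g v₀ w →
                w =ᵐ[volume.restrict (Ioc 0 T)] vm δ) ∧
              WeaklyContinuous T (vm δ)) ∧
            ∀ t ∈ Icc 0 T, ∀ h : H4,
              Tendsto (fun δ => inner ℝ (vm δ t) h) (𝓝[>] 0) (𝓝 (inner ℝ (v t) h)) := by
  -- `ε₀ = 1/16` makes `‖g(t)‖ < 1/8`; the initial value need not be small, the problem being linear
  refine ⟨1 / 16, by norm_num, 1, one_pos, fun T hT => ?_⟩
  obtain ⟨C, hC, hex⟩ := exists_mild_of_pos hT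
  refine ⟨2 * C, by positivity, fun v₀ g hgm hgn _ => ?_⟩
  have hg := isCoefficient_of_eLpNorm_le hgm hgn
  -- solutions of the modified problems; values `δ ∉ ]0, 1]` are irrelevant
  have hall : ∀ δ : ℝ, ∃ v d : ℝ → H4,
      AEStronglyMeasurable v (timeMeasure T) ∧ MemLp d 2 (timeMeasure T) ∧
      (∀ t ∈ Icc 0 T, ‖v t‖ ≤ Real.sqrt (C * ‖v₀‖ ^ 2)) ∧
      (∫ t in Ioc 0 T, ‖d t‖ ^ 2) ≤ C * ‖v₀‖ ^ 2 ∧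
      (δ ∈ Ioc (0 : ℝ) 1 → ∀ᵐ t ∂timeMeasure T, H4.opE δ (v t) = H4.incl (d t)) ∧
      (δ ∈ Ioc (0 : ℝ) 1 → ∀ t ∈ Icc 0 T, IsMild δ g v₀ v t) := by
    intro δ
    by_cases hδ : δ ∈ Ioc (0 : ℝ) 1
    · obtain ⟨v, d, h1, h2, h3, h4, h5, h6⟩ := hex δ hδ g hg v₀
      exact ⟨v, d, h1, h2, fun t ht => Real.le_sqrt_of_sq_le (h3 t ht), h4, fun _ => h5,
        fun _ => h6⟩
    · refine ⟨fun _ => 0, fun _ => 0, aestronglyMeasurable_const, MemLp.zero, fun t _ => ?_, ?_,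
        fun h => absurd h hδ, fun h => absurd h hδ⟩
      · rw [norm_zero]
        exact Real.sqrt_nonneg _
      · simp only [norm_zero, ne_eq, OfNat.ofNat_ne_zero, not_false_eq_true, zero_pow,
          integral_zero]
        positivity
  choose vm d hvm hd hM hN hE hmild using hall
  obtain ⟨v, dv, hv, hvM, hdv, hdvN, hvE, hvmild, -⟩ := exists_limit hT.le
    (Ultrafilter.of_le (𝓝[>] (0 : ℝ))) hg hvm hM hd hN hE hmild
  have h0 : (0 : ℝ) ∈ Icc (0 : ℝ) 1 := H4.zero_mem_Icc
  have hv2 := memLp_of_bound_time 2 hv hvM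
  refine ⟨v, isWeakSolution_iff.2 (isModifiedWeakSolution_of_forall_isMild hT.le hg h0 hv hvM
    hvmild), fun w hw => (isWeakSolution_iff.1 hw).ae_eq hT.le hg h0 hv hvM hvmild,
    weaklyContinuous_of_isMild hg hv hvM hvmild, (hvmild 0 ⟨le_rfl, hT.le⟩).apply_zero,
    ⟨dv, hdv, ?_, fun t ht => ?_⟩, vm, fun δ hδ => ?_, fun t ht h => ?_⟩
  · filter_upwards [hvE] with s hs
    rw [H4.opE_zero] at hs
    have h1 := (v s).hasWeakDeriv ⟨(0, 1), by decide⟩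
    rw [H4.fn_eq (dv s), ← hs]
    exact h1
  · have h1 : ‖v t‖ ^ 2 ≤ C * ‖v₀‖ ^ 2 := by
      rw [← Real.sq_sqrt (show 0 ≤ C * ‖v₀‖ ^ 2 by positivity)]
      have := hvM t ⟨ht.1.le, ht.2⟩
      gcongr
    have h2 : ∫ s in Ioc 0 t, ‖dv s‖ ^ 2 ≤ ∫ s in Ioc 0 T, ‖dv s‖ ^ 2 :=
      setIntegral_mono_set (hdv.integrable_norm_pow (by simp)) (ae_of_all _ fun s => sq_nonneg _)
        (Ioc_subset_Ioc_right ht.2).eventuallyLE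
    have h3 : 0 ≤ C * ‖v₀‖ ^ 2 := by positivity
    linarith
  · have hδ' : δ ∈ Icc (0 : ℝ) 1 := ⟨hδ.1.le, hδ.2⟩
    exact ⟨isModifiedWeakSolution_of_forall_isMild hT.le hg hδ' (hvm δ) (hM δ) (hmild δ hδ),
      fun w hw => hw.ae_eq hT.le hg hδ' (hvm δ) (hM δ) (hmild δ hδ),
      weaklyContinuous_of_isMild hg (hvm δ) (hM δ) (hmild δ hδ)⟩
  · -- every ultrafilter yields a limit, and all these limits agree by uniqueness
    refine (tendsto_iff_ultrafilter _ _ _).2 fun U hU => ?_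
    obtain ⟨w, -, hw, hwM, -, -, -, hwmild, hlim⟩ := exists_limit hT.le hU hg hvm hM hd hN hE hmild
    rw [IsMild.unique_of_forall hg h0 hv2 (memLp_of_bound_time 2 hw hwM) hvmild hwmild t ht]
    exact hlim t ht h
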